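/- **Setting.** Let $\Gamma$ be an infinite chain of rings of unit radius touching at the points with coordinates $j\pi$, $j\in\mathbb Z$; it is parametrized by two copies of $\mathbb R$ (upper and lower semicircles), so $L^2(\Gamma)=L^2(\mathbb R)\oplus L^2(\mathbb R)$. Fix $A,\alpha\in\mathbb R$. For a real sequence $\boldsymbol\alpha=(\alpha_j)_{j\in\mathbb Z}$ with finitely many distinct values, $-\Delta_{\boldsymbol\alpha}$ is the operator in $L^2(\Gamma)$ acting as $-\mathcal D^2$ on every edge, with $\mathcal D=\frac{d}{dx}+iA$ on the upper and $\mathcal D=\frac{d}{dx}-iA$ on the lower semicircles; its domain consists of the functions $(\psi,\varphi)\in L^2(\Gamma)$ that are $H^2$ on each edge $(j\pi,(j+1)\pi)$, with $(\mathcal D^2\psi,\mathcal D^2\varphi)\in L^2(\Gamma)$, and that satisfy at each vertex $j\pi$ the $\delta$-coupling: all four boundary values agree (with common value $\psi(j\pi)$), and $\mathcal D\psi(j\pi^+)+\mathcal D\varphi(j\pi^+)-\mathcal D\psi(j\pi^-)-\mathcal D\varphi(j\pi^-)=\alpha_j\psi(j\pi)$. Write $-\Delta_\alpha$ for the operator with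 all $\alpha_j=\alpha$, and, for $m\in\mathbb N$ and real $\gamma_1,\dots,\gamma_m$, write $-\Delta_{\alpha+\varepsilon\gamma}$ for the one with $\alpha_j=\alpha+\varepsilon\gamma_j$ for $1\le j\le m$ and $\alpha_j=\alpha$ otherwise. Put $S=\sum_{j=1}^m\gamma_j$ and $$\xi(k)=\frac1{\cos A\pi}\Big(\cos k\pi+\frac{\alpha}{4k}\sin k\pi\Big)$$ (with $\frac{\sin k\pi}{k}:=\pi$ at $k=0$). For $E\in\mathbb R$ the momentum is $k=\sqrt E$ if $E\ge0$ and $k=i\sqrt{-E}$ if $E<0$. A gap of a closed set $\sigma\subset\mathbb R$ is a connected component of $\mathbb R\setminus\sigma$; gaps are numbered $1,2,\dots$ from left to right, the first one being the unbounded component below $\sigma$. **Theorem (Magnetic case, weak coupling).** Suppose that $A\notin\mathbb Z$ and $A-\frac12\notin\mathbb Z$. 1. For every $\varepsilon\in(0,1)$ the essential spectrum of $-\Delta_{\alpha+\varepsilon\gamma}$ coincides with that of $-\Delta_\alpha$. Its gaps form an infinite sequence $G_1,G_2,\dots$ ordered from left to right, and the energies $E=k^2\in\mathbb R$ with $|\xi(k)|=1$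 form an infinite strictly increasing sequence $k_1^2<k_2^2<\dots$. 2. If $S<0$, there is $\varepsilon_0>0$ such that for all $\varepsilon\in(0,\varepsilon_0)$ the operator $-\Delta_{\alpha+\varepsilon\gamma}$ has exactly one eigenvalue in every odd gap $G_n$ ($n$ odd), and this eigenvalue is simple. If $S>0$, the same holds for every even gap $G_n$ ($n$ even). 3. In both cases let $k_{n,\varepsilon}^2$ be the eigenvalue in $G_n$ (with $n$ odd if $S<0$, and $n$ even if $S>0$). For each such $n$ with $k_n\ne0$, $$k_{n,\varepsilon}=k_n-\xi(k_n)\,K_n\,\varepsilon^2+\mathcal O(\varepsilon^3),\qquad\varepsilon\to0^+,$$ where $\xi(k_n)\in\{1,-1\}$ and $$K_n=\frac{\sin (k_n\pi)\;S^2}{\cos (A\pi)\,\big(32k_n^2\pi-8\alpha k_n\pi\cot (k_n\pi)+8\alpha\big)}.$$ -/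

import Mathlib

open MeasureTheory Set Filter Topology Asymptotics

noncomputable section

/-! ### Self-adjoint operators: eigenvalues, essential spectrum, gaps -/

/-- The eigenspace of a (partially defined) linear operator `T` at `z`. -/
def opEigenspace {H : Type*} [AddCommGroup H] [Module ℂ H] (T : H →ₗ.[ℂ] H) (z : ℂ) :
    Submodule ℂ H :=
  (LinearMap.ker (T.toFun - z • T.domain.subtype)).map T.domain.subtype

/-- `E` is an eigenvalue of `T`. -/
def IsOpEigenvalue {H : Type*} [AddCommGroup H] [Module ℂ H] (T : H →ₗ.[ℂ] H) (E : ℝ) : Prop :=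
  opEigenspace T (E : ℂ) ≠ ⊥

/-- `E` is a simple eigenvalue of `T`: its eigenspace is one-dimensional. -/
def IsSimpleOpEigenvalue {H : Type*} [AddCommGroup H] [Module ℂ H] (T : H →ₗ.[ℂ] H)
    (E : ℝ) : Prop :=
  Module.finrank ℂ (opEigenspace T (E : ℂ)) = 1

/-- The (real) essential spectrum of an operator, through singular Weyl sequences: normalized
sequences in the domain which tend weakly to zero and along which `(T - E) u` tends to zero. -/
def essSpectrum {H : Type*} [NormedAddCommGroup H] [InnerProductSpace ℂ H] (T : H →ₗ.[ℂ] H) :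
    Set ℝ :=
  {E | ∃ u : ℕ → T.domain, (∀ n, ‖(u n : H)‖ = 1) ∧
      (∀ w : H, Tendsto (fun n => inner ℂ w (u n : H)) atTop (𝓝 0)) ∧
      Tendsto (fun n => T (u n) - (E : ℂ) • (u n : H)) atTop (𝓝 0)}

/-- A gap of a set `S ⊆ ℝ` is a connected component of its complement (the unbounded component
below `S` counts as a gap). -/
def IsGap (S : Set ℝ) (I : Set ℝ) : Prop :=
  ∃ x ∈ Sᶜ, I = connectedComponentIn Sᶜ x

/-- `G 1, G 2, …` are all the gaps of `S`, listed from the left to the right. -/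
def EnumeratesGaps (S : Set ℝ) (G : ℕ+ → Set ℝ) : Prop :=
  (∀ I, IsGap S I ↔ ∃ n, G n = I) ∧
    ∀ m n, m < n → ∀ x ∈ G m, ∀ y ∈ G n, x < y

/-! ### Functions of class `H²` on an interval -/

/-- `f` is (the `C¹` representative of) an element of the Sobolev space `H²(a, b)`, with
derivative `f₁` and second derivative `f₂`. The values at `a` and `b` are the boundary values. -/
structure IsH2On (a b : ℝ) (f f₁ f₂ : ℝ → ℂ) : Prop where
  memLp : MemLp f₂ 2 (volume.restrict (Ioo a b))
  value : ∀ x ∈ Icc a b, f x = f a + ∫ t in a..x, f₁ t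
  deriv : ∀ x ∈ Icc a b, f₁ x = f₁ a + ∫ t in a..x, f₂ t

namespace IsH2On

variable {a b : ℝ} {f f₁ f₂ g g₁ g₂ : ℝ → ℂ}

theorem integrableOn (h : IsH2On a b f f₁ f₂) : IntegrableOn f₂ (Icc a b) := by
  rw [integrableOn_Icc_iff_integrableOn_Ioo]
  exact h.memLp.integrable (by norm_num)

theorem continuousOn_deriv (h : IsH2On a b f f₁ f₂) : ContinuousOn f₁ (Icc a b) := by
  rcases le_or_gt a b with hab | hab
  · have hc : ContinuousOn (fun x => f₁ a + ∫ t in a..x, f₂ t) (Icc a b) := by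
      have := intervalIntegral.continuousOn_primitive_interval (a := a) (b := b) (f := f₂)
        (μ := volume) (by rw [uIcc_of_le hab]; exact h.integrableOn)
      rw [uIcc_of_le hab] at this
      exact continuousOn_const.add this
    exact hc.congr h.deriv
  · simp [Icc_eq_empty_of_lt hab]

theorem continuousOn (h : IsH2On a b f f₁ f₂) : ContinuousOn f (Icc a b) := by
  rcases le_or_gt a b with hab | hab
  · have hc : ContinuousOn (fun x => f a + ∫ t in a..x, f₁ t) (Icc a b) := by
      have := intervalIntegral.continuousOn_primitive_interval (a := a) (b := b) (f := f₁)
        (μ := volume) (by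
          rw [uIcc_of_le hab]; exact h.continuousOn_deriv.integrableOn_compact isCompact_Icc)
      rw [uIcc_of_le hab] at this
      exact continuousOn_const.add this
    exact hc.congr h.value
  · simp [Icc_eq_empty_of_lt hab]

theorem intervalIntegrable₁ (h : IsH2On a b f f₁ f₂) {x : ℝ} (hx : x ∈ Icc a b) :
    IntervalIntegrable f₁ volume a x := by
  rw [intervalIntegrable_iff_integrableOn_Icc_of_le hx.1]
  exact (h.continuousOn_deriv.integrableOn_compact isCompact_Icc).mono_set
    (Icc_subset_Icc_right hx.2)

theorem intervalIntegrable₂ (h : IsH2On a b f f₁ f₂) {x : ℝ} (hx : x ∈ Icc a b) :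
    IntervalIntegrable f₂ volume a x := by
  rw [intervalIntegrable_iff_integrableOn_Icc_of_le hx.1]
  exact h.integrableOn.mono_set (Icc_subset_Icc_right hx.2)

theorem zero : IsH2On a b 0 0 0 where
  memLp := MemLp.zero
  value := by simp
  deriv := by simp

theorem add (h : IsH2On a b f f₁ f₂) (h' : IsH2On a b g g₁ g₂) :
    IsH2On a b (f + g) (f₁ + g₁) (f₂ + g₂) where
  memLp := h.memLp.add h'.memLp
  value x hx := by
    simp only [Pi.add_apply]
    rw [intervalIntegral.integral_add (h.intervalIntegrable₁ hx) (h'.intervalIntegrable₁ hx),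
      h.value x hx, h'.value x hx]
    ring
  deriv x hx := by
    simp only [Pi.add_apply]
    rw [intervalIntegral.integral_add (h.intervalIntegrable₂ hx) (h'.intervalIntegrable₂ hx),
      h.deriv x hx, h'.deriv x hx]
    ring

theorem smul (c : ℂ) (h : IsH2On a b f f₁ f₂) : IsH2On a b (c • f) (c • f₁) (c • f₂) where
  memLp := h.memLp.const_smul c
  value x hx := by
    simp only [Pi.smul_apply]
    rw [intervalIntegral.integral_smul, h.value x hx, smul_add]
  deriv x hx := by
    simp only [Pi.smul_apply]
    rw [intervalIntegral.integral_smul, h.deriv x hx, smul_add]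

theorem eq_zero_of_integral (hab : a < b) {p q : ℝ → ℂ} (hp : ∀ x ∈ Icc a b, p x = 0)
    (hq : IntegrableOn q (Icc a b))
    (hpq : ∀ x ∈ Icc a b, p x = p a + ∫ t in a..x, q t) :
    q =ᵐ[volume.restrict (Ioo a b)] 0 := by
  have hint : ∀ x ∈ Icc a b, ∫ t in a..x, q t = 0 := by
    intro x hx
    have := hpq x hx
    rw [hp x hx, hp a (left_mem_Icc.2 hab.le), zero_add] at this
    exact this.symm
  have hII : IntervalIntegrable q volume a b := by
    rwa [intervalIntegrable_iff_integrableOn_Icc_of_le hab.le]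
  have hae := hII.ae_hasDerivAt_integral
  rw [Filter.EventuallyEq, ae_restrict_iff' measurableSet_Ioo]
  filter_upwards [hae] with x hx hxI
  have hxI' : x ∈ uIcc a b := by rw [uIcc_of_le hab.le]; exact Ioo_subset_Icc_self hxI
  have h1 := hx hxI' a left_mem_uIcc
  have h2 : HasDerivAt (fun y => ∫ t in a..y, q t) 0 x := by
    refine (hasDerivAt_const x (0 : ℂ)).congr_of_eventuallyEq ?_
    filter_upwards [isOpen_Ioo.mem_nhds hxI] with y hy
    exact hint y (Ioo_subset_Icc_self hy)
  simpa using h1.unique h2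

theorem eqOn_zero_of_ae (hab : a < b) {p : ℝ → ℂ} (hc : ContinuousOn p (Icc a b))
    (h0 : p =ᵐ[volume.restrict (Ioo a b)] 0) : ∀ x ∈ Icc a b, p x = 0 := by
  have h1 : EqOn p 0 (Icc a b) := by
    refine Measure.eqOn_Icc_of_ae_eq (μ := volume) hab.ne ?_ hc continuousOn_const
    rwa [restrict_Ioo_eq_restrict_Icc] at h0
  exact fun x hx => h1 hx

theorem all_zero (hab : a < b) (h : IsH2On a b f f₁ f₂)
    (h0 : f =ᵐ[volume.restrict (Ioo a b)] 0) :
    (∀ x ∈ Icc a b, f x = 0) ∧ (∀ x ∈ Icc a b, f₁ x = 0) ∧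
      f₂ =ᵐ[volume.restrict (Ioo a b)] 0 := by
  have hf := eqOn_zero_of_ae hab h.continuousOn h0
  have hf₁ := eqOn_zero_of_ae hab h.continuousOn_deriv
    (eq_zero_of_integral hab hf (h.continuousOn_deriv.integrableOn_compact isCompact_Icc) h.value)
  exact ⟨hf, hf₁, eq_zero_of_integral hab hf₁ h.integrableOn h.deriv⟩

end IsH2On

/-! ### The magnetic chain graph -/

/-- The state space `L²(Γ)` of the chain of rings of unit radius; `Γ` is parametrized by two
copies of the real line, number `0` for the upper and number `1` for the lower semicircles. -/
abbrev ChainSpace : Type := PiLp 2 (fun _ : Fin 2 => Lp ℂ 2 (volume : Measure ℝ))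

/-- The coordinate `jπ` of the `j`-th vertex (touching point of two rings). -/
def vertexPt (j : ℤ) : ℝ := j * Real.pi

/-- The quasiderivative is `d/dx + iA` on the upper and `d/dx - iA` on the lower semicircles. -/
def fieldSign (A : ℝ) : Fin 2 → ℝ := ![A, -A]

/-- The quasiderivative `f' + i a f` of a function `f` with derivative `f₁`. -/
def quasiDeriv (a : ℝ) (f f₁ : ℝ → ℂ) : ℝ → ℂ := fun x => f₁ x + Complex.I * a * f x

/-- `u` lies in the domain of the magnetic Laplacian on the chain, with `δ`-couplings of strength
`α j` at the vertices `jπ`, and the operator sends `u` to `v`. The function `f s j` is the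
component of `u` on the edge `(jπ, (j+1)π)` of the line number `s`. -/
def IsChainPair (A : ℝ) (α : ℤ → ℝ) (u v : ChainSpace) : Prop :=
  ∃ f f₁ f₂ : Fin 2 → ℤ → ℝ → ℂ,
    (∀ s j, IsH2On (vertexPt j) (vertexPt (j + 1)) (f s j) (f₁ s j) (f₂ s j)) ∧
    (∀ s j, (u s : ℝ → ℂ) =ᵐ[volume.restrict (Ioo (vertexPt j) (vertexPt (j + 1)))] f s j) ∧
    (∀ s j, (v s : ℝ → ℂ) =ᵐ[volume.restrict (Ioo (vertexPt j) (vertexPt (j + 1)))]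
      -quasiDeriv (fieldSign A s) (quasiDeriv (fieldSign A s) (f s j) (f₁ s j))
        (quasiDeriv (fieldSign A s) (f₁ s j) (f₂ s j))) ∧
    (∀ s j, f s j (vertexPt j) = f 0 j (vertexPt j) ∧
      f s (j - 1) (vertexPt j) = f 0 j (vertexPt j)) ∧
    (∀ j, ∑ s, (quasiDeriv (fieldSign A s) (f s j) (f₁ s j) (vertexPt j) -
        quasiDeriv (fieldSign A s) (f s (j - 1)) (f₁ s (j - 1)) (vertexPt j)) =
      α j * f 0 j (vertexPt j))

theorem quasiDeriv_add (a : ℝ) (f f₁ g g₁ : ℝ → ℂ) :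
    quasiDeriv a (f + g) (f₁ + g₁) = quasiDeriv a f f₁ + quasiDeriv a g g₁ := by
  funext x; simp only [quasiDeriv, Pi.add_apply]; ring

theorem quasiDeriv_smul (a : ℝ) (c : ℂ) (f f₁ : ℝ → ℂ) :
    quasiDeriv a (c • f) (c • f₁) = c • quasiDeriv a f f₁ := by
  funext x; simp only [quasiDeriv, Pi.smul_apply, smul_eq_mul]; ring

theorem quasiDeriv_zero (a : ℝ) : quasiDeriv a 0 0 = 0 := by
  funext x; simp [quasiDeriv]

/-- The graph of the magnetic Laplacian. -/
def chainGraph (A : ℝ) (α : ℤ → ℝ) : Submodule ℂ (ChainSpace × ChainSpace) where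
  carrier := {p | IsChainPair A α p.1 p.2}
  zero_mem' := by
    refine ⟨0, 0, 0, fun s j => IsH2On.zero, fun s j => ?_, fun s j => ?_, ?_, ?_⟩
    · exact ae_restrict_of_ae (Lp.coeFn_zero ℂ 2 volume)
    · simp only [Pi.zero_apply, quasiDeriv_zero, neg_zero]
      exact ae_restrict_of_ae (Lp.coeFn_zero ℂ 2 volume)
    · simp
    · simp [quasiDeriv_zero]
  add_mem' := by
    rintro ⟨u, v⟩ ⟨u', v'⟩ ⟨f, f₁, f₂, h1, h2, h3, h4, h5⟩ ⟨g, g₁, g₂, k1, k2, k3, k4, k5⟩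
    refine ⟨f + g, f₁ + g₁, f₂ + g₂, fun s j => (h1 s j).add (k1 s j), fun s j => ?_,
      fun s j => ?_, fun s j => ?_, fun j => ?_⟩
    · filter_upwards [h2 s j, k2 s j, ae_restrict_of_ae (Lp.coeFn_add (u s) (u' s))]
        with x hx hx' hs
      change ((u s + u' s : Lp ℂ 2 (volume : Measure ℝ)) : ℝ → ℂ) x = _
      rw [hs]; simp only [Pi.add_apply]; rw [← hx, ← hx']
    · filter_upwards [h3 s j, k3 s j, ae_restrict_of_ae (Lp.coeFn_add (v s) (v' s))]
        with x hx hx' hs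
      change ((v s + v' s : Lp ℂ 2 (volume : Measure ℝ)) : ℝ → ℂ) x = _
      simp only [Pi.add_apply, quasiDeriv_add] at hs ⊢
      rw [hs, hx, hx']
      simp only [Pi.neg_apply, Pi.add_apply]; ring
    · simp only [Pi.add_apply]
      exact ⟨by rw [(h4 s j).1, (k4 s j).1], by rw [(h4 s j).2, (k4 s j).2]⟩
    · have := congrArg₂ (· + ·) (h5 j) (k5 j)
      simp only [Pi.add_apply, quasiDeriv_add, Fin.sum_univ_two] at this ⊢
      rw [mul_add, ← this]; ring
  smul_mem' := by
    rintro c ⟨u, v⟩ ⟨f, f₁, f₂, h1, h2, h3, h4, h5⟩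
    refine ⟨c • f, c • f₁, c • f₂, fun s j => (h1 s j).smul c, fun s j => ?_,
      fun s j => ?_, fun s j => ?_, fun j => ?_⟩
    · filter_upwards [h2 s j, ae_restrict_of_ae (Lp.coeFn_smul c (u s))] with x hx hs
      change ((c • u s : Lp ℂ 2 (volume : Measure ℝ)) : ℝ → ℂ) x = _
      rw [hs]; simp only [Pi.smul_apply]; rw [← hx]
    · filter_upwards [h3 s j, ae_restrict_of_ae (Lp.coeFn_smul c (v s))] with x hx hs
      change ((c • v s : Lp ℂ 2 (volume : Measure ℝ)) : ℝ → ℂ) x = _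
      simp only [Pi.smul_apply, quasiDeriv_smul] at hs ⊢
      rw [hs, hx]
      simp
    · simp only [Pi.smul_apply]
      exact ⟨by rw [(h4 s j).1], by rw [(h4 s j).2]⟩
    · have := congrArg (c * ·) (h5 j)
      simp only [Pi.smul_apply, quasiDeriv_smul, Fin.sum_univ_two, smul_eq_mul] at this ⊢
      rw [mul_left_comm, ← this]; ring

theorem iUnion_edges_ae {p : ℝ → Prop}
    (h : ∀ j : ℤ, ∀ᵐ x ∂volume.restrict (Ioo (vertexPt j) (vertexPt (j + 1))), p x) :
    ∀ᵐ x, p x := by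
  have h' : ∀ j : ℤ, ∀ᵐ x ∂volume.restrict (Ico (vertexPt j) (vertexPt (j + 1))), p x := by
    intro j; rw [← restrict_Ioo_eq_restrict_Ico]; exact h j
  rw [← Measure.restrict_univ (μ := (volume : Measure ℝ))]
  have hU : (univ : Set ℝ) = ⋃ j : ℤ, Ico (vertexPt j) (vertexPt (j + 1)) := by
    refine (eq_univ_of_forall fun x => mem_iUnion.2 ⟨⌊x / Real.pi⌋, ?_⟩).symm
    have hpi := Real.pi_pos
    constructor
    · have := Int.floor_le (x / Real.pi)
      simpa [vertexPt] using (le_div_iff₀ hpi).1 this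
    · have := Int.lt_floor_add_one (x / Real.pi)
      simpa [vertexPt] using (div_lt_iff₀ hpi).1 this
  rw [hU, ae_restrict_iUnion_eq]
  simpa using h'

theorem chainGraph_single_valued (A : ℝ) (α : ℤ → ℝ) :
    ∀ x ∈ chainGraph A α, x.1 = 0 → x.2 = 0 := by
  rintro ⟨u, v⟩ ⟨f, f₁, f₂, h1, h2, h3, -, -⟩ hu
  simp only at hu
  subst hu
  ext s : 1
  change v s = 0
  rw [Lp.eq_zero_iff_ae_eq_zero]
  refine iUnion_edges_ae fun j => ?_
  have hlt : vertexPt j < vertexPt (j + 1) := by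
    simp only [vertexPt, Int.cast_add, Int.cast_one]; nlinarith [Real.pi_pos]
  have hz : f s j =ᵐ[volume.restrict (Ioo (vertexPt j) (vertexPt (j + 1)))] 0 :=
    (h2 s j).symm.trans (ae_restrict_of_ae (Lp.coeFn_zero ℂ 2 volume))
  obtain ⟨z0, z1, z2⟩ := (h1 s j).all_zero hlt hz
  filter_upwards [h3 s j, z2, ae_restrict_mem measurableSet_Ioo] with x hx hx2 hxI
  rw [hx]
  simp [quasiDeriv, z0 x (Ioo_subset_Icc_self hxI), z1 x (Ioo_subset_Icc_self hxI), hx2]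

/-- The magnetic Laplacian `-Δ_α` on the chain graph, as an unbounded operator in `L²(Γ)`. -/
def chainLaplacian (A : ℝ) (α : ℤ → ℝ) : ChainSpace →ₗ.[ℂ] ChainSpace :=
  (chainGraph A α).toLinearPMap

/-- The operator `chainLaplacian A α` has the graph it was built from. -/
theorem chainLaplacian_graph (A : ℝ) (α : ℤ → ℝ) :
    (chainLaplacian A α).graph = chainGraph A α :=
  Submodule.toLinearPMap_graph_eq _ (chainGraph_single_valued A α)

/-- The constant coupling `α`, changed to `α + ε γ j` at the vertices `j = 1, …, m`. -/
def perturbedCoupling (α : ℝ) (m : ℕ) (γ : ℤ → ℝ) (ε : ℝ) : ℤ → ℝ :=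
  fun j => if j ∈ Finset.Icc (1 : ℤ) m then α + ε * γ j else α

/-! ### The quantities in the expansion -/

/-- The momentum `k` with `k ^ 2 = E`, positive for `E > 0` and `iκ`, `κ > 0`, for `E < 0`. -/
def momentum (E : ℝ) : ℂ :=
  if 0 ≤ E then (√E : ℂ) else Complex.I * (√(-E) : ℂ)

/-- `ξ(k) = (cos kπ + α/(4k) sin kπ) / cos Aπ`, extended to `k = 0` by continuity. -/
def chainXi (A α : ℝ) (k : ℂ) : ℂ :=
  (Complex.cos (k * Real.pi) +
    α / 4 * (if k = 0 then (Real.pi : ℂ) else Complex.sin (k * Real.pi) / k)) /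
      (Real.cos (A * Real.pi) : ℂ)

/-- The coefficient `K` at the momentum `k`, for `S = ∑ γ j`. -/
def chainK (A α S : ℝ) (k : ℂ) : ℂ :=
  Complex.sin (k * Real.pi) * (S : ℂ) ^ 2 /
    ((Real.cos (A * Real.pi) : ℂ) *
      (32 * k ^ 2 * Real.pi - 8 * α * k * Real.pi * Complex.cot (k * Real.pi) + 8 * α))

/-- In the weak coupling limit there is exactly one eigenvalue in each of the gaps `G n` with
`n ∈ P`, this eigenvalue is simple, and its momentum has the second order expansion
`k_n - ξ(k_n) K_n ε² + O(ε³)` at the band edge `k_n² = e n`, if `k_n ≠ 0`. The first part holds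
for all these gaps at once as soon as `ε` is small enough. -/
def WeakCouplingEigenvalues (A α : ℝ) (m : ℕ) (γ : ℤ → ℝ) (G : ℕ+ → Set ℝ) (e : ℕ+ → ℝ)
    (P : Set ℕ+) : Prop :=
  ∃ ev : ℕ+ → ℝ → ℝ,
    (∃ ε₀ > (0 : ℝ), ∀ ε ∈ Ioo 0 ε₀, ∀ n ∈ P,
      ev n ε ∈ G n ∧
      IsSimpleOpEigenvalue (chainLaplacian A (perturbedCoupling α m γ ε)) (ev n ε) ∧
      ∀ E ∈ G n, IsOpEigenvalue (chainLaplacian A (perturbedCoupling α m γ ε)) E → E = ev n ε) ∧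
    ∀ n ∈ P, e n ≠ 0 →
      (fun ε : ℝ => momentum (ev n ε) - (momentum (e n) - chainXi A α (momentum (e n)) *
        chainK A α (∑ j ∈ Finset.Icc (1 : ℤ) m, γ j) (momentum (e n)) * (ε : ℂ) ^ 2))
        =O[𝓝[>] 0] fun ε : ℝ => ε ^ 3

end

/-! ### Integration by parts and Green's identity on an edge -/

/-! The problem reduces to a scalar difference equation on the vertices. On an edge a gauge factor
removes the magnetic field, and Green's identity against the solutions `sin kt / k` of the free
equation expresses the one-sided derivatives through the values at the two ends. Inserted into the
δ-condition, this gives for the nodal values `x` the equation `2 cos(Aπ) (x (j+1) + x (j-1)) = (4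
cos kπ + α j sin kπ / k) x j`, up to an error controlled by `(T - E) u`
(`exists_norm_nodeResidual_sq_le`). When `sin kπ / k ≠ 0` the nodal values and `(T - E) u` control
`u` (`exists_edgeMass_le`), and conversely every square summable sequence with square summable
residual is lifted to an element of the domain (`exists_chainPair_of_nodes`).

Essential spectrum. The unperturbed equation is `x (j+1) + x (j-1) = 2 ξ x j`. For `|ξ| ≤ 1` long
truncated plane waves give Weyl sequences. For `|ξ| > 1` the difference operator is bounded below on
`ℓ²`, and finitely many perturbed nodes do not matter because nodal values are weakly continuous.
Zeros of `sin kπ / k` carry eigenfunctions supported on two rings, arbitrarily far out, for every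
choice of couplings. Hence the essential spectrum is described by `bandDisc` and `bandSin` alone
(`essSpectrum_chainLaplacian`).

Gaps. Between two consecutive zeros of `sin kπ / k` the function `(cos kπ - c) / (sin kπ / k)` is
strictly decreasing in the energy for `|c| ≤ 1` (`strictAntiOn_bandSlope`). So the discriminant `cos
kπ + α sin kπ / (4k)`, up to sign, crosses each level in `(-1, 1)` exactly once there
(`exists_bandEdge`), and each such interval contains one odd gap at its left and one even gap at its
right.

Eigenvalues. In a gap write `2 ξ = λ + 1/λ` with `|λ| < 1`. The eigenvalues are the zeros of a
secular function built from the solution decaying at `-∞` (`isOpEigenvalue_iff_transfer`); up to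
signs it is `1 - l² + b l W(l², b l)` with `l = |λ|`, `b` proportional to `ε |sin kπ / k|` and `W` a
polynomial with `W(1, 0) = ± S`. For small `b` a zero satisfies `|ξ| - 1 = b² S² / 8 + O(b³)`, and
`(|ξ| - 1) / b` is Lipschitz in `b` along the zeros (`exists_secular_bounds`). Existence is the
intermediate value theorem between the band edge, where the secular function is negative exactly
under the right sign of `S`, and a point further away where it is positive. Uniqueness comes from
the Lipschitz bound: `(|ξ| - 1) / b` is `1/ε` times an affine function of the monotone slope above,
which in turn controls `b`, so two zeros satisfy a contraction estimate with factor `O(ε²)`. All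
constants are uniform in the gap, because `sin kπ / k` is bounded on half-lines to the right and the
eigenvalues are bounded below (`exists_gap_eigenvalues`).

Expansion. The estimate for `|ξ| - 1` says that the discriminant at the eigenvalue differs from its
edge value by a multiple of `ε² (sin kπ / k)²`, up to `O(ε³)`. Since the discriminant has nonzero
derivative at the edge, it can be inverted there (`momentum_expansion`), and `edge_coefficient`
identifies the result with `-ξ K`. -/

theorem absolutelyContinuousOnInterval_primitive {a b : ℝ} {q : ℝ → ℂ}
    (hq : IntervalIntegrable q volume a b) :
    AbsolutelyContinuousOnInterval (fun x => ∫ t in a..x, q t) a b := by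
  have hc : ∀ z : ℂ, AbsolutelyContinuousOnInterval (fun _ : ℝ => z) a b := fun z =>
    (contDiffOn_const (c := z)).absolutelyContinuousOnInterval
  have hre : IntervalIntegrable (fun t => (q t).re) volume a b := ⟨hq.1.re, hq.2.re⟩
  have him : IntervalIntegrable (fun t => (q t).im) volume a b := ⟨hq.1.im, hq.2.im⟩
  have h1 := (hre.absolutelyContinuousOnInterval_intervalIntegral (c := a) left_mem_uIcc).smul
    (hc 1)
  have h2 := (him.absolutelyContinuousOnInterval_intervalIntegral (c := a) left_mem_uIcc).smul
    (hc Complex.I)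
  have h3 := h1.add h2
  -- The definition only evaluates the function at points of the interval, so it suffices that the
  -- recombined real and imaginary parts agree with the integral there.
  rw [absolutelyContinuousOnInterval_iff] at h3 ⊢
  intro ε hε
  obtain ⟨δ, hδ, h⟩ := h3 ε hε
  refine ⟨δ, hδ, fun E hE hE' => ?_⟩
  have key : ∀ x ∈ uIcc a b, (∫ t in a..x, q t) =
      (((fun x => ∫ t in a..x, (q t).re) : ℝ → ℝ) • ((fun _ => (1 : ℂ)) : ℝ → ℂ) +
        ((fun x => ∫ t in a..x, (q t).im) : ℝ → ℝ) • ((fun _ => Complex.I) : ℝ → ℂ)) x := by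
    intro x hx
    have hqx : IntervalIntegrable q volume a x := hq.mono_set (uIcc_subset_uIcc_left hx)
    have e1 : ∫ t in a..x, q t = ∫ t in a..x, (((q t).re : ℂ) + ((q t).im : ℂ) * Complex.I) :=
      intervalIntegral.integral_congr fun t _ => (Complex.re_add_im (q t)).symm
    have i1 : IntervalIntegrable (fun t => ((q t).re : ℂ)) volume a x :=
      ⟨hqx.1.re.ofReal, hqx.2.re.ofReal⟩
    have i2 : IntervalIntegrable (fun t => ((q t).im : ℂ)) volume a x :=
      ⟨hqx.1.im.ofReal, hqx.2.im.ofReal⟩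
    rw [e1, intervalIntegral.integral_add i1 (i2.mul_const _), intervalIntegral.integral_mul_const,
      intervalIntegral.integral_ofReal, intervalIntegral.integral_ofReal]
    simp
  convert h E hE hE' using 1
  refine Finset.sum_congr rfl fun i hi => ?_
  rw [← key _ (hE.1 i hi).1, ← key _ (hE.1 i hi).2]

/-- Since `q` is merely integrable, the product is differentiable only almost everywhere. The
difference of the product and the primitive of its formal derivative is absolutely continuous with
derivative zero almost everywhere, hence constant. -/
theorem mul_sub_mul_eq_integral {a b : ℝ} {p q w w₁ : ℝ → ℂ} (hq : IntegrableOn q (Icc a b))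
    (hp : ∀ x ∈ Icc a b, p x = p a + ∫ t in a..x, q t) (hw : ∀ x, HasDerivAt w (w₁ x) x)
    (hw₁ : Continuous w₁) {x : ℝ} (hx : x ∈ Icc a b) :
    p x * w x - p a * w a = ∫ t in a..x, (q t * w t + p t * w₁ t) := by
  have hax : a ≤ x := hx.1
  have hqx : IntervalIntegrable q volume a x := by
    rw [intervalIntegrable_iff_integrableOn_Icc_of_le hax]
    exact hq.mono_set (Icc_subset_Icc_right hx.2)
  have hwc : Continuous w := continuous_iff_continuousAt.2 fun y => (hw y).continuousAt
  -- Nothing is known about `p` outside `Icc a b`, so the argument is run for the primitive `P` and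
  -- transferred at the end.
  set P : ℝ → ℂ := fun y => p a + ∫ t in a..y, q t with hP
  have hPac : AbsolutelyContinuousOnInterval P a x :=
    (contDiffOn_const (c := p a)).absolutelyContinuousOnInterval.add
      (absolutelyContinuousOnInterval_primitive hqx)
  have hwd : ContDiff ℝ 1 w := by
    rw [contDiff_one_iff_deriv]
    refine ⟨fun y => (hw y).differentiableAt, ?_⟩
    have : deriv w = w₁ := funext fun y => (hw y).deriv
    rwa [this]
  have hprod : AbsolutelyContinuousOnInterval (P • w) a x :=
    hPac.smul hwd.contDiffOn.absolutelyContinuousOnInterval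
  have hInt : IntervalIntegrable (fun t => q t * w t + P t * w₁ t) volume a x :=
    (hqx.mul_continuousOn hwc.continuousOn).add
      (hPac.continuousOn.mul hw₁.continuousOn).intervalIntegrable
  have hdiff := hprod.sub (absolutelyContinuousOnInterval_primitive hInt)
  obtain ⟨C, hC⟩ := hdiff.const_of_ae_hasDerivAt_zero (by
    filter_upwards [hqx.ae_hasDerivAt_integral, hInt.ae_hasDerivAt_integral] with y h1 h2 hy
    have d1 := (((h1 hy a left_mem_uIcc).const_add (p a)).mul (hw y)).sub (h2 hy a left_mem_uIcc)
    refine d1.congr_deriv ?_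
    have hPy : P y = p a + ∫ t in a..y, q t := rfl
    rw [hPy]
    ring)
  have hA := hC a left_mem_uIcc
  have hX := hC x right_mem_uIcc
  have e := hX.trans hA.symm
  simp only [Pi.sub_apply, smul_eq_mul, Pi.mul_apply,
    intervalIntegral.integral_same, sub_zero] at e
  have hPa : P a = p a := by simp [hP]
  have hPx : P x = p x := (hp x hx).symm
  have hcongr : ∫ t in a..x, (q t * w t + p t * w₁ t) = ∫ t in a..x, (q t * w t + P t * w₁ t) := by
    refine intervalIntegral.integral_congr fun t ht => ?_
    rw [uIcc_of_le hax] at ht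
    simp only [hP, hp t ⟨ht.1, ht.2.trans hx.2⟩]
  rw [hcongr, ← hPx, ← hPa]
  linear_combination e

/-- The gauge factor on an edge which starts at `a`. -/
noncomputable def gaugeFactor (c a x : ℝ) : ℂ := Complex.exp (Complex.I * c * ((x - a : ℝ) : ℂ))

theorem gaugeFactor_self (c a : ℝ) : gaugeFactor c a a = 1 := by simp [gaugeFactor]

theorem norm_gaugeFactor (c a x : ℝ) : ‖gaugeFactor c a x‖ = 1 := by
  rw [gaugeFactor, show Complex.I * c * ((x - a : ℝ) : ℂ) = ((c * (x - a) : ℝ) : ℂ) * Complex.I by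
    push_cast; ring]
  exact Complex.norm_exp_ofReal_mul_I _

theorem gaugeFactor_ne_zero (c a x : ℝ) : gaugeFactor c a x ≠ 0 := Complex.exp_ne_zero _

theorem hasDerivAt_gaugeFactor (c a x : ℝ) :
    HasDerivAt (gaugeFactor c a) (Complex.I * c * gaugeFactor c a x) x := by
  have h1 : HasDerivAt (fun x : ℝ => ((x - a : ℝ) : ℂ)) 1 x := by
    simpa using ((hasDerivAt_id x).sub_const a).ofReal_comp
  exact (h1.const_mul (Complex.I * c)).cexp.congr_deriv (by rw [gaugeFactor]; ring)

theorem continuous_gaugeFactor (c a : ℝ) : Continuous (gaugeFactor c a) :=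
  continuous_iff_continuousAt.2 fun x => (hasDerivAt_gaugeFactor c a x).continuousAt

/-- Green's identity for the quasiderivative on an edge. -/
theorem IsH2On.green {a b c : ℝ} {f f₁ f₂ w w₁ w₂ : ℝ → ℂ} (h : IsH2On a b f f₁ f₂)
    (hw : ∀ x, HasDerivAt w (w₁ x) x) (hw₁ : ∀ x, HasDerivAt w₁ (w₂ x) x) (hw₂ : Continuous w₂)
    {x : ℝ} (hx : x ∈ Icc a b) :
    ∫ t in a..x, gaugeFactor c a t *
        (quasiDeriv c (quasiDeriv c f f₁) (quasiDeriv c f₁ f₂) t * w t - f t * w₂ t) =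
      gaugeFactor c a x * (quasiDeriv c f f₁ x * w x - f x * w₁ x) -
        (quasiDeriv c f f₁ a * w a - f a * w₁ a) := by
  have hwc : Continuous w := continuous_iff_continuousAt.2 fun y => (hw y).continuousAt
  have hw₁c : Continuous w₁ := continuous_iff_continuousAt.2 fun y => (hw₁ y).continuousAt
  have hg := continuous_gaugeFactor c a
  -- With `g` the gauge factor, the integrand of Green's identity is the sum of the product-rule
  -- integrands of `f₁ · (g w)` and `f · (g (i c w - w₁))`; the two cross terms in `f₁ w₁` cancel.
  have dA : ∀ y, HasDerivAt (fun y => gaugeFactor c a y * w y)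
      (gaugeFactor c a y * (Complex.I * c * w y + w₁ y)) y := fun y =>
    ((hasDerivAt_gaugeFactor c a y).mul (hw y)).congr_deriv (by ring)
  have dB : ∀ y, HasDerivAt (fun y => gaugeFactor c a y * (Complex.I * c * w y - w₁ y))
      (gaugeFactor c a y * (Complex.I * c * (Complex.I * c) * w y - w₂ y)) y := fun y =>
    ((hasDerivAt_gaugeFactor c a y).mul (((hw y).const_mul (Complex.I * c)).sub
      (hw₁ y))).congr_deriv (by simp only [Pi.sub_apply]; ring)
  have e1 := mul_sub_mul_eq_integral h.integrableOn h.deriv dA (by fun_prop) hx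
  have e2 := mul_sub_mul_eq_integral
    (h.continuousOn_deriv.integrableOn_compact isCompact_Icc) h.value dB (by fun_prop) hx
  have i1 : IntervalIntegrable (fun t => f₂ t * (gaugeFactor c a t * w t) +
      f₁ t * (gaugeFactor c a t * (Complex.I * c * w t + w₁ t))) volume a x :=
    ((h.intervalIntegrable₂ hx).mul_continuousOn (by fun_prop)).add
      ((h.intervalIntegrable₁ hx).mul_continuousOn (by fun_prop))
  have hfi : IntervalIntegrable f volume a x := by
    rw [intervalIntegrable_iff_integrableOn_Icc_of_le hx.1]
    exact (h.continuousOn.integrableOn_compact isCompact_Icc).mono_set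
      (Icc_subset_Icc_right hx.2)
  have i2 : IntervalIntegrable (fun t => f₁ t * (gaugeFactor c a t * (Complex.I * c * w t - w₁ t))
      + f t * (gaugeFactor c a t * (Complex.I * c * (Complex.I * c) * w t - w₂ t))) volume a x :=
    ((h.intervalIntegrable₁ hx).mul_continuousOn (by fun_prop)).add
      (hfi.mul_continuousOn (by fun_prop))
  have e3 := intervalIntegral.integral_add i1 i2
  have e4 : ∫ t in a..x, gaugeFactor c a t *
        (quasiDeriv c (quasiDeriv c f f₁) (quasiDeriv c f₁ f₂) t * w t - f t * w₂ t) =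
      ∫ t in a..x, (f₂ t * (gaugeFactor c a t * w t) +
        f₁ t * (gaugeFactor c a t * (Complex.I * c * w t + w₁ t)) +
        (f₁ t * (gaugeFactor c a t * (Complex.I * c * w t - w₁ t))
      + f t * (gaugeFactor c a t * (Complex.I * c * (Complex.I * c) * w t - w₂ t)))) := by
    refine intervalIntegral.integral_congr fun t _ => ?_
    simp only [quasiDeriv]
    ring
  rw [e4, e3, ← e1, ← e2]
  simp only [quasiDeriv, gaugeFactor_self]
  ring

theorem isH2On_of_hasDerivAt {a b : ℝ} {f f₁ f₂ : ℝ → ℂ} (hf : ∀ x, HasDerivAt f (f₁ x) x)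
    (hf₁ : ∀ x, HasDerivAt f₁ (f₂ x) x) (hf₂ : Continuous f₂) : IsH2On a b f f₁ f₂ where
  memLp := by
    obtain ⟨C, hC⟩ := (isCompact_Icc (a := a) (b := b)).exists_bound_of_continuousOn
      hf₂.continuousOn
    refine MemLp.of_bound hf₂.aestronglyMeasurable C ?_
    filter_upwards [ae_restrict_mem measurableSet_Ioo] with x hx
    exact hC x (Ioo_subset_Icc_self hx)
  value x _ := by
    rw [intervalIntegral.integral_eq_sub_of_hasDerivAt (fun t _ => hf t)
      ((continuous_iff_continuousAt.2 fun y => (hf₁ y).continuousAt).intervalIntegrable _ _)]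
    ring
  deriv x _ := by
    rw [intervalIntegral.integral_eq_sub_of_hasDerivAt (fun t _ => hf₁ t)
      (hf₂.intervalIntegrable _ _)]
    ring

/-! ### Solutions of the free equation on an edge -/

theorem momentum_sq (E : ℝ) : momentum E ^ 2 = E := by
  unfold momentum
  split_ifs with h
  · rw [← Complex.ofReal_pow, Real.sq_sqrt h]
  · rw [mul_pow, ← Complex.ofReal_pow, Real.sq_sqrt (by linarith), Complex.I_sq]
    simp

theorem momentum_eq_zero {E : ℝ} : momentum E = 0 ↔ E = 0 := by
  rw [← sq_eq_zero_iff, momentum_sq, Complex.ofReal_eq_zero]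

/-- The solution `cos kx` of `-w'' = E w`. -/
noncomputable def edgeCos (E t : ℝ) : ℂ := Complex.cos (momentum E * t)

/-- The solution `sin kx / k` of `-w'' = E w`. -/
noncomputable def edgeSin (E t : ℝ) : ℂ :=
  if momentum E = 0 then (t : ℂ) else Complex.sin (momentum E * t) / momentum E

@[simp] theorem edgeCos_zero (E : ℝ) : edgeCos E 0 = 1 := by simp [edgeCos]

@[simp] theorem edgeSin_zero (E : ℝ) : edgeSin E 0 = 0 := by simp [edgeSin]

theorem hasDerivAt_edgeSin (E t : ℝ) : HasDerivAt (edgeSin E) (edgeCos E t) t := by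
  by_cases h : momentum E = 0
  · have : edgeSin E = fun x : ℝ => (x : ℂ) := by funext x; simp [edgeSin, h]
    rw [this]
    simpa [edgeCos, h] using (hasDerivAt_id t).ofReal_comp
  · have h1 : HasDerivAt (fun z : ℂ => Complex.sin (momentum E * z) / momentum E)
        (edgeCos E t) (t : ℂ) :=
      (((hasDerivAt_id (t : ℂ)).const_mul (momentum E)).csin.div_const _).congr_deriv (by
        simp only [edgeCos, id]; field_simp)
    have : edgeSin E = fun x : ℝ => Complex.sin (momentum E * x) / momentum E := by
      funext x; simp [edgeSin, h]
    rw [this]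
    exact h1.comp_ofReal

theorem hasDerivAt_edgeCos (E t : ℝ) : HasDerivAt (edgeCos E) (-(E : ℂ) * edgeSin E t) t := by
  have h1 : HasDerivAt (fun z : ℂ => Complex.cos (momentum E * z))
      (-(E : ℂ) * edgeSin E t) (t : ℂ) :=
    (((hasDerivAt_id (t : ℂ)).const_mul (momentum E)).ccos).congr_deriv (by
      simp only [edgeSin, id, ← momentum_sq]
      split_ifs with h
      · simp [h]
      · field_simp)
  exact h1.comp_ofReal

theorem continuous_edgeSin (E : ℝ) : Continuous (edgeSin E) :=
  continuous_iff_continuousAt.2 fun t => (hasDerivAt_edgeSin E t).continuousAt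

theorem continuous_edgeCos (E : ℝ) : Continuous (edgeCos E) :=
  continuous_iff_continuousAt.2 fun t => (hasDerivAt_edgeCos E t).continuousAt

theorem hasDerivAt_comp_const_sub {w : ℝ → ℂ} {d : ℂ} {c t : ℝ} (h : HasDerivAt w d (c - t)) :
    HasDerivAt (fun t => w (c - t)) (-d) t := by
  have := h.scomp t ((hasDerivAt_id t).const_sub c)
  simpa [Function.comp_def] using this

/-- The value `cos kπ` as a real function of the energy. -/
noncomputable def bandCos (E : ℝ) : ℝ :=
  if 0 ≤ E then Real.cos (√E * Real.pi) else Real.cosh (√(-E) * Real.pi)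

/-- The value `sin kπ / k` as a real function of the energy. -/
noncomputable def bandSin (E : ℝ) : ℝ :=
  if E = 0 then Real.pi else if 0 ≤ E then Real.sin (√E * Real.pi) / √E
    else Real.sinh (√(-E) * Real.pi) / √(-E)

theorem edgeCos_pi (E : ℝ) : edgeCos E Real.pi = bandCos E := by
  unfold edgeCos bandCos momentum
  split_ifs
  · push_cast; rfl
  · push_cast
    rw [← Complex.cos_mul_I]; ring_nf

theorem edgeSin_pi (E : ℝ) : edgeSin E Real.pi = bandSin E := by
  unfold edgeSin bandSin
  simp only [momentum_eq_zero]
  split_ifs with h h'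
  · rfl
  · simp only [momentum, if_pos h']; push_cast; rfl
  · have : ((√(-E) : ℝ) : ℂ) ≠ 0 := by
      rw [Complex.ofReal_ne_zero, Real.sqrt_ne_zero']; linarith
    simp only [momentum, if_neg h']
    push_cast
    rw [show Complex.I * (√(-E) : ℂ) * (Real.pi : ℂ) = (√(-E) * Real.pi : ℂ) * Complex.I by ring,
      Complex.sin_mul_I]
    field_simp [Complex.I_ne_zero]

theorem bandCos_sq_add (E : ℝ) : bandCos E ^ 2 + E * bandSin E ^ 2 = 1 := by
  unfold bandCos bandSin
  split_ifs with h0 h1 h1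
  · simp [h1]
  · have := Real.sq_sqrt h0
    rw [div_pow, this, mul_div_cancel₀ _ h1]; exact Real.cos_sq_add_sin_sq _
  · linarith
  · have := Real.sq_sqrt (show 0 ≤ -E by linarith)
    rw [div_pow, this, div_neg, mul_neg, mul_div_cancel₀ _ h1]
    linarith [Real.cosh_sq (√(-E) * Real.pi)]

/-! ### Integrals over an edge as inner products -/

theorem vertexPt_succ (j : ℤ) : vertexPt (j + 1) = vertexPt j + Real.pi := by
  simp only [vertexPt]; push_cast; ring

theorem vertexPt_lt_succ (j : ℤ) : vertexPt j < vertexPt (j + 1) := by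
  rw [vertexPt_succ]; linarith [Real.pi_pos]

/-- The edge number `j`, as an open interval. -/
def edgeSet (j : ℤ) : Set ℝ := Ioo (vertexPt j) (vertexPt (j + 1))

theorem measurableSet_edgeSet (j : ℤ) : MeasurableSet (edgeSet j) := measurableSet_Ioo

theorem volume_edgeSet (j : ℤ) : volume (edgeSet j) = ENNReal.ofReal Real.pi := by
  rw [edgeSet, Real.volume_Ioo, vertexPt_succ]; congr 1; ring

theorem sub_mem_of_mem_edgeSet {j : ℤ} {t : ℝ} (h : t ∈ edgeSet j) :
    t - vertexPt j ∈ Icc 0 Real.pi := by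
  have := h.1; have := h.2; rw [vertexPt_succ] at this
  constructor <;> linarith

instance (j : ℤ) : IsFiniteMeasure (volume.restrict (edgeSet j)) :=
  ⟨by rw [Measure.restrict_apply_univ, volume_edgeSet]; exact ENNReal.ofReal_lt_top⟩

theorem memLp_edge_indicator {φ : ℝ → ℂ} (hφ : Continuous φ) (j : ℤ) :
    MemLp ((edgeSet j).indicator φ) 2 volume := by
  rw [memLp_indicator_iff_restrict (measurableSet_edgeSet j)]
  obtain ⟨C, hC⟩ := (isCompact_Icc (a := vertexPt j) (b := vertexPt (j + 1))).exists_bound_of_continuousOn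
    hφ.continuousOn
  refine MemLp.of_bound hφ.aestronglyMeasurable C ?_
  filter_upwards [ae_restrict_mem (measurableSet_edgeSet j)] with x hx
  exact hC x (Ioo_subset_Icc_self hx)

/-- The element of `L²(Γ)` which is the function `φ` on the edge `j` of the line `s` and zero
elsewhere. -/
noncomputable def edgeVec (s : Fin 2) (j : ℤ) {φ : ℝ → ℂ} (hφ : Continuous φ) : ChainSpace :=
  WithLp.toLp 2 (Pi.single s ((memLp_edge_indicator hφ j).toLp _))

theorem inner_edgeVec (s : Fin 2) (j : ℤ) {φ : ℝ → ℂ} (hφ : Continuous φ) (u : ChainSpace) :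
    inner ℂ (edgeVec s j hφ) u = ∫ t in edgeSet j, starRingEnd ℂ (φ t) * u s t := by
  have h1 : inner ℂ (edgeVec s j hφ) u = inner ℂ ((memLp_edge_indicator hφ j).toLp _) (u s) := by
    rw [PiLp.inner_apply, Finset.sum_eq_single s]
    · simp [edgeVec]
    · intro i _ hi
      simp [edgeVec, hi]
    · simp
  rw [h1, L2.inner_def, ← integral_indicator (measurableSet_edgeSet j)]
  refine integral_congr_ae ?_
  filter_upwards [(memLp_edge_indicator hφ j).coeFn_toLp] with t ht
  rw [ht]
  by_cases h : t ∈ edgeSet j <;> simp [h, mul_comm]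

/-- The squared `L²` norm of `u` over the two edges with number `j`. -/
noncomputable def edgeMass (u : ChainSpace) (j : ℤ) : ℝ :=
  ∑ s, ∫ t in edgeSet j, ‖u s t‖ ^ 2

theorem integrableOn_norm_sq (u : ChainSpace) (s : Fin 2) (S : Set ℝ) :
    IntegrableOn (fun t => ‖u s t‖ ^ 2) S :=
  ((memLp_two_iff_integrable_sq_norm (Lp.aestronglyMeasurable _)).1 (Lp.memLp (u s))).integrableOn

theorem integral_norm_sq_nonneg (u : ChainSpace) (s : Fin 2) (j : ℤ) :
    0 ≤ ∫ t in edgeSet j, ‖u s t‖ ^ 2 := integral_nonneg fun _ => by positivity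

theorem edgeMass_nonneg (u : ChainSpace) (j : ℤ) : 0 ≤ edgeMass u j :=
  Finset.sum_nonneg fun s _ => integral_norm_sq_nonneg u s j

theorem integral_le_edgeMass (u : ChainSpace) (s : Fin 2) (j : ℤ) :
    ∫ t in edgeSet j, ‖u s t‖ ^ 2 ≤ edgeMass u j :=
  Finset.single_le_sum (f := fun s => ∫ t in edgeSet j, ‖u s t‖ ^ 2)
    (fun i _ => integral_norm_sq_nonneg u i j) (Finset.mem_univ s)

theorem iUnion_Ico_vertexPt : (⋃ j : ℤ, Ico (vertexPt j) (vertexPt (j + 1))) = univ := by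
  refine eq_univ_of_forall fun x => mem_iUnion.2 ⟨⌊x / Real.pi⌋, ?_⟩
  have hpi := Real.pi_pos
  constructor
  · have := Int.floor_le (x / Real.pi)
    simpa [vertexPt] using (le_div_iff₀ hpi).1 this
  · have := Int.lt_floor_add_one (x / Real.pi)
    simpa [vertexPt] using (div_lt_iff₀ hpi).1 this

theorem vertexPt_le_vertexPt {i j : ℤ} (h : i ≤ j) : vertexPt i ≤ vertexPt j := by
  have : (i : ℝ) ≤ j := by exact_mod_cast h
  simp only [vertexPt]; nlinarith [Real.pi_pos]

theorem pairwise_disjoint_Ico_vertexPt :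
    Pairwise (Function.onFun Disjoint fun j : ℤ => Ico (vertexPt j) (vertexPt (j + 1))) := by
  refine (pairwise_disjoint_on _).2 fun i j hij => ?_
  rw [Set.disjoint_left]
  rintro x ⟨_, h⟩ ⟨h', _⟩
  exact absurd (h.trans_le ((vertexPt_le_vertexPt (by omega)).trans h')) (lt_irrefl _)

theorem hasSum_edgeMass (u : ChainSpace) : HasSum (edgeMass u) (‖u‖ ^ 2) := by
  have h1 : ∀ s : Fin 2, HasSum (fun j => ∫ t in edgeSet j, ‖u s t‖ ^ 2) (‖u s‖ ^ 2) := by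
    intro s
    have h := hasSum_integral_iUnion (μ := volume) (f := fun t => ‖u s t‖ ^ 2)
      (fun j : ℤ => measurableSet_Ico (a := vertexPt j) (b := vertexPt (j + 1)))
      pairwise_disjoint_Ico_vertexPt (integrableOn_norm_sq u s _)
    rw [iUnion_Ico_vertexPt, Measure.restrict_univ] at h
    have e : ∫ t, ‖u s t‖ ^ 2 = ‖u s‖ ^ 2 := by
      have h1 := L2.inner_def (𝕜 := ℂ) (u s) (u s)
      have h2 : ∀ t, inner ℂ (u s t) (u s t) = ((‖u s t‖ ^ 2 : ℝ) : ℂ) := fun t => by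
        rw [inner_self_eq_norm_sq_to_K]; simp
      simp only [h2] at h1
      rw [integral_complex_ofReal] at h1
      have h3 := congrArg Complex.re h1
      rw [Complex.ofReal_re] at h3
      exact h3.symm.trans (inner_self_eq_norm_sq (𝕜 := ℂ) (u s))
    rw [e] at h
    have hfun : (fun j => ∫ t in edgeSet j, ‖u s t‖ ^ 2) =
        fun j => ∫ t in Ico (vertexPt j) (vertexPt (j + 1)), ‖u s t‖ ^ 2 := by
      funext j
      rw [show volume.restrict (edgeSet j) = _ from restrict_Ioo_eq_restrict_Ico]
    rwa [hfun]
  have h2 := hasSum_sum fun s (_ : s ∈ Finset.univ) => h1 s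
  rw [PiLp.norm_sq_eq_of_L2]
  exact h2

theorem sq_integral_norm_le (u : ChainSpace) (s : Fin 2) (j : ℤ) :
    (∫ t in edgeSet j, ‖u s t‖) ^ 2 ≤ Real.pi * edgeMass u j := by
  -- The number `r` is the mean of `‖u s ·‖` over the edge, and integrating `(‖u s t‖ - r) ^ 2 ≥ 0`
  -- is the Cauchy–Schwarz inequality.
  set r := (∫ t in edgeSet j, ‖u s t‖) / Real.pi with hr
  have hpi := Real.pi_pos
  have hi2 := integrableOn_norm_sq u s (edgeSet j)
  have hi1 : IntegrableOn (fun t => ‖u s t‖) (edgeSet j) :=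
    ((Lp.memLp (u s)).restrict (edgeSet j)).integrable (by norm_num) |>.norm
  have h0 : 0 ≤ ∫ t in edgeSet j, (‖u s t‖ ^ 2 - 2 * r * ‖u s t‖ + r ^ 2) :=
    integral_nonneg fun t => by
      have := sq_nonneg (‖u s t‖ - r)
      simp only [Pi.zero_apply]; linarith
  have i3 : IntegrableOn (fun t => 2 * r * ‖u s t‖) (edgeSet j) := hi1.const_mul _
  have i4 : IntegrableOn (fun t => ‖u s t‖ ^ 2 - 2 * r * ‖u s t‖) (edgeSet j) := hi2.sub i3
  have e1 : ∫ t in edgeSet j, (‖u s t‖ ^ 2 - 2 * r * ‖u s t‖ + r ^ 2) =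
      (∫ t in edgeSet j, (‖u s t‖ ^ 2 - 2 * r * ‖u s t‖)) + ∫ t in edgeSet j, r ^ 2 :=
    integral_add i4 (integrable_const _)
  have e2 : ∫ t in edgeSet j, (‖u s t‖ ^ 2 - 2 * r * ‖u s t‖) =
      (∫ t in edgeSet j, ‖u s t‖ ^ 2) - ∫ t in edgeSet j, 2 * r * ‖u s t‖ :=
    integral_sub hi2 i3
  rw [e1, e2, integral_const_mul, integral_const,
    Measure.real, Measure.restrict_apply_univ, volume_edgeSet, ENNReal.toReal_ofReal hpi.le,
    smul_eq_mul] at h0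
  have h1 : ∫ t in edgeSet j, ‖u s t‖ = Real.pi * r := by rw [hr]; field_simp
  rw [h1] at h0 ⊢
  have := integral_le_edgeMass u s j
  nlinarith

/-- The integral over an edge of `u` against a function of the local coordinate, after removal of
the magnetic field. -/
noncomputable def edgePairing (A : ℝ) (φ : ℝ → ℂ) (s : Fin 2) (j : ℤ) (u : ChainSpace) : ℂ :=
  ∫ t in edgeSet j, gaugeFactor (fieldSign A s) (vertexPt j) t * (u s t * φ (t - vertexPt j))

/-- This form makes the pairing linear in `u` and continuous under weak convergence, which is what
singular Weyl sequences provide. -/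
theorem exists_edgePairing_eq_inner (A : ℝ) {φ : ℝ → ℂ} (hφ : Continuous φ) (s : Fin 2) (j : ℤ) :
    ∃ p : ChainSpace, ∀ u, edgePairing A φ s j u = inner ℂ p u := by
  have hg := continuous_gaugeFactor (fieldSign A s) (vertexPt j)
  refine ⟨edgeVec s j (φ := fun t => starRingEnd ℂ
    (gaugeFactor (fieldSign A s) (vertexPt j) t * φ (t - vertexPt j))) (by fun_prop), fun u => ?_⟩
  rw [inner_edgeVec, edgePairing]
  congr 1; funext t
  rw [Complex.conj_conj]; ring

theorem edgePairing_sub_smul (A : ℝ) {φ : ℝ → ℂ} (hφ : Continuous φ) (s : Fin 2) (j : ℤ)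
    (u v : ChainSpace) (c : ℂ) :
    edgePairing A φ s j (v - c • u) = edgePairing A φ s j v - c * edgePairing A φ s j u := by
  obtain ⟨p, hp⟩ := exists_edgePairing_eq_inner A hφ s j
  simp only [hp, inner_sub_right, inner_smul_right]

theorem norm_edgePairing_sq_le (A : ℝ) {φ : ℝ → ℂ} {B : ℝ}
    (hB : ∀ t ∈ Icc 0 Real.pi, ‖φ t‖ ≤ B) (s : Fin 2) (j : ℤ) (u : ChainSpace) :
    ‖edgePairing A φ s j u‖ ^ 2 ≤ B ^ 2 * Real.pi * edgeMass u j := by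
  have hB0 : 0 ≤ B := (norm_nonneg _).trans (hB 0 ⟨le_rfl, Real.pi_pos.le⟩)
  have hi1 : IntegrableOn (fun t => ‖u s t‖) (edgeSet j) :=
    ((Lp.memLp (u s)).restrict (edgeSet j)).integrable (by norm_num) |>.norm
  have h1 : ‖edgePairing A φ s j u‖ ≤ B * ∫ t in edgeSet j, ‖u s t‖ := by
    rw [← integral_const_mul]
    refine norm_integral_le_of_norm_le (hi1.const_mul B) ?_
    filter_upwards [ae_restrict_mem (measurableSet_edgeSet j)] with t ht
    rw [norm_mul, norm_gaugeFactor, one_mul, norm_mul, mul_comm]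
    exact mul_le_mul_of_nonneg_right (hB _ (sub_mem_of_mem_edgeSet ht)) (norm_nonneg _)
  calc ‖edgePairing A φ s j u‖ ^ 2 ≤ (B * ∫ t in edgeSet j, ‖u s t‖) ^ 2 := by gcongr
    _ = B ^ 2 * (∫ t in edgeSet j, ‖u s t‖) ^ 2 := by ring
    _ ≤ B ^ 2 * (Real.pi * edgeMass u j) := by gcongr; exact sq_integral_norm_le u s j
    _ = _ := by ring

/-! ### Nodal values -/

theorem Lp_sub_smul_ae (u v : ChainSpace) (c : ℂ) (s : Fin 2) :
    ((v - c • u) s : ℝ → ℂ) =ᵐ[volume] fun t => v s t - c * u s t := by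
  filter_upwards [Lp.coeFn_sub (v s) (c • u s), Lp.coeFn_smul c (u s)] with t h1 h2
  change ((v s - c • u s : Lp ℂ 2 (volume : Measure ℝ)) : ℝ → ℂ) t = _
  rw [h1, Pi.sub_apply, h2, Pi.smul_apply, smul_eq_mul]

/-- Green's identity over the full edge, in a form where the integral depends on `u` and `v` only.
Different choices of `φ` extract different boundary data: `nodeTest` yields a nodal value, the sine
solutions yield the derivatives at the ends. The exponential is the gauge factor accumulated along
the edge. -/
theorem edgePairing_green {A : ℝ} {s : Fin 2} {j : ℤ} {u v : ChainSpace} {f f₁ f₂ : ℝ → ℂ}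
    (h : IsH2On (vertexPt j) (vertexPt (j + 1)) f f₁ f₂)
    (hu : (u s : ℝ → ℂ) =ᵐ[volume.restrict (edgeSet j)] f)
    (hv : (v s : ℝ → ℂ) =ᵐ[volume.restrict (edgeSet j)]
      -quasiDeriv (fieldSign A s) (quasiDeriv (fieldSign A s) f f₁)
        (quasiDeriv (fieldSign A s) f₁ f₂))
    {φ φ₁ φ₂ : ℝ → ℂ} (hφ : ∀ x, HasDerivAt φ (φ₁ x) x) (hφ₁ : ∀ x, HasDerivAt φ₁ (φ₂ x) x)
    (hφ₂ : Continuous φ₂) :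
    edgePairing A φ s j v + edgePairing A φ₂ s j u =
      (quasiDeriv (fieldSign A s) f f₁ (vertexPt j) * φ 0 - f (vertexPt j) * φ₁ 0) -
      Complex.exp (Complex.I * fieldSign A s * Real.pi) *
        (quasiDeriv (fieldSign A s) f f₁ (vertexPt (j + 1)) * φ Real.pi -
          f (vertexPt (j + 1)) * φ₁ Real.pi) := by
  set a := vertexPt j with ha
  set b := vertexPt (j + 1) with hb
  have hab : b = a + Real.pi := vertexPt_succ j
  have hle : a ≤ b := (vertexPt_lt_succ j).le
  set c := fieldSign A s with hc
  have hφc : Continuous φ := continuous_iff_continuousAt.2 fun y => (hφ y).continuousAt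
  have d1 : ∀ x, HasDerivAt (fun x => φ (x - a)) (φ₁ (x - a)) x := fun x => by
    simpa using (hφ (x - a)).comp_sub_const x a
  have d2 : ∀ x, HasDerivAt (fun x => φ₁ (x - a)) (φ₂ (x - a)) x := fun x => by
    simpa using (hφ₁ (x - a)).comp_sub_const x a
  have hG := h.green (c := c) d1 d2 (by fun_prop) (right_mem_Icc.2 hle)
  rw [intervalIntegral.integral_of_le hle, integral_Ioc_eq_integral_Ioo] at hG
  have hgc := continuous_gaugeFactor c a
  have hLp : ∀ w : ChainSpace, ∀ ψ : ℝ → ℂ, Continuous ψ →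
      IntegrableOn (fun t => gaugeFactor c a t * (w s t * ψ (t - a))) (edgeSet j) := by
    intro w ψ hψ
    have hw : IntegrableOn (w s : ℝ → ℂ) (edgeSet j) :=
      ((Lp.memLp (w s)).restrict (edgeSet j)).integrable (by norm_num)
    have hw' : IntegrableOn (w s : ℝ → ℂ) (Icc a b) := by
      rwa [integrableOn_Icc_iff_integrableOn_Ioo]
    have := (hw'.mul_continuousOn (g' := fun t => gaugeFactor c a t * ψ (t - a))
      (by fun_prop) isCompact_Icc).mono_set Ioo_subset_Icc_self
    exact this.congr (Eventually.of_forall fun t => by ring)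
  rw [edgePairing, edgePairing, ← integral_add (hLp v φ hφc) (hLp u φ₂ hφ₂)]
  have hcongr : ∫ t in edgeSet j, (gaugeFactor c a t * (v s t * φ (t - a)) +
        gaugeFactor c a t * (u s t * φ₂ (t - a))) =
      ∫ t in edgeSet j, -(gaugeFactor c a t *
        (quasiDeriv c (quasiDeriv c f f₁) (quasiDeriv c f₁ f₂) t * φ (t - a) -
          f t * φ₂ (t - a))) := by
    refine integral_congr_ae ?_
    filter_upwards [hu, hv] with t h1 h2
    rw [h1, h2, Pi.neg_apply]; ring
  have hπ : gaugeFactor c a b = Complex.exp (Complex.I * c * Real.pi) := by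
    rw [gaugeFactor, hab]; simp
  rw [hcongr, integral_neg]
  rw [edgeSet, hG, hπ, hab]
  simp only [sub_self, add_sub_cancel_left]
  ring

/-- A test function on `[0, π]` whose boundary values vanish, except for the derivative at `0`. -/
noncomputable def nodeTest (t : ℝ) : ℂ := t * (1 - t / Real.pi) ^ 2

noncomputable def nodeTest₁ (t : ℝ) : ℂ :=
  (1 - t / Real.pi) ^ 2 - 2 * (t / Real.pi) * (1 - t / Real.pi)

noncomputable def nodeTest₂ (t : ℝ) : ℂ :=
  -(4 / Real.pi) * (1 - t / Real.pi) + 2 * (t / Real.pi) / Real.pi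

theorem hasDerivAt_nodeTest (t : ℝ) : HasDerivAt nodeTest (nodeTest₁ t) t := by
  have hpi : (Real.pi : ℂ) ≠ 0 := by exact_mod_cast Real.pi_ne_zero
  have h : HasDerivAt (fun z : ℂ => z * (1 - z / Real.pi) ^ 2) (nodeTest₁ t) (t : ℂ) := by
    have h1 : HasDerivAt (fun z : ℂ => 1 - z / Real.pi) (-(1 / Real.pi)) (t : ℂ) :=
      ((hasDerivAt_id (t : ℂ)).div_const _).const_sub 1
    refine ((hasDerivAt_id (t : ℂ)).mul (h1.pow 2)).congr_deriv ?_
    simp only [nodeTest₁, id, Pi.pow_apply]; push_cast; field_simp; ring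
  exact h.comp_ofReal

theorem hasDerivAt_nodeTest₁ (t : ℝ) : HasDerivAt nodeTest₁ (nodeTest₂ t) t := by
  have hpi : (Real.pi : ℂ) ≠ 0 := by exact_mod_cast Real.pi_ne_zero
  have h : HasDerivAt (fun z : ℂ => (1 - z / Real.pi) ^ 2 -
      2 * (z / Real.pi) * (1 - z / Real.pi)) (nodeTest₂ t) (t : ℂ) := by
    have h1 : HasDerivAt (fun z : ℂ => z / Real.pi) (1 / Real.pi) (t : ℂ) :=
      (hasDerivAt_id (t : ℂ)).div_const _
    have h2 := h1.const_sub 1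
    refine ((h2.pow 2).sub ((h1.const_mul 2).mul h2)).congr_deriv ?_
    simp only [nodeTest₂]; push_cast; field_simp; ring
  exact h.comp_ofReal

theorem continuous_nodeTest : Continuous nodeTest :=
  continuous_iff_continuousAt.2 fun t => (hasDerivAt_nodeTest t).continuousAt

theorem continuous_nodeTest₂ : Continuous nodeTest₂ := by
  unfold nodeTest₂; fun_prop

theorem nodeTest_boundary : nodeTest 0 = 0 ∧ nodeTest₁ 0 = 1 ∧ nodeTest Real.pi = 0 ∧
    nodeTest₁ Real.pi = 0 := by
  have hpi : (Real.pi : ℂ) ≠ 0 := by exact_mod_cast Real.pi_ne_zero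
  simp [nodeTest, nodeTest₁, hpi]

/-- The value at the vertex `j`, computed from `u` and `v = T u` on the adjacent upper edge. -/
noncomputable def nodeVal (A : ℝ) (u v : ChainSpace) (j : ℤ) : ℂ :=
  -(edgePairing A nodeTest 0 j v + edgePairing A nodeTest₂ 0 j u)

theorem exists_norm_le_on_edge {φ : ℝ → ℂ} (hφ : Continuous φ) :
    ∃ B : ℝ, 0 < B ∧ ∀ t ∈ Icc 0 Real.pi, ‖φ t‖ ≤ B := by
  obtain ⟨B, hB⟩ := (isCompact_Icc (a := (0 : ℝ)) (b := Real.pi)).exists_bound_of_continuousOn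
    hφ.continuousOn
  exact ⟨max B 1, by positivity, fun t ht => (hB t ht).trans (le_max_left _ _)⟩

/-- Because `nodeVal` is an integral against fixed continuous functions on one edge, it is bounded
by the local masses, with a constant that does not depend on the edge. -/
theorem exists_norm_nodeVal_sq_le (A : ℝ) :
    ∃ K : ℝ, 0 < K ∧ ∀ u v j, ‖nodeVal A u v j‖ ^ 2 ≤ K * (edgeMass u j + edgeMass v j) := by
  obtain ⟨B, hB0, hB⟩ := exists_norm_le_on_edge continuous_nodeTest
  obtain ⟨B', hB0', hB'⟩ := exists_norm_le_on_edge continuous_nodeTest₂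
  refine ⟨2 * Real.pi * (B ^ 2 + B' ^ 2), by positivity, fun u v j => ?_⟩
  have h1 := norm_edgePairing_sq_le A hB 0 j v
  have h2 := norm_edgePairing_sq_le A hB' 0 j u
  have h3 : ‖nodeVal A u v j‖ ≤ ‖edgePairing A nodeTest 0 j v‖ + ‖edgePairing A nodeTest₂ 0 j u‖ := by
    rw [nodeVal, norm_neg]; exact norm_add_le _ _
  have hu := edgeMass_nonneg u j
  have hv := edgeMass_nonneg v j
  calc ‖nodeVal A u v j‖ ^ 2
      ≤ (‖edgePairing A nodeTest 0 j v‖ + ‖edgePairing A nodeTest₂ 0 j u‖) ^ 2 := by gcongr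
    _ ≤ 2 * (‖edgePairing A nodeTest 0 j v‖ ^ 2 + ‖edgePairing A nodeTest₂ 0 j u‖ ^ 2) := add_sq_le
    _ ≤ 2 * (B ^ 2 * Real.pi * edgeMass v j + B' ^ 2 * Real.pi * edgeMass u j) := by gcongr
    _ ≤ _ := by
      have e1 : 0 ≤ B ^ 2 * Real.pi * edgeMass u j := by positivity
      have e2 : 0 ≤ B' ^ 2 * Real.pi * edgeMass v j := by positivity
      linarith

theorem nodeVal_sub_smul (A : ℝ) (u v u' v' : ChainSpace) (c : ℂ) (j : ℤ) :
    nodeVal A (u - c • u') (v - c • v') j = nodeVal A u v j - c * nodeVal A u' v' j := by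
  simp only [nodeVal, edgePairing_sub_smul A continuous_nodeTest,
    edgePairing_sub_smul A continuous_nodeTest₂]
  ring

theorem tendsto_nodeVal (A : ℝ) (j : ℤ) {u v : ℕ → ChainSpace}
    (hu : ∀ w, Tendsto (fun n => inner ℂ w (u n)) atTop (𝓝 0))
    (hv : ∀ w, Tendsto (fun n => inner ℂ w (v n)) atTop (𝓝 0)) :
    Tendsto (fun n => nodeVal A (u n) (v n) j) atTop (𝓝 0) := by
  obtain ⟨p, hp⟩ := exists_edgePairing_eq_inner A continuous_nodeTest 0 j
  obtain ⟨p', hp'⟩ := exists_edgePairing_eq_inner A continuous_nodeTest₂ 0 j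
  simp only [nodeVal, hp, hp']
  simpa using ((hv p).add (hu p')).neg

/-- Of the four boundary data of `nodeTest` only the derivative at the left end is nonzero, so
Green's identity isolates the value there. -/
theorem nodeVal_eq {A : ℝ} {j : ℤ} {u v : ChainSpace} {f f₁ f₂ : ℝ → ℂ}
    (h : IsH2On (vertexPt j) (vertexPt (j + 1)) f f₁ f₂)
    (hu : (u 0 : ℝ → ℂ) =ᵐ[volume.restrict (edgeSet j)] f)
    (hv : (v 0 : ℝ → ℂ) =ᵐ[volume.restrict (edgeSet j)]
      -quasiDeriv (fieldSign A 0) (quasiDeriv (fieldSign A 0) f f₁)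
        (quasiDeriv (fieldSign A 0) f₁ f₂)) :
    nodeVal A u v j = f (vertexPt j) := by
  obtain ⟨h1, h2, h3, h4⟩ := nodeTest_boundary
  rw [nodeVal, edgePairing_green h hu hv hasDerivAt_nodeTest hasDerivAt_nodeTest₁
    continuous_nodeTest₂, h1, h2, h3, h4]
  ring

/-! ### End derivatives expressed through end values -/

section NodalRelations

variable {A : ℝ} {s : Fin 2} {j : ℤ} {u v : ChainSpace} {f f₁ f₂ : ℝ → ℂ}

theorem edgePairing_neg_mul (E : ℝ) (φ : ℝ → ℂ) :
    edgePairing A (fun t => -(E : ℂ) * φ t) s j u = -(E : ℂ) * edgePairing A φ s j u := by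
  rw [edgePairing, edgePairing, ← integral_const_mul]
  congr 1; funext t; ring

/-- The derivative at the left end of an edge, in terms of the values at the two ends. -/
theorem quasiDeriv_left_mul (h : IsH2On (vertexPt j) (vertexPt (j + 1)) f f₁ f₂)
    (hu : (u s : ℝ → ℂ) =ᵐ[volume.restrict (edgeSet j)] f)
    (hv : (v s : ℝ → ℂ) =ᵐ[volume.restrict (edgeSet j)]
      -quasiDeriv (fieldSign A s) (quasiDeriv (fieldSign A s) f f₁)
        (quasiDeriv (fieldSign A s) f₁ f₂)) (E : ℝ) :
    quasiDeriv (fieldSign A s) f f₁ (vertexPt j) * bandSin E =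
      edgePairing A (fun t => edgeSin E (Real.pi - t)) s j (v - (E : ℂ) • u) +
        Complex.exp (Complex.I * fieldSign A s * Real.pi) * f (vertexPt (j + 1)) -
        bandCos E * f (vertexPt j) := by
  have hc := continuous_edgeSin E
  -- This solution of the free equation vanishes at the right end, so the derivative there drops
  -- out.
  have hG := edgePairing_green h hu hv (φ := fun t => edgeSin E (Real.pi - t))
    (φ₁ := fun t => -edgeCos E (Real.pi - t)) (φ₂ := fun t => -(E : ℂ) * edgeSin E (Real.pi - t))
    (fun x => hasDerivAt_comp_const_sub (hasDerivAt_edgeSin E _))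
    (fun x => (hasDerivAt_comp_const_sub (hasDerivAt_edgeCos E _)).neg.congr_deriv (by ring))
    (by fun_prop)
  rw [edgePairing_neg_mul E (fun t => edgeSin E (Real.pi - t))] at hG
  rw [edgePairing_sub_smul A (by fun_prop)]
  simp only [sub_zero, sub_self, edgeSin_zero, edgeCos_zero, edgeSin_pi, edgeCos_pi] at hG
  linear_combination -hG

/-- The derivative at the right end of an edge, in terms of the values at the two ends. -/
theorem quasiDeriv_right_mul (h : IsH2On (vertexPt j) (vertexPt (j + 1)) f f₁ f₂)
    (hu : (u s : ℝ → ℂ) =ᵐ[volume.restrict (edgeSet j)] f)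
    (hv : (v s : ℝ → ℂ) =ᵐ[volume.restrict (edgeSet j)]
      -quasiDeriv (fieldSign A s) (quasiDeriv (fieldSign A s) f f₁)
        (quasiDeriv (fieldSign A s) f₁ f₂)) (E : ℝ) :
    quasiDeriv (fieldSign A s) f f₁ (vertexPt (j + 1)) * bandSin E =
      bandCos E * f (vertexPt (j + 1)) - Complex.exp (-(Complex.I * fieldSign A s * Real.pi)) *
        (f (vertexPt j) + edgePairing A (edgeSin E) s j (v - (E : ℂ) • u)) := by
  have hc := continuous_edgeSin E
  -- This solution vanishes at the left end, so only the derivative at the right end remains.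
  have hG := edgePairing_green h hu hv (φ := edgeSin E)
    (φ₁ := edgeCos E) (φ₂ := fun t => -(E : ℂ) * edgeSin E t)
    (fun x => hasDerivAt_edgeSin E x) (fun x => hasDerivAt_edgeCos E x) (by fun_prop)
  rw [edgePairing_neg_mul E] at hG
  rw [edgePairing_sub_smul A hc]
  simp only [edgeSin_zero, edgeCos_zero, edgeSin_pi, edgeCos_pi] at hG
  have he : Complex.exp (-(Complex.I * fieldSign A s * Real.pi)) *
      Complex.exp (Complex.I * fieldSign A s * Real.pi) = 1 := by
    rw [← Complex.exp_add]; simp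
  linear_combination (Complex.exp (-(Complex.I * fieldSign A s * Real.pi))) * hG +
    (-quasiDeriv (fieldSign A s) f f₁ (vertexPt (j + 1)) * bandSin E +
      f (vertexPt (j + 1)) * bandCos E) * he

end NodalRelations

/-! ### The difference equation for the nodal values -/

theorem sum_fieldSign_exp (A : ℝ) : Complex.exp (Complex.I * fieldSign A 0 * Real.pi) +
    Complex.exp (Complex.I * fieldSign A 1 * Real.pi) = 2 * Real.cos (A * Real.pi) := by
  simp only [fieldSign, Matrix.cons_val_zero, Matrix.cons_val_one, Complex.ofReal_neg]
  rw [show Complex.I * (A : ℂ) * Real.pi = (A * Real.pi : ℂ) * Complex.I by ring,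
    show Complex.I * -(A : ℂ) * Real.pi = -(A * Real.pi : ℂ) * Complex.I by ring]
  push_cast
  exact (Complex.two_cos _).symm

theorem sum_fieldSign_exp_neg (A : ℝ) : Complex.exp (-(Complex.I * fieldSign A 0 * Real.pi)) +
    Complex.exp (-(Complex.I * fieldSign A 1 * Real.pi)) = 2 * Real.cos (A * Real.pi) := by
  rw [← sum_fieldSign_exp]
  simp only [fieldSign, Matrix.cons_val_zero, Matrix.cons_val_one, Complex.ofReal_neg]
  rw [add_comm]
  congr 2 <;> ring

theorem norm_exp_fieldSign (A : ℝ) (s : Fin 2) :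
    ‖Complex.exp (Complex.I * fieldSign A s * Real.pi)‖ = 1 := by
  rw [show Complex.I * (fieldSign A s : ℂ) * Real.pi =
    ((fieldSign A s * Real.pi : ℝ) : ℂ) * Complex.I by push_cast; ring]
  exact Complex.norm_exp_ofReal_mul_I _

theorem norm_exp_neg_fieldSign (A : ℝ) (s : Fin 2) :
    ‖Complex.exp (-(Complex.I * fieldSign A s * Real.pi))‖ = 1 := by
  rw [Complex.exp_neg, norm_inv, norm_exp_fieldSign, inv_one]

theorem norm_add_four_sq_le (a b c d : ℂ) :
    ‖a + b + c + d‖ ^ 2 ≤ 4 * (‖a‖ ^ 2 + ‖b‖ ^ 2 + ‖c‖ ^ 2 + ‖d‖ ^ 2) := by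
  have h : ‖a + b + c + d‖ ≤ ‖a‖ + ‖b‖ + ‖c‖ + ‖d‖ := norm_add₄_le
  have h2 : ‖a + b + c + d‖ ^ 2 ≤ (‖a‖ + ‖b‖ + ‖c‖ + ‖d‖) ^ 2 := by gcongr
  nlinarith [sq_nonneg (‖a‖ - ‖b‖), sq_nonneg (‖a‖ - ‖c‖), sq_nonneg (‖a‖ - ‖d‖),
    sq_nonneg (‖b‖ - ‖c‖), sq_nonneg (‖b‖ - ‖d‖), sq_nonneg (‖c‖ - ‖d‖)]

/-- The residual of the difference equation which the nodal values of a solution of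
`(T - E) u = 0` satisfy. -/
noncomputable def nodeResidual (A : ℝ) (α : ℤ → ℝ) (E : ℝ) (x : ℤ → ℂ) (j : ℤ) : ℂ :=
  2 * Real.cos (A * Real.pi) * (x (j + 1) + x (j - 1)) - (4 * bandCos E + α j * bandSin E) * x j

/-- Multiply the δ-condition by `bandSin E` and replace the four one-sided derivatives by end
values. The phases of the upper and the lower edge add up to `2 cos(Aπ)`, and what is left over
consists of four pairings of `(T - E) u` with sine solutions on the two adjacent rings. The constant
does not depend on the couplings. -/
theorem exists_norm_nodeResidual_sq_le (A E : ℝ) :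
    ∃ K : ℝ, 0 < K ∧ ∀ α u v, IsChainPair A α u v → ∀ j,
      ‖nodeResidual A α E (nodeVal A u v) j‖ ^ 2 ≤
        K * (edgeMass (v - (E : ℂ) • u) j + edgeMass (v - (E : ℂ) • u) (j - 1)) := by
  have hc := continuous_edgeSin E
  obtain ⟨B, hB0, hB⟩ := exists_norm_le_on_edge hc
  have hB' : ∀ t ∈ Icc 0 Real.pi, ‖edgeSin E (Real.pi - t)‖ ≤ B := fun t ht =>
    hB _ ⟨by linarith [ht.2], by linarith [ht.1]⟩
  refine ⟨8 * (B ^ 2 * Real.pi), by positivity, ?_⟩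
  rintro α u v ⟨f, f₁, f₂, h1, h2, h3, h4, h5⟩ j
  have hx : ∀ i, nodeVal A u v i = f 0 i (vertexPt i) := fun i =>
    nodeVal_eq (h1 0 i) (h2 0 i) (h3 0 i)
  set g := v - (E : ℂ) • u
  have hl : ∀ s, quasiDeriv (fieldSign A s) (f s j) (f₁ s j) (vertexPt j) * bandSin E =
      edgePairing A (fun t => edgeSin E (Real.pi - t)) s j g +
        Complex.exp (Complex.I * fieldSign A s * Real.pi) * nodeVal A u v (j + 1) -
        bandCos E * nodeVal A u v j := by
    intro s
    have := quasiDeriv_left_mul (h1 s j) (h2 s j) (h3 s j) E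
    have e := (h4 s (j + 1)).2
    rw [add_sub_cancel_right] at e
    rwa [e, (h4 s j).1, ← hx, ← hx] at this
  have hr : ∀ s, quasiDeriv (fieldSign A s) (f s (j - 1)) (f₁ s (j - 1)) (vertexPt j) *
      bandSin E = bandCos E * nodeVal A u v j -
        Complex.exp (-(Complex.I * fieldSign A s * Real.pi)) *
        (nodeVal A u v (j - 1) + edgePairing A (edgeSin E) s (j - 1) g) := by
    intro s
    have := quasiDeriv_right_mul (h1 s (j - 1)) (h2 s (j - 1)) (h3 s (j - 1)) E
    rwa [sub_add_cancel, (h4 s j).2, (h4 s (j - 1)).1, ← hx, ← hx] at this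
  have key : nodeResidual A α E (nodeVal A u v) j =
      -edgePairing A (fun t => edgeSin E (Real.pi - t)) 0 j g +
      -edgePairing A (fun t => edgeSin E (Real.pi - t)) 1 j g +
      -(Complex.exp (-(Complex.I * fieldSign A 0 * Real.pi)) *
        edgePairing A (edgeSin E) 0 (j - 1) g) +
      -(Complex.exp (-(Complex.I * fieldSign A 1 * Real.pi)) *
        edgePairing A (edgeSin E) 1 (j - 1) g) := by
    have h := h5 j
    rw [Fin.sum_univ_two, ← hx] at h
    rw [nodeResidual]
    linear_combination (bandSin E : ℂ) * h - hl 0 - hl 1 + hr 0 + hr 1 -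
      nodeVal A u v (j + 1) * sum_fieldSign_exp A - nodeVal A u v (j - 1) * sum_fieldSign_exp_neg A
  rw [key]
  have hg := edgeMass_nonneg g
  refine (norm_add_four_sq_le _ _ _ _).trans ?_
  simp only [norm_neg, norm_mul, norm_exp_neg_fieldSign, one_mul]
  have b1 := norm_edgePairing_sq_le A hB' 0 j g
  have b2 := norm_edgePairing_sq_le A hB' 1 j g
  have b3 := norm_edgePairing_sq_le A hB 0 (j - 1) g
  have b4 := norm_edgePairing_sq_le A hB 1 (j - 1) g
  linarith

/-- Variation of constants: away from the Dirichlet spectrum, `u` is controlled on every edge by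
its values at the vertices and by `(T - E) u`. -/
theorem exists_edgeMass_le {A E : ℝ} (hS : bandSin E ≠ 0) :
    ∃ K : ℝ, 0 < K ∧ ∀ α u v, IsChainPair A α u v → ∀ j,
      edgeMass u j ≤ K * (‖nodeVal A u v j‖ ^ 2 + ‖nodeVal A u v (j + 1)‖ ^ 2 +
        edgeMass (v - (E : ℂ) • u) j) := by
  have hcs := continuous_edgeSin E
  have hcc := continuous_edgeCos E
  have hpi := Real.pi_pos
  obtain ⟨B, hB0, hB⟩ := exists_norm_le_on_edge hcs
  obtain ⟨B', hB0', hB'⟩ := exists_norm_le_on_edge hcc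
  have hBr : ∀ t ∈ Icc 0 Real.pi, ‖edgeSin E (Real.pi - t)‖ ≤ B := fun t ht =>
    hB _ ⟨by linarith [ht.2], by linarith [ht.1]⟩
  set D := B / |bandSin E| with hD
  have hDpos : 0 < D := div_pos hB0 (abs_pos.2 hS)
  -- The summands bound the four terms of the representation `hrep` below, and the factor 4 is that
  -- of `norm_add_four_sq_le`.
  set K := 4 * (D ^ 2 * B ^ 2 * Real.pi + D ^ 2 + (D * B' + B') ^ 2 + B ^ 2 * Real.pi) with hK
  have hKpos : 0 < K := by positivity
  refine ⟨2 * Real.pi * K, by positivity, ?_⟩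
  rintro α u v ⟨f, f₁, f₂, h1, h2, h3, h4, h5⟩ j
  have hx : ∀ i, nodeVal A u v i = f 0 i (vertexPt i) := fun i =>
    nodeVal_eq (h1 0 i) (h2 0 i) (h3 0 i)
  set g := v - (E : ℂ) • u with hg
  have hgm := edgeMass_nonneg g j
  have hpt : ∀ s, ∀ t ∈ edgeSet j, ‖f s j t‖ ^ 2 ≤ K * (‖nodeVal A u v j‖ ^ 2 +
      ‖nodeVal A u v (j + 1)‖ ^ 2 + edgeMass g j) := by
    intro s t ht
    have htI : t ∈ Icc (vertexPt j) (vertexPt (j + 1)) := Ioo_subset_Icc_self ht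
    have htl := sub_mem_of_mem_edgeSet ht
    set c := fieldSign A s
    set d := quasiDeriv c (f s j) (f₁ s j) (vertexPt j) with hd
    have hl := quasiDeriv_left_mul (h1 s j) (h2 s j) (h3 s j) E
    have e := (h4 s (j + 1)).2
    rw [add_sub_cancel_right] at e
    rw [e, (h4 s j).1, ← hx, ← hx] at hl
    -- Duhamel's formula: this solution vanishes at `y = t` with derivative `-1`, so Green's
    -- identity on the piece of the edge up to `t` isolates `f s j t`.
    have hG := (h1 s j).green (c := c) (w := fun y => edgeSin E (t - y))
      (w₁ := fun y => -edgeCos E (t - y)) (w₂ := fun y => -(E : ℂ) * edgeSin E (t - y))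
      (fun x => hasDerivAt_comp_const_sub (hasDerivAt_edgeSin E _))
      (fun x => (hasDerivAt_comp_const_sub (hasDerivAt_edgeCos E _)).neg.congr_deriv (by ring))
      (by fun_prop) htI
    simp only [sub_self, edgeSin_zero, edgeCos_zero] at hG
    rw [(h4 s j).1, ← hx, ← hd] at hG
    have hgint : IntegrableOn (fun y => ‖g s y‖) (edgeSet j) :=
      ((Lp.memLp (g s)).restrict (edgeSet j)).integrable (by norm_num) |>.norm
    have hI : ‖∫ y in (vertexPt j)..t, gaugeFactor c (vertexPt j) y *
        (quasiDeriv c (quasiDeriv c (f s j) (f₁ s j)) (quasiDeriv c (f₁ s j) (f₂ s j)) y *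
          edgeSin E (t - y) - f s j y * (-(E : ℂ) * edgeSin E (t - y)))‖ ≤
        B * ∫ y in edgeSet j, ‖g s y‖ := by
      rw [intervalIntegral.integral_of_le htI.1, integral_Ioc_eq_integral_Ioo]
      have hsub : Ioo (vertexPt j) t ⊆ edgeSet j := Ioo_subset_Ioo_right htI.2
      refine (norm_integral_le_of_norm_le ((hgint.mono_set hsub).const_mul B) ?_).trans ?_
      · have a2 := ae_restrict_of_ae_restrict_of_subset hsub (h2 s j)
        have a3 := ae_restrict_of_ae_restrict_of_subset hsub (h3 s j)
        filter_upwards [a2, a3, ae_restrict_of_ae (Lp_sub_smul_ae u v E s),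
          ae_restrict_mem measurableSet_Ioo] with y y2 y3 y4 y5
        rw [Pi.neg_apply] at y3
        have : quasiDeriv c (quasiDeriv c (f s j) (f₁ s j)) (quasiDeriv c (f₁ s j) (f₂ s j)) y *
            edgeSin E (t - y) - f s j y * (-(E : ℂ) * edgeSin E (t - y)) =
            -(g s y * edgeSin E (t - y)) := by
          rw [hg, y4, y3, y2]; ring
        rw [this, norm_mul, norm_gaugeFactor, one_mul, norm_neg, norm_mul, mul_comm]
        refine mul_le_mul_of_nonneg_right (hB _ ⟨by linarith [y5.2], ?_⟩) (norm_nonneg _)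
        linarith [y5.1, htl.2]
      · rw [integral_const_mul]
        exact mul_le_mul_of_nonneg_left (setIntegral_mono_set hgint
          (Eventually.of_forall fun _ => norm_nonneg _) hsub.eventuallyLE) hB0.le
    have hS' : (bandSin E : ℂ) ≠ 0 := by exact_mod_cast hS
    set p := edgePairing A (fun t => edgeSin E (Real.pi - t)) s j g
    set I := ∫ y in (vertexPt j)..t, gaugeFactor c (vertexPt j) y *
        (quasiDeriv c (quasiDeriv c (f s j) (f₁ s j)) (quasiDeriv c (f₁ s j) (f₂ s j)) y *
          edgeSin E (t - y) - f s j y * (-(E : ℂ) * edgeSin E (t - y)))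
    set η := edgeSin E (t - vertexPt j) / bandSin E with hη
    have hηn : ‖η‖ ≤ D := by
      rw [hη, norm_div, Complex.norm_real, Real.norm_eq_abs]
      exact div_le_div_of_nonneg_right (hB _ htl) (abs_nonneg _)
    have hC : ‖(bandCos E : ℂ)‖ ≤ B' := by
      rw [← edgeCos_pi]; exact hB' _ ⟨hpi.le, le_rfl⟩
    have hrep : gaugeFactor c (vertexPt j) t * f s j t =
        η * p + η * (Complex.exp (Complex.I * c * Real.pi) * nodeVal A u v (j + 1)) +
        (-(η * bandCos E) + edgeCos E (t - vertexPt j)) * nodeVal A u v j + I := by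
      have : d = (p + Complex.exp (Complex.I * c * Real.pi) * nodeVal A u v (j + 1) -
          bandCos E * nodeVal A u v j) / bandSin E := by
        rw [eq_div_iff hS']; exact hl
      rw [this] at hG
      rw [hη]
      linear_combination -hG
    have hn : ‖f s j t‖ = ‖gaugeFactor c (vertexPt j) t * f s j t‖ := by
      rw [norm_mul, norm_gaugeFactor, one_mul]
    rw [hn, hrep]
    refine (norm_add_four_sq_le _ _ _ _).trans ?_
    have b1 : ‖η * p‖ ^ 2 ≤ D ^ 2 * (B ^ 2 * Real.pi * edgeMass g j) := by
      rw [norm_mul, mul_pow]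
      have := norm_edgePairing_sq_le A hBr s j g
      gcongr
    have b2 : ‖η * (Complex.exp (Complex.I * c * Real.pi) * nodeVal A u v (j + 1))‖ ^ 2 ≤
        D ^ 2 * ‖nodeVal A u v (j + 1)‖ ^ 2 := by
      rw [norm_mul, norm_mul, norm_exp_fieldSign, one_mul, mul_pow]
      gcongr
    have b3 : ‖(-(η * bandCos E) + edgeCos E (t - vertexPt j)) * nodeVal A u v j‖ ^ 2 ≤
        (D * B' + B') ^ 2 * ‖nodeVal A u v j‖ ^ 2 := by
      rw [norm_mul, mul_pow]
      gcongr
      refine (norm_add_le _ _).trans (add_le_add ?_ (hB' _ htl))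
      rw [norm_neg, norm_mul]
      gcongr
    have b4 : ‖I‖ ^ 2 ≤ B ^ 2 * (Real.pi * edgeMass g j) := by
      calc ‖I‖ ^ 2 ≤ (B * ∫ y in edgeSet j, ‖g s y‖) ^ 2 := by gcongr
        _ = B ^ 2 * (∫ y in edgeSet j, ‖g s y‖) ^ 2 := by ring
        _ ≤ _ := by gcongr; exact sq_integral_norm_le g s j
    have n1 : 0 ≤ (D ^ 2 * B ^ 2 * Real.pi + D ^ 2 + B ^ 2 * Real.pi) *
        ‖nodeVal A u v j‖ ^ 2 := by positivity
    have n2 : 0 ≤ (D ^ 2 * B ^ 2 * Real.pi + (D * B' + B') ^ 2 + B ^ 2 * Real.pi) *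
        ‖nodeVal A u v (j + 1)‖ ^ 2 := by positivity
    have n3 : 0 ≤ (D ^ 2 + (D * B' + B') ^ 2) * edgeMass g j := by positivity
    rw [hK]
    linarith
  have hs : ∀ s, ∫ t in edgeSet j, ‖u s t‖ ^ 2 ≤ Real.pi * (K * (‖nodeVal A u v j‖ ^ 2 +
      ‖nodeVal A u v (j + 1)‖ ^ 2 + edgeMass g j)) := by
    intro s
    have : ∫ t in edgeSet j, K * (‖nodeVal A u v j‖ ^ 2 +
      ‖nodeVal A u v (j + 1)‖ ^ 2 + edgeMass g j) = Real.pi * (K * (‖nodeVal A u v j‖ ^ 2 +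
      ‖nodeVal A u v (j + 1)‖ ^ 2 + edgeMass g j)) := by
      rw [integral_const, Measure.real, Measure.restrict_apply_univ, volume_edgeSet,
        ENNReal.toReal_ofReal hpi.le, smul_eq_mul]
    rw [← this]
    refine integral_mono_ae (integrableOn_norm_sq u s _) (integrable_const _) ?_
    filter_upwards [h2 s j, ae_restrict_mem (measurableSet_edgeSet j)] with t ht ht'
    rw [ht]
    exact hpt s t ht'
  rw [edgeMass, Fin.sum_univ_two]
  linarith [hs 0, hs 1]

/-! ### Square summable solutions of the difference equation -/

theorem summable_norm_sq_shift {x : ℤ → ℂ} (hx : Summable fun j => ‖x j‖ ^ 2) (i : ℤ) :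
    Summable fun j => ‖x (j + i)‖ ^ 2 :=
  (Equiv.summable_iff (f := fun j => ‖x j‖ ^ 2) (Equiv.addRight i)).2 hx

theorem tsum_norm_sq_shift (x : ℤ → ℂ) (i : ℤ) :
    ∑' j, ‖x (j + i)‖ ^ 2 = ∑' j, ‖x j‖ ^ 2 :=
  (Equiv.addRight i).tsum_eq fun j => ‖x j‖ ^ 2

/-- The sum of the two shifts has norm at most 2 on `ℓ²`, so `2 ξ` minus it is bounded below by `2
(|ξ| - 1)`. The inequality is obtained node by node from weighted Young inequalities and then
summed. -/
theorem sq_sub_one_mul_tsum_le {x r : ℤ → ℂ} {ξ : ℝ} (hξ : 1 < |ξ|)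
    (hx : Summable fun j => ‖x j‖ ^ 2) (hr : Summable fun j => ‖r j‖ ^ 2)
    (h : ∀ j, 2 * (ξ : ℂ) * x j = x (j + 1) + x (j - 1) + r j) :
    4 * (|ξ| - 1) ^ 2 * ∑' j, ‖x j‖ ^ 2 ≤ ∑' j, ‖r j‖ ^ 2 := by
  set X := |ξ| with hX
  have hδ : 0 < X - 1 := by linarith
  have hX0 : 0 < X := by linarith
  have hpt : ∀ j, 4 * X ^ 2 * ‖x j‖ ^ 2 ≤
      2 * X * ‖x (j + 1)‖ ^ 2 + 2 * X * ‖x (j + -1)‖ ^ 2 + X / (X - 1) * ‖r j‖ ^ 2 := by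
    intro j
    have h1 : ‖2 * (ξ : ℂ) * x j‖ = 2 * X * ‖x j‖ := by
      rw [norm_mul, norm_mul, Complex.norm_real, Complex.norm_two, Real.norm_eq_abs]
    have h2 : 2 * X * ‖x j‖ ≤ ‖x (j + 1)‖ + ‖x (j - 1)‖ + ‖r j‖ := by
      rw [← h1, h j]; exact norm_add₃_le
    rw [← sub_eq_add_neg]
    set p := ‖x (j + 1)‖
    set q := ‖x (j - 1)‖
    have h3 : (2 * X * ‖x j‖) ^ 2 ≤ (p + q + ‖r j‖) ^ 2 := by gcongr
    -- Young's inequality with the conjugate weights `1 / X` and `(X - 1) / X`; the weight `X` on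
    -- `(p + q) ^ 2` is small enough to be absorbed after summation.
    have h4 : (p + q + ‖r j‖) ^ 2 ≤ X * (p + q) ^ 2 + X / (X - 1) * ‖r j‖ ^ 2 := by
      have : X * (p + q) ^ 2 + X / (X - 1) * ‖r j‖ ^ 2 - (p + q + ‖r j‖) ^ 2 =
          ((X - 1) * (p + q) - ‖r j‖) ^ 2 / (X - 1) := by
        field_simp; ring
      have h5 : 0 ≤ ((X - 1) * (p + q) - ‖r j‖) ^ 2 / (X - 1) := by positivity
      linarith
    nlinarith [mul_nonneg hX0.le (sq_nonneg (p - q))]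
  have hs1 := summable_norm_sq_shift hx 1
  have hs2 := summable_norm_sq_shift hx (-1)
  have := (hx.mul_left (4 * X ^ 2)).tsum_le_tsum hpt
    (((hs1.mul_left (2 * X)).add (hs2.mul_left (2 * X))).add (hr.mul_left (X / (X - 1))))
  rw [((hs1.mul_left (2 * X)).add (hs2.mul_left (2 * X))).tsum_add (hr.mul_left (X / (X - 1))),
    (hs1.mul_left (2 * X)).tsum_add (hs2.mul_left (2 * X)), tsum_mul_left, tsum_mul_left,
    tsum_mul_left, tsum_mul_left, tsum_norm_sq_shift, tsum_norm_sq_shift] at this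
  set Sx := ∑' j, ‖x j‖ ^ 2
  set Sr := ∑' j, ‖r j‖ ^ 2
  have h6 : 4 * X * (X - 1) * Sx ≤ X / (X - 1) * Sr := by linarith
  rw [div_mul_eq_mul_div, le_div_iff₀ hδ] at h6
  have h7 : X * (4 * (X - 1) ^ 2 * Sx) ≤ X * Sr := by linarith
  exact le_of_mul_le_mul_left h7 hX0

theorem summable_norm_nodeVal_sq (A : ℝ) (u v : ChainSpace) :
    Summable fun j => ‖nodeVal A u v j‖ ^ 2 := by
  obtain ⟨K, hK, h⟩ := exists_norm_nodeVal_sq_le A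
  exact Summable.of_nonneg_of_le (fun j => by positivity) (h u v)
    (((hasSum_edgeMass u).summable.add (hasSum_edgeMass v).summable).mul_left K)

theorem exists_tsum_nodeVal_le (A : ℝ) : ∃ K : ℝ, 0 < K ∧ ∀ u v,
    ∑' j, ‖nodeVal A u v j‖ ^ 2 ≤ K * (‖u‖ ^ 2 + ‖v‖ ^ 2) := by
  obtain ⟨K, hK, h⟩ := exists_norm_nodeVal_sq_le A
  refine ⟨K, hK, fun u v => ?_⟩
  have := ((hasSum_edgeMass u).add (hasSum_edgeMass v)).mul_left K
  exact (Summable.tsum_le_tsum (h u v) (summable_norm_nodeVal_sq A u v) this.summable).trans_eq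
    this.tsum_eq

theorem exists_norm_sq_le {A E : ℝ} (hS : bandSin E ≠ 0) :
    ∃ K : ℝ, 0 < K ∧ ∀ α u v, IsChainPair A α u v →
      ‖u‖ ^ 2 ≤ K * (∑' j, ‖nodeVal A u v j‖ ^ 2 + ‖v - (E : ℂ) • u‖ ^ 2) := by
  obtain ⟨K, hK, h⟩ := exists_edgeMass_le (A := A) hS
  refine ⟨2 * K, mul_pos two_pos hK, fun α u v hp => ?_⟩
  have hx := summable_norm_nodeVal_sq A u v
  have hg := hasSum_edgeMass (v - (E : ℂ) • u)
  have hs1 := summable_norm_sq_shift hx 1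
  have hs : HasSum (fun j => K * (‖nodeVal A u v j‖ ^ 2 + ‖nodeVal A u v (j + 1)‖ ^ 2 +
      edgeMass (v - (E : ℂ) • u) j)) (K * (∑' j, ‖nodeVal A u v j‖ ^ 2 +
        ∑' j, ‖nodeVal A u v j‖ ^ 2 + ‖v - (E : ℂ) • u‖ ^ 2)) := by
    have h1 := hs1.hasSum
    rw [tsum_norm_sq_shift] at h1
    exact ((hx.hasSum.add h1).add hg).mul_left K
  have h2 := hasSum_le (h α u v hp) (hasSum_edgeMass u) hs
  have h0 : 0 ≤ K * ‖v - (E : ℂ) • u‖ ^ 2 := by positivity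
  refine h2.trans ?_
  generalize ‖v - (E : ℂ) • u‖ ^ 2 = G at *
  generalize ∑' j, ‖nodeVal A u v j‖ ^ 2 = X at *
  linarith

theorem exists_tsum_nodeResidual_le (A E : ℝ) :
    ∃ K : ℝ, 0 < K ∧ ∀ α u v, IsChainPair A α u v →
      (Summable fun j => ‖nodeResidual A α E (nodeVal A u v) j‖ ^ 2) ∧
      ∑' j, ‖nodeResidual A α E (nodeVal A u v) j‖ ^ 2 ≤ K * ‖v - (E : ℂ) • u‖ ^ 2 := by
  obtain ⟨K, hK, h⟩ := exists_norm_nodeResidual_sq_le A E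
  refine ⟨2 * K, mul_pos two_pos hK, ?_⟩
  intro α u v hp
  have hg := hasSum_edgeMass (v - (E : ℂ) • u)
  have hg1 : HasSum (fun j => edgeMass (v - (E : ℂ) • u) (j - 1)) (‖v - (E : ℂ) • u‖ ^ 2) :=
    (Equiv.hasSum_iff (f := edgeMass (v - (E : ℂ) • u)) (Equiv.subRight (1 : ℤ))).2 hg
  have hsum := (hg.add hg1).mul_left K
  have hr : Summable fun j => ‖nodeResidual A α E (nodeVal A u v) j‖ ^ 2 :=
    Summable.of_nonneg_of_le (fun j => by positivity) (h α u v hp) hsum.summable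
  refine ⟨hr, ?_⟩
  have h1 := hasSum_le (h α u v hp) hr.hasSum hsum
  have h2 : K * (‖v - (E : ℂ) • u‖ ^ 2 + ‖v - (E : ℂ) • u‖ ^ 2) =
    2 * K * ‖v - (E : ℂ) • u‖ ^ 2 := by ring
  exact h1.trans_eq h2

/-! ### Construction of elements of the domain -/

theorem floor_div_pi_eq {j : ℤ} {t : ℝ} (h : t ∈ Ico (vertexPt j) (vertexPt (j + 1))) :
    ⌊t / Real.pi⌋ = j := by
  rw [Int.floor_eq_iff, le_div_iff₀ Real.pi_pos, div_lt_iff₀ Real.pi_pos]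
  simpa [vertexPt] using h

/-- All edges have the same length, so square summable sup bounds suffice for square integrability.
Gluing through `⌊t / π⌋` keeps the function measurable. -/
theorem exists_Lp_of_edges (G : ℤ → ℝ → ℂ) (hG : ∀ j, Continuous (G j)) (B : ℤ → ℝ)
    (hB : Summable fun j => B j ^ 2) (hGB : ∀ j, ∀ t ∈ edgeSet j, ‖G j t‖ ≤ B j) :
    ∃ w : Lp ℂ 2 (volume : Measure ℝ), ∀ j, (w : ℝ → ℂ) =ᵐ[volume.restrict (edgeSet j)] G j := by
  set U : ℝ → ℂ := fun t => G ⌊t / Real.pi⌋ t with hU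
  have hmeas : Measurable U := by
    have h1 : Measurable fun p : ℤ × ℝ => G p.1 p.2 :=
      measurable_from_prod_countable_right fun j => (hG j).measurable
    exact h1.comp ((Int.measurable_floor.comp (measurable_id.div_const _)).prodMk measurable_id)
  have hUG : ∀ j, ∀ t ∈ Ico (vertexPt j) (vertexPt (j + 1)), U t = G j t := fun j t ht => by
    simp only [hU, floor_div_pi_eq ht]
  have hres : ∀ j, volume.restrict (Ico (vertexPt j) (vertexPt (j + 1))) =
      volume.restrict (edgeSet j) := fun j => restrict_Ioo_eq_restrict_Ico.symm
  have hbd : ∀ j, ∀ᵐ t ∂volume.restrict (edgeSet j), ‖‖U t‖ ^ 2‖ ≤ B j ^ 2 := fun j => by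
    filter_upwards [ae_restrict_mem (measurableSet_edgeSet j)] with t ht
    rw [hUG j t (Ioo_subset_Ico_self ht), Real.norm_of_nonneg (by positivity)]
    exact pow_le_pow_left₀ (norm_nonneg _) (hGB j t ht) 2
  have hint : ∀ j, IntegrableOn (fun t => ‖U t‖ ^ 2) (Ico (vertexPt j) (vertexPt (j + 1))) := by
    intro j
    rw [IntegrableOn, hres]
    exact Integrable.of_bound (hmeas.norm.pow_const 2).aestronglyMeasurable _ (hbd j)
  have hmem : MemLp U 2 volume := by
    rw [memLp_two_iff_integrable_sq_norm hmeas.aestronglyMeasurable, ← integrableOn_univ,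
      ← iUnion_Ico_vertexPt]
    refine integrableOn_iUnion_of_summable_integral_norm hint ?_
    refine Summable.of_nonneg_of_le (fun j => integral_nonneg fun _ => norm_nonneg _) (fun j => ?_)
      (hB.mul_left Real.pi)
    rw [hres]
    have := integral_mono_ae (μ := volume.restrict (edgeSet j)) (f := fun t => ‖‖U t‖ ^ 2‖)
      (g := fun _ => B j ^ 2) (by have := hint j; rw [IntegrableOn, hres] at this; exact this.norm)
      (integrable_const _) (hbd j)
    rwa [integral_const, Measure.real, Measure.restrict_apply_univ, volume_edgeSet,
      ENNReal.toReal_ofReal Real.pi_pos.le, smul_eq_mul] at this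
  refine ⟨hmem.toLp U, fun j => ?_⟩
  filter_upwards [ae_restrict_of_ae hmem.coeFn_toLp, ae_restrict_mem (measurableSet_edgeSet j)]
    with t h1 h2
  rw [h1, hUG j t (Ioo_subset_Ico_self h2)]

/-- The data `F` are given in the gauge without field and in the local coordinate on `[0, π]`.
Multiplication by the opposite gauge factor turns ordinary derivatives into quasiderivatives; this
is why phases enter the condition at the right end and the vertex condition. -/
theorem exists_chainPair_of_edges {A : ℝ} {α : ℤ → ℝ} {F F₁ F₂ : Fin 2 → ℤ → ℝ → ℂ}
    (hF : ∀ s j t, HasDerivAt (F s j) (F₁ s j t) t)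
    (hF₁ : ∀ s j t, HasDerivAt (F₁ s j) (F₂ s j t) t) (hF₂ : ∀ s j, Continuous (F₂ s j))
    {x : ℤ → ℂ} (hl : ∀ s j, F s j 0 = x j)
    (hr : ∀ s j, F s j Real.pi = Complex.exp (Complex.I * fieldSign A s * Real.pi) * x (j + 1))
    (hk : ∀ j, ∑ s, (F₁ s j 0 - Complex.exp (-(Complex.I * fieldSign A s * Real.pi)) *
      F₁ s (j - 1) Real.pi) = α j * x j)
    {B : ℤ → ℝ} (hB : Summable fun j => B j ^ 2)
    (hFB : ∀ s j, ∀ t ∈ Icc 0 Real.pi, ‖F s j t‖ ≤ B j)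
    (hFB₂ : ∀ s j, ∀ t ∈ Icc 0 Real.pi, ‖F₂ s j t‖ ≤ B j) :
    ∃ u v, IsChainPair A α u v ∧ nodeVal A u v = x ∧
      (∀ s j, (u s : ℝ → ℂ) =ᵐ[volume.restrict (edgeSet j)] fun t =>
        gaugeFactor (-fieldSign A s) (vertexPt j) t * F s j (t - vertexPt j)) ∧
      ∀ s j, (v s : ℝ → ℂ) =ᵐ[volume.restrict (edgeSet j)] fun t =>
        -(gaugeFactor (-fieldSign A s) (vertexPt j) t * F₂ s j (t - vertexPt j)) := by
  have hFc : ∀ s j, Continuous (F s j) := fun s j =>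
    continuous_iff_continuousAt.2 fun y => (hF s j y).continuousAt
  have hgc : ∀ s j, Continuous (gaugeFactor (-fieldSign A s) (vertexPt j)) := fun s j =>
    continuous_gaugeFactor _ _
  have h1 : ∀ s, ∃ w : Lp ℂ 2 (volume : Measure ℝ), ∀ j,
      (w : ℝ → ℂ) =ᵐ[volume.restrict (edgeSet j)] fun t =>
        gaugeFactor (-fieldSign A s) (vertexPt j) t * F s j (t - vertexPt j) := by
    refine fun s => exists_Lp_of_edges _ (fun j => ?_) B hB fun j t ht => ?_
    · have := hFc s j; have := hgc s j; fun_prop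
    · rw [norm_mul, norm_gaugeFactor, one_mul]
      exact hFB s j _ (sub_mem_of_mem_edgeSet ht)
  have h2 : ∀ s, ∃ w : Lp ℂ 2 (volume : Measure ℝ), ∀ j,
      (w : ℝ → ℂ) =ᵐ[volume.restrict (edgeSet j)] fun t =>
        -(gaugeFactor (-fieldSign A s) (vertexPt j) t * F₂ s j (t - vertexPt j)) := by
    refine fun s => exists_Lp_of_edges _ (fun j => ?_) B hB fun j t ht => ?_
    · have := hF₂ s j; have := hgc s j; fun_prop
    · rw [norm_neg, norm_mul, norm_gaugeFactor, one_mul]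
      exact hFB₂ s j _ (sub_mem_of_mem_edgeSet ht)
  choose u hu using h1
  choose v hv using h2
  set f : Fin 2 → ℤ → ℝ → ℂ := fun s j t =>
    gaugeFactor (-fieldSign A s) (vertexPt j) t * F s j (t - vertexPt j) with hf
  set f₁ : Fin 2 → ℤ → ℝ → ℂ := fun s j t => gaugeFactor (-fieldSign A s) (vertexPt j) t *
    (F₁ s j (t - vertexPt j) - Complex.I * fieldSign A s * F s j (t - vertexPt j)) with hf₁
  set f₂ : Fin 2 → ℤ → ℝ → ℂ := fun s j t => gaugeFactor (-fieldSign A s) (vertexPt j) t *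
    (F₂ s j (t - vertexPt j) - 2 * Complex.I * fieldSign A s * F₁ s j (t - vertexPt j) +
      (Complex.I * fieldSign A s) ^ 2 * F s j (t - vertexPt j)) with hf₂
  have dF : ∀ s j t, HasDerivAt (fun t => F s j (t - vertexPt j)) (F₁ s j (t - vertexPt j)) t :=
    fun s j t => by simpa using (hF s j (t - vertexPt j)).comp_sub_const t (vertexPt j)
  have dF₁ : ∀ s j t, HasDerivAt (fun t => F₁ s j (t - vertexPt j)) (F₂ s j (t - vertexPt j)) t :=
    fun s j t => by simpa using (hF₁ s j (t - vertexPt j)).comp_sub_const t (vertexPt j)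
  have d1 : ∀ s j t, HasDerivAt (f s j) (f₁ s j t) t := fun s j t =>
    ((hasDerivAt_gaugeFactor _ _ t).mul (dF s j t)).congr_deriv (by
      simp only [hf₁, Complex.ofReal_neg]; ring)
  have d2 : ∀ s j t, HasDerivAt (f₁ s j) (f₂ s j t) t := fun s j t =>
    ((hasDerivAt_gaugeFactor _ _ t).mul ((dF₁ s j t).sub ((dF s j t).const_mul _))).congr_deriv (by
      simp only [hf₂, Complex.ofReal_neg, Pi.sub_apply]; ring)
  have hF₁c : ∀ s j, Continuous (F₁ s j) := fun s j =>
    continuous_iff_continuousAt.2 fun y => (hF₁ s j y).continuousAt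
  have hH : ∀ s j, IsH2On (vertexPt j) (vertexPt (j + 1)) (f s j) (f₁ s j) (f₂ s j) := fun s j =>
    isH2On_of_hasDerivAt (d1 s j) (d2 s j) (by
      have := hFc s j; have := hF₁c s j; have := hF₂ s j; have := hgc s j
      simp only [hf₂]; fun_prop)
  have q1 : ∀ s j t, quasiDeriv (fieldSign A s) (f s j) (f₁ s j) t =
      gaugeFactor (-fieldSign A s) (vertexPt j) t * F₁ s j (t - vertexPt j) := fun s j t => by
    simp only [quasiDeriv, hf, hf₁]; ring
  have q2 : ∀ s j t, quasiDeriv (fieldSign A s) (quasiDeriv (fieldSign A s) (f s j) (f₁ s j))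
      (quasiDeriv (fieldSign A s) (f₁ s j) (f₂ s j)) t =
      gaugeFactor (-fieldSign A s) (vertexPt j) t * F₂ s j (t - vertexPt j) := fun s j t => by
    simp only [quasiDeriv, hf, hf₁, hf₂]; ring
  have hend : ∀ s j, gaugeFactor (-fieldSign A s) (vertexPt (j - 1)) (vertexPt j) =
      Complex.exp (-(Complex.I * fieldSign A s * Real.pi)) := fun s j => by
    have : vertexPt j = vertexPt (j - 1) + Real.pi := by rw [← vertexPt_succ]; simp
    rw [gaugeFactor, this]; push_cast; ring_nf
  have hdiff : ∀ j, vertexPt j - vertexPt (j - 1) = Real.pi := fun j => by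
    have : vertexPt j = vertexPt (j - 1) + Real.pi := by rw [← vertexPt_succ]; simp
    rw [this]; ring
  have v1 : ∀ s j, f s j (vertexPt j) = x j := fun s j => by
    simp only [hf, gaugeFactor_self, sub_self, one_mul, hl]
  have v2 : ∀ s j, f s (j - 1) (vertexPt j) = x j := fun s j => by
    simp only [hf, hend, hdiff, hr, sub_add_cancel]
    rw [← mul_assoc, ← Complex.exp_add]; simp
  have hv' : ∀ s j, (v s : ℝ → ℂ) =ᵐ[volume.restrict (edgeSet j)]
      -quasiDeriv (fieldSign A s) (quasiDeriv (fieldSign A s) (f s j) (f₁ s j))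
        (quasiDeriv (fieldSign A s) (f₁ s j) (f₂ s j)) := fun s j => by
    filter_upwards [hv s j] with t ht
    rw [ht, Pi.neg_apply, q2]
  refine ⟨WithLp.toLp 2 u, WithLp.toLp 2 v, ⟨f, f₁, f₂, hH, hu, hv', fun s j => ?_, fun j => ?_⟩,
    ?_, hu, hv⟩
  · rw [v1, v1, v2]; exact ⟨rfl, rfl⟩
  · rw [v1, ← hk j]
    refine Finset.sum_congr rfl fun s _ => ?_
    rw [q1, q1, hend, hdiff, gaugeFactor_self, sub_self, one_mul]
  · funext j
    rw [nodeVal_eq (hH 0 j) (hu 0 j) (hv' 0 j), v1]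

theorem edgeMass_le_of_ae {w : ChainSpace} {j : ℤ} {C : ℝ}
    (h : ∀ s, ∀ᵐ t ∂volume.restrict (edgeSet j), ‖w s t‖ ≤ C) :
    edgeMass w j ≤ 2 * Real.pi * C ^ 2 := by
  have hs : ∀ s, ∫ t in edgeSet j, ‖w s t‖ ^ 2 ≤ Real.pi * C ^ 2 := by
    intro s
    have := integral_mono_ae (μ := volume.restrict (edgeSet j)) (integrableOn_norm_sq w s _)
      (integrable_const (C ^ 2)) (by
        filter_upwards [h s] with t ht
        exact pow_le_pow_left₀ (norm_nonneg _) ht 2)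
    rwa [integral_const, Measure.real, Measure.restrict_apply_univ, volume_edgeSet,
      ENNReal.toReal_ofReal Real.pi_pos.le, smul_eq_mul] at this
  rw [edgeMass, Fin.sum_univ_two]
  linarith [hs 0, hs 1]

/-- Interpolate the nodal values by solutions of the free equation on each edge. The interpolation
is continuous but violates the δ-condition at `j` by the residual divided by `bandSin E`. A multiple
of `nodeTest` changes the derivative at the left end of an edge and none of the other boundary data;
it repairs the condition, and it is the only contribution to `(T - E) u`. -/
theorem exists_chainPair_of_nodes (A : ℝ) {E : ℝ} (hS : bandSin E ≠ 0) :
    ∃ K : ℝ, 0 < K ∧ ∀ (α : ℤ → ℝ) (x : ℤ → ℂ), (Summable fun j => ‖x j‖ ^ 2) →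
      (Summable fun j => ‖nodeResidual A α E x j‖ ^ 2) →
      ∃ u v, IsChainPair A α u v ∧ nodeVal A u v = x ∧
        (∀ j, edgeMass (v - (E : ℂ) • u) j ≤ K * ‖nodeResidual A α E x j‖ ^ 2) ∧
        ∀ j, x j = 0 → x (j + 1) = 0 → nodeResidual A α E x j = 0 → edgeMass u j = 0 := by
  have hcs := continuous_edgeSin E
  have hcc := continuous_edgeCos E
  have hn := continuous_nodeTest
  have hn2 := continuous_nodeTest₂
  have hS' : (bandSin E : ℂ) ≠ 0 := by exact_mod_cast hS
  obtain ⟨D, hD0, hD⟩ := exists_norm_le_on_edge (φ := fun t => nodeTest₂ t + E * nodeTest t)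
    (by fun_prop)
  set D' := D / (2 * |bandSin E|) with hD'
  have hD'0 : 0 < D' := div_pos hD0 (mul_pos two_pos (abs_pos.2 hS))
  obtain ⟨M0, hM00, hM0⟩ := exists_norm_le_on_edge
    (φ := fun t => edgeSin E (Real.pi - t) / bandSin E) (by fun_prop)
  obtain ⟨M1, hM10, hM1⟩ := exists_norm_le_on_edge
    (φ := fun t => edgeSin E t / bandSin E) (by fun_prop)
  obtain ⟨M2, hM20, hM2⟩ := exists_norm_le_on_edge
    (φ := fun t => nodeTest t / (2 * bandSin E)) (by fun_prop)
  obtain ⟨M3, hM30, hM3⟩ := exists_norm_le_on_edge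
    (φ := fun t => nodeTest₂ t / (2 * bandSin E)) (by fun_prop)
  set M := (1 + |E|) * (M0 + M1) + M2 + M3 with hM
  have hMpos : 0 < M := by positivity
  have hMe : M = M0 + M1 + |E| * M0 + |E| * M1 + M2 + M3 := by rw [hM]; ring
  have p0 : 0 ≤ |E| * M0 := by positivity
  have p1 : 0 ≤ |E| * M1 := by positivity
  have b0 : ∀ t ∈ Icc 0 Real.pi, ‖edgeSin E (Real.pi - t) / bandSin E‖ ≤ M := fun t ht =>
    (hM0 t ht).trans (by linarith)
  have b1 : ∀ t ∈ Icc 0 Real.pi, ‖edgeSin E t / bandSin E‖ ≤ M := fun t ht =>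
    (hM1 t ht).trans (by linarith)
  have b2 : ∀ t ∈ Icc 0 Real.pi, ‖nodeTest t / (2 * bandSin E)‖ ≤ M := fun t ht =>
    (hM2 t ht).trans (by linarith)
  have b3 : ∀ t ∈ Icc 0 Real.pi, ‖nodeTest₂ t / (2 * bandSin E)‖ ≤ M := fun t ht =>
    (hM3 t ht).trans (by linarith)
  have b0' : ∀ t ∈ Icc 0 Real.pi, ‖-(E : ℂ) * edgeSin E (Real.pi - t) / bandSin E‖ ≤ M :=
    fun t ht => by
      rw [mul_div_assoc, norm_mul, norm_neg, Complex.norm_real, Real.norm_eq_abs]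
      linarith [mul_le_mul_of_nonneg_left (hM0 t ht) (abs_nonneg E)]
  have b1' : ∀ t ∈ Icc 0 Real.pi, ‖-(E : ℂ) * edgeSin E t / bandSin E‖ ≤ M :=
    fun t ht => by
      rw [mul_div_assoc, norm_mul, norm_neg, Complex.norm_real, Real.norm_eq_abs]
      linarith [mul_le_mul_of_nonneg_left (hM1 t ht) (abs_nonneg E)]
  refine ⟨2 * Real.pi * D' ^ 2, mul_pos (mul_pos two_pos Real.pi_pos) (pow_pos hD'0 2), ?_⟩
  intro α x hx hres
  set ρ := nodeResidual A α E x with hρ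
  set e : Fin 2 → ℂ := fun s => Complex.exp (Complex.I * fieldSign A s * Real.pi) with he
  -- The defect is shared equally by the two lines, hence the factor 2 in the last denominator.
  set F : Fin 2 → ℤ → ℝ → ℂ := fun s j t =>
    edgeSin E (Real.pi - t) / bandSin E * x j + edgeSin E t / bandSin E * (e s * x (j + 1)) -
      nodeTest t / (2 * bandSin E) * ρ j with hF
  set F₁ : Fin 2 → ℤ → ℝ → ℂ := fun s j t =>
    -edgeCos E (Real.pi - t) / bandSin E * x j + edgeCos E t / bandSin E * (e s * x (j + 1)) -
      nodeTest₁ t / (2 * bandSin E) * ρ j with hF₁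
  set F₂ : Fin 2 → ℤ → ℝ → ℂ := fun s j t =>
    -(E : ℂ) * edgeSin E (Real.pi - t) / bandSin E * x j +
      -(E : ℂ) * edgeSin E t / bandSin E * (e s * x (j + 1)) -
      nodeTest₂ t / (2 * bandSin E) * ρ j with hF₂
  have d1 : ∀ s j t, HasDerivAt (F s j) (F₁ s j t) t := fun s j t =>
    ((((hasDerivAt_comp_const_sub (hasDerivAt_edgeSin E _)).div_const _).mul_const _).add
      (((hasDerivAt_edgeSin E t).div_const _).mul_const _)).sub
      (((hasDerivAt_nodeTest t).div_const _).mul_const _)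
  have d2 : ∀ s j t, HasDerivAt (F₁ s j) (F₂ s j t) t := fun s j t =>
    (((((hasDerivAt_comp_const_sub (hasDerivAt_edgeCos E (Real.pi - t))).neg.congr_deriv
      (show _ = -(E : ℂ) * edgeSin E (Real.pi - t) by ring)).div_const _).mul_const _).add
      (((hasDerivAt_edgeCos E t).div_const _).mul_const _)).sub
      (((hasDerivAt_nodeTest₁ t).div_const _).mul_const _)
  have hen : ∀ s, ‖e s‖ = 1 := fun s => norm_exp_fieldSign A s
  have hee : ∀ s, Complex.exp (-(Complex.I * fieldSign A s * Real.pi)) * e s = 1 := fun s => by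
    rw [he, ← Complex.exp_add]; simp
  obtain ⟨t1, t2, t3, t4⟩ := nodeTest_boundary
  set B : ℤ → ℝ := fun j => M * (‖x j‖ + ‖x (j + 1)‖ + ‖ρ j‖) with hB
  have hBs : Summable fun j => B j ^ 2 := by
    refine Summable.of_nonneg_of_le (fun j => sq_nonneg _) (fun j => ?_)
      (((hx.add (summable_norm_sq_shift hx 1)).add hres).mul_left (3 * M ^ 2))
    rw [hB]
    have : (‖x j‖ + ‖x (j + 1)‖ + ‖ρ j‖) ^ 2 ≤ 3 * (‖x j‖ ^ 2 + ‖x (j + 1)‖ ^ 2 + ‖ρ j‖ ^ 2) := by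
      nlinarith [sq_nonneg (‖x j‖ - ‖x (j + 1)‖), sq_nonneg (‖x j‖ - ‖ρ j‖),
        sq_nonneg (‖x (j + 1)‖ - ‖ρ j‖)]
    calc (M * (‖x j‖ + ‖x (j + 1)‖ + ‖ρ j‖)) ^ 2 = M ^ 2 * (‖x j‖ + ‖x (j + 1)‖ + ‖ρ j‖) ^ 2 := by
          ring
      _ ≤ M ^ 2 * (3 * (‖x j‖ ^ 2 + ‖x (j + 1)‖ ^ 2 + ‖ρ j‖ ^ 2)) := by gcongr
      _ = _ := by ring
  have hsum : ∀ {p q r : ℂ}, ‖p‖ ≤ M → ‖q‖ ≤ M → ‖r‖ ≤ M → ∀ s j,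
      ‖p * x j + q * (e s * x (j + 1)) - r * ρ j‖ ≤ B j := by
    intro p q r hp hq hr s j
    refine (norm_sub_le _ _).trans ((add_le_add_left (norm_add_le _ _) _).trans ?_)
    rw [norm_mul, norm_mul, norm_mul, norm_mul, hen, one_mul, hB]
    have := mul_le_mul_of_nonneg_right hp (norm_nonneg (x j))
    have := mul_le_mul_of_nonneg_right hq (norm_nonneg (x (j + 1)))
    have := mul_le_mul_of_nonneg_right hr (norm_nonneg (ρ j))
    simp only; linarith
  obtain ⟨u, v, hp, hnode, hu, hv⟩ := exists_chainPair_of_edges (A := A) (α := α) (x := x) d1 d2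
    (fun s j => by simp only [hF₂]; fun_prop)
    (fun s j => by simp only [hF, sub_zero, edgeSin_zero, edgeSin_pi, t1]; field_simp; ring)
    (fun s j => by simp only [hF, sub_self, edgeSin_zero, edgeSin_pi, t3]; field_simp; ring)
    (fun j => by
      rw [Fin.sum_univ_two]
      simp only [hF₁, sub_zero, sub_self, edgeCos_zero, edgeCos_pi, t2, t4, sub_add_cancel]
      have h0 := sum_fieldSign_exp A
      have h1 := sum_fieldSign_exp_neg A
      have hee0 := hee 0
      have hee1 := hee 1
      have hr : ρ j = 2 * Real.cos (A * Real.pi) * (x (j + 1) + x (j - 1)) -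
        (4 * bandCos E + α j * bandSin E) * x j := rfl
      change e 0 + e 1 = _ at h0
      generalize Complex.exp (-(Complex.I * fieldSign A 0 * Real.pi)) = e0 at *
      generalize Complex.exp (-(Complex.I * fieldSign A 1 * Real.pi)) = e1 at *
      field_simp
      rw [hr]
      linear_combination 2 * x (j + 1) * h0 + 2 * x (j - 1) * h1 -
        2 * x j * bandCos E * hee0 - 2 * x j * bandCos E * hee1)
    hBs (fun s j t ht => hsum (b0 t ht) (b1 t ht) (b2 t ht) s j)
    (fun s j t ht => hsum (b0' t ht) (b1' t ht) (b3 t ht) s j)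
  refine ⟨u, v, hp, hnode, fun j => ?_, fun j h1 h2 h3 => ?_⟩
  · have := edgeMass_le_of_ae (w := v - (E : ℂ) • u) (j := j) (C := D' * ‖ρ j‖) fun s => by
      filter_upwards [hu s j, hv s j, ae_restrict_of_ae (Lp_sub_smul_ae u v E s),
        ae_restrict_mem (measurableSet_edgeSet j)] with t ut vt wt ht
      have e1 : v s t - E * u s t = gaugeFactor (-fieldSign A s) (vertexPt j) t *
          ((nodeTest₂ (t - vertexPt j) + E * nodeTest (t - vertexPt j)) / (2 * bandSin E) *
            ρ j) := by
        rw [ut, vt]; simp only [hF, hF₂]; ring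
      rw [wt, e1, norm_mul, norm_gaugeFactor, one_mul, norm_mul, norm_div, norm_mul,
        Complex.norm_real, Complex.norm_two, Real.norm_eq_abs]
      gcongr
      rw [hD']
      gcongr
      exact hD _ (sub_mem_of_mem_edgeSet ht)
    refine this.trans_eq (by ring)
  · refine le_antisymm ?_ (edgeMass_nonneg _ _)
    have := edgeMass_le_of_ae (w := u) (j := j) (C := 0) fun s => by
      filter_upwards [hu s j] with t ut
      rw [ut]
      simp only [hF, h1, h2, h3]
      simp
    simpa using this

/-! ### Weyl sequences -/

theorem isChainPair_iff {A : ℝ} {α : ℤ → ℝ} {u v : ChainSpace} :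
    IsChainPair A α u v ↔ ∃ y : (chainLaplacian A α).domain, (y : ChainSpace) = u ∧
      chainLaplacian A α y = v := by
  have h := LinearPMap.mem_graph_iff (chainLaplacian A α) (x := (u, v))
  rw [chainLaplacian_graph] at h
  exact h

theorem isChainPair_smul {A : ℝ} {α : ℤ → ℝ} {u v : ChainSpace} (c : ℂ)
    (h : IsChainPair A α u v) : IsChainPair A α (c • u) (c • v) :=
  (chainGraph A α).smul_mem c (show (u, v) ∈ chainGraph A α from h)

theorem isChainPair_sub_smul {A : ℝ} {α : ℤ → ℝ} {u v u' v' : ChainSpace} (c : ℂ)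
    (h : IsChainPair A α u v) (h' : IsChainPair A α u' v') :
    IsChainPair A α (u - c • u') (v - c • v') := by
  have h1 : (u, v) ∈ chainGraph A α := h
  have h2 : (u', v') ∈ chainGraph A α := h'
  have h3 := Submodule.sub_mem _ h1 (Submodule.smul_mem _ c h2)
  rw [Prod.smul_mk, Prod.mk_sub_mk] at h3
  exact h3

theorem ae_eq_zero_of_edgeMass_eq_zero {u : ChainSpace} {j : ℤ} (h : edgeMass u j = 0)
    (s : Fin 2) : (u s : ℝ → ℂ) =ᵐ[volume.restrict (edgeSet j)] 0 := by
  have h0 : ∫ t in edgeSet j, ‖u s t‖ ^ 2 = 0 :=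
    le_antisymm ((integral_le_edgeMass u s j).trans_eq h) (integral_norm_sq_nonneg u s j)
  rw [integral_eq_zero_iff_of_nonneg (fun _ => by positivity) (integrableOn_norm_sq u s _)] at h0
  filter_upwards [h0] with t ht
  simpa using ht

theorem hasSum_inner (w u : ChainSpace) :
    HasSum (fun j => ∑ s, ∫ t in edgeSet j, inner ℂ (w s t) (u s t)) (inner ℂ w u) := by
  have h1 : ∀ s : Fin 2, HasSum (fun j => ∫ t in edgeSet j, inner ℂ (w s t) (u s t))
      (inner ℂ (w s) (u s)) := by
    intro s
    have h := hasSum_integral_iUnion (μ := volume) (f := fun t => inner ℂ (w s t) (u s t))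
      (fun j : ℤ => measurableSet_Ico (a := vertexPt j) (b := vertexPt (j + 1)))
      pairwise_disjoint_Ico_vertexPt (L2.integrable_inner (𝕜 := ℂ) (w s) (u s)).integrableOn
    rw [iUnion_Ico_vertexPt, Measure.restrict_univ, ← L2.inner_def] at h
    have hfun : (fun j => ∫ t in edgeSet j, inner ℂ (w s t) (u s t)) =
        fun j => ∫ t in Ico (vertexPt j) (vertexPt (j + 1)), inner ℂ (w s t) (u s t) := by
      funext j
      rw [show volume.restrict (edgeSet j) = _ from restrict_Ioo_eq_restrict_Ico]
    rwa [hfun]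
  rw [PiLp.inner_apply]
  exact hasSum_sum fun s (_ : s ∈ Finset.univ) => h1 s

theorem norm_sum_integral_inner_le (w u : ChainSpace) (j : ℤ) {ρ : ℝ} (hρ : 0 < ρ) :
    ‖∑ s, ∫ t in edgeSet j, inner ℂ (w s t) (u s t)‖ ≤ ρ * edgeMass w j + ρ⁻¹ * edgeMass u j := by
  have hs : ∀ s : Fin 2, ‖∫ t in edgeSet j, inner ℂ (w s t) (u s t)‖ ≤
      ρ * (∫ t in edgeSet j, ‖w s t‖ ^ 2) + ρ⁻¹ * ∫ t in edgeSet j, ‖u s t‖ ^ 2 := by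
    intro s
    have i1 := (integrableOn_norm_sq w s (edgeSet j)).const_mul ρ
    have i2 := (integrableOn_norm_sq u s (edgeSet j)).const_mul ρ⁻¹
    rw [← integral_const_mul, ← integral_const_mul, ← integral_add i1 i2]
    refine norm_integral_le_of_norm_le (i1.add i2) (Eventually.of_forall fun t => ?_)
    refine (norm_inner_le_norm _ _).trans ?_
    have h1 : ρ * ‖w s t‖ ^ 2 + ρ⁻¹ * ‖u s t‖ ^ 2 - 2 * (‖w s t‖ * ‖u s t‖) =
        (ρ * ‖w s t‖ - ‖u s t‖) ^ 2 / ρ := by field_simp; ring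
    have h2 : 0 ≤ (ρ * ‖w s t‖ - ‖u s t‖) ^ 2 / ρ := by positivity
    have h3 : 0 ≤ ‖w s t‖ * ‖u s t‖ := by positivity
    linarith
  refine (norm_sum_le _ _).trans ((Finset.sum_le_sum fun s _ => hs s).trans_eq ?_)
  rw [edgeMass, edgeMass, Finset.sum_add_distrib, Finset.mul_sum, Finset.mul_sum]

/-- The supports escape to `+∞`, so the inner product only sees a tail of `w`, whose mass tends to
zero. -/
theorem tendsto_inner_of_edgeMass {u : ℕ → ChainSpace} (h1 : ∀ n, ‖u n‖ = 1)
    (h2 : ∀ n : ℕ, ∀ j : ℤ, j < n → edgeMass (u n) j = 0) (w : ChainSpace) :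
    Tendsto (fun n => inner ℂ w (u n)) atTop (𝓝 0) := by
  have hw := hasSum_edgeMass w
  have htail : Tendsto (fun n : ℕ => ∑' j : ℤ, if j < n then 0 else edgeMass w j) atTop (𝓝 0) := by
    have := tendsto_tsum_of_dominated_convergence (𝓕 := atTop)
      (f := fun (n : ℕ) (j : ℤ) => if j < n then 0 else edgeMass w j) (g := fun _ => 0)
      (bound := edgeMass w) hw.summable (fun j => by
        refine tendsto_const_nhds.congr' ?_
        filter_upwards [eventually_gt_atTop j.toNat] with n hn
        rw [if_pos (by omega)])
      (Eventually.of_forall fun n j => by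
        split_ifs
        · simpa using edgeMass_nonneg w j
        · rw [Real.norm_of_nonneg (edgeMass_nonneg w j)])
    simpa using this
  rw [Metric.tendsto_atTop]
  intro ε hε
  obtain ⟨N, hN⟩ := (Metric.tendsto_atTop.1 htail) (ε ^ 2 / 4) (by positivity)
  refine ⟨N, fun n hn => ?_⟩
  have htn := hN n hn
  rw [Real.dist_eq, sub_zero] at htn
  have htn' := (abs_lt.1 htn).2
  rw [dist_zero_right]
  have hsw : Summable fun j : ℤ => if j < n then 0 else edgeMass w j :=
    Summable.of_nonneg_of_le (fun j => by split_ifs; exacts [le_rfl, edgeMass_nonneg w j])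
      (fun j => by split_ifs; exacts [edgeMass_nonneg w j, le_rfl]) hw.summable
  -- With this weight in Young's inequality the tail of `w`, of mass below `ε ^ 2 / 4`, and the unit
  -- mass of `u n` contribute at most `ε / 2` each.
  have hρ : 0 < 2 / ε := by positivity
  have hb := (hsw.hasSum.mul_left (2 / ε)).add ((hasSum_edgeMass (u n)).mul_left (2 / ε)⁻¹)
  have hle := (hasSum_inner w (u n)).norm_le_of_bounded hb fun j => by
    by_cases hj : j < n
    · rw [if_pos hj, h2 n j hj, mul_zero, mul_zero, add_zero]
      have : ∑ s, ∫ t in edgeSet j, inner ℂ (w s t) (u n s t) = 0 := by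
        refine Finset.sum_eq_zero fun s _ => ?_
        rw [integral_congr_ae (g := fun _ => (0 : ℂ)), integral_zero]
        filter_upwards [ae_eq_zero_of_edgeMass_eq_zero (h2 n j hj) s] with t ht
        rw [ht]; simp
      rw [this, norm_zero]
    · rw [if_neg hj]
      exact norm_sum_integral_inner_le w (u n) j hρ
  rw [h1] at hle
  refine hle.trans_lt ?_
  have : 2 / ε * (ε ^ 2 / 4) = ε / 2 := by field_simp; norm_num
  have h3 := mul_lt_mul_of_pos_left htn' hρ
  rw [this] at h3
  have : (2 / ε)⁻¹ * 1 ^ 2 = ε / 2 := by rw [inv_div]; ring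
  linarith

theorem mem_essSpectrum_of_approx {A : ℝ} {α : ℤ → ℝ} {E : ℝ}
    (h : ∀ n : ℕ, ∃ u v, IsChainPair A α u v ∧ u ≠ 0 ∧
      ‖v - (E : ℂ) • u‖ ≤ 1 / ((n : ℝ) + 1) * ‖u‖ ∧ ∀ j : ℤ, j < n → edgeMass u j = 0) :
    E ∈ essSpectrum (chainLaplacian A α) := by
  choose u v hp hu hle hz using h
  have hp' := fun n => isChainPair_iff.1 (isChainPair_smul ((‖u n‖⁻¹ : ℝ) : ℂ) (hp n))
  choose y hy hTy using hp'
  have hn : ∀ n, 0 < ‖u n‖ := fun n => norm_pos_iff.2 (hu n)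
  have hnorm : ∀ n, ‖(y n : ChainSpace)‖ = 1 := fun n => by
    rw [hy, norm_smul, Complex.norm_real, Real.norm_of_nonneg (inv_nonneg.2 (hn n).le),
      inv_mul_cancel₀ (hn n).ne']
  refine ⟨y, hnorm, ?_, ?_⟩
  · refine tendsto_inner_of_edgeMass hnorm fun n j hj => ?_
    refine le_antisymm ?_ (edgeMass_nonneg _ _)
    have := edgeMass_le_of_ae (w := (y n : ChainSpace)) (j := j) (C := 0) fun s => by
      rw [hy]
      filter_upwards [ae_eq_zero_of_edgeMass_eq_zero (hz n j hj) s,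
        ae_restrict_of_ae (Lp.coeFn_smul ((‖u n‖⁻¹ : ℝ) : ℂ) (u n s))] with t h1 h2
      change ‖((((‖u n‖⁻¹ : ℝ) : ℂ) • u n s : Lp ℂ 2 (volume : Measure ℝ)) : ℝ → ℂ) t‖ ≤ 0
      rw [h2, Pi.smul_apply, h1]; simp
    simpa using this
  · refine squeeze_zero_norm (fun n => ?_) tendsto_one_div_add_atTop_nhds_zero_nat
    rw [hTy, hy, smul_comm, ← smul_sub, norm_smul, Complex.norm_real,
      Real.norm_of_nonneg (inv_nonneg.2 (hn n).le), inv_mul_le_iff₀ (hn n), mul_comm]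
    exact hle n

/-! ### The essential spectrum -/

/-- The function `ξ` as a real function of the energy. -/
noncomputable def bandXi (A α E : ℝ) : ℝ :=
  (bandCos E + α / 4 * bandSin E) / Real.cos (A * Real.pi)

theorem chainXi_momentum (A α E : ℝ) : chainXi A α (momentum E) = bandXi A α E := by
  rw [bandXi, chainXi]
  push_cast
  rw [← edgeCos_pi, ← edgeSin_pi]
  rfl

/-- Splitting off a reference coupling `α` leaves a recursion with constant coefficients and a term
that lives on the perturbed vertices only. -/
theorem nodeResidual_eq {A : ℝ} (hc : Real.cos (A * Real.pi) ≠ 0) (α : ℝ) (β : ℤ → ℝ) (E : ℝ)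
    (x : ℤ → ℂ) (j : ℤ) :
    nodeResidual A β E x j = 2 * Real.cos (A * Real.pi) *
      (x (j + 1) + x (j - 1) - 2 * (bandXi A α E : ℂ) * x j) - (β j - α) * bandSin E * x j := by
  have hc' : (Real.cos (A * Real.pi) : ℂ) ≠ 0 := by exact_mod_cast hc
  rw [nodeResidual, bandXi]
  push_cast
  push_cast at hc'
  field_simp
  ring

/-- Along a singular Weyl sequence each single nodal value tends to zero by weak continuity, hence
so does the perturbation, which sits on the finite set `F`. The lower bound for the constant
recursion then makes the whole `ℓ²` norm of the nodal values tend to zero, and with it the norm of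
`u`, which contradicts normalization. -/
theorem not_mem_essSpectrum {A α E : ℝ} {β : ℤ → ℝ} (F : Finset ℤ) (hβ : ∀ j ∉ F, β j = α)
    (hc : Real.cos (A * Real.pi) ≠ 0) (hS : bandSin E ≠ 0) (hξ : 1 < |bandXi A α E|) :
    E ∉ essSpectrum (chainLaplacian A β) := by
  rintro ⟨y, hy1, hyw, hyE⟩
  have hp : ∀ n, IsChainPair A β (y n) (chainLaplacian A β (y n)) := fun n =>
    isChainPair_iff.2 ⟨y n, rfl, rfl⟩
  set u : ℕ → ChainSpace := fun n => y n with hu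
  set v : ℕ → ChainSpace := fun n => chainLaplacian A β (y n) with hv
  obtain ⟨K, hK, hKu⟩ := exists_norm_sq_le (A := A) hS
  obtain ⟨K', hK', hKr⟩ := exists_tsum_nodeResidual_le A E
  have hvw : ∀ w, Tendsto (fun n => inner ℂ w (v n)) atTop (𝓝 0) := by
    intro w
    have h1 : Tendsto (fun n => inner ℂ w (v n - (E : ℂ) • u n)) atTop (𝓝 (inner ℂ w 0)) :=
      tendsto_const_nhds.inner hyE
    have h2 := h1.add ((hyw w).const_mul (E : ℂ))
    simp only [inner_zero_right, mul_zero, add_zero] at h2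
    refine h2.congr fun n => ?_
    rw [inner_sub_right, inner_smul_right]; ring
  have hx0 : ∀ j, Tendsto (fun n => nodeVal A (u n) (v n) j) atTop (𝓝 0) := fun j =>
    tendsto_nodeVal A j hyw hvw
  set c := Real.cos (A * Real.pi)
  set ξ := bandXi A α E
  set S := bandSin E
  have hδ : 0 < 4 * (|ξ| - 1) ^ 2 := by have : 0 < |ξ| - 1 := by linarith
                                        positivity
  have hc' : (c : ℂ) ≠ 0 := by exact_mod_cast hc
  have hmain : ∀ n, 4 * (|ξ| - 1) ^ 2 * ∑' j, ‖nodeVal A (u n) (v n) j‖ ^ 2 ≤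
      2 * ∑ j ∈ F, ‖((β j - α) * S / (2 * c) : ℂ) * nodeVal A (u n) (v n) j‖ ^ 2 +
      2 * (‖(1 / (2 * c) : ℂ)‖ ^ 2 * (K' * ‖v n - (E : ℂ) • u n‖ ^ 2)) := by
    intro n
    set x := nodeVal A (u n) (v n) with hx
    set ρ := nodeResidual A β E x
    set r : ℤ → ℂ := fun j => -((β j - α) * S / (2 * c) * x j + 1 / (2 * c) * ρ j) with hr
    obtain ⟨hρs, hρK⟩ := hKr β (u n) (v n) (hp n)
    have hF : HasSum (fun j => ‖((β j - α) * S / (2 * c) : ℂ) * x j‖ ^ 2)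
        (∑ j ∈ F, ‖((β j - α) * S / (2 * c) : ℂ) * x j‖ ^ 2) :=
      hasSum_sum_of_ne_finset_zero fun j hj => by rw [hβ j hj]; simp
    have hb : HasSum (fun j => 2 * ‖((β j - α) * S / (2 * c) : ℂ) * x j‖ ^ 2 +
        2 * (‖(1 / (2 * c) : ℂ)‖ ^ 2 * ‖ρ j‖ ^ 2))
        (2 * ∑ j ∈ F, ‖((β j - α) * S / (2 * c) : ℂ) * x j‖ ^ 2 +
          2 * (‖(1 / (2 * c) : ℂ)‖ ^ 2 * ∑' j, ‖ρ j‖ ^ 2)) :=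
      (hF.mul_left 2).add ((hρs.hasSum.mul_left _).mul_left 2)
    have hle : ∀ j, ‖r j‖ ^ 2 ≤ 2 * ‖((β j - α) * S / (2 * c) : ℂ) * x j‖ ^ 2 +
        2 * (‖(1 / (2 * c) : ℂ)‖ ^ 2 * ‖ρ j‖ ^ 2) := by
      intro j
      rw [← mul_pow, ← norm_mul, hr]
      simp only [norm_neg]
      have h1 := norm_add_le (((β j - α) * S / (2 * c) : ℂ) * x j) (1 / (2 * c) * ρ j)
      have h2 : ‖((β j - α) * S / (2 * c) : ℂ) * x j + 1 / (2 * c) * ρ j‖ ^ 2 ≤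
        (‖((β j - α) * S / (2 * c) : ℂ) * x j‖ + ‖1 / (2 * c) * ρ j‖) ^ 2 := by gcongr
      have h3 := add_sq_le (a := ‖((β j - α) * S / (2 * c) : ℂ) * x j‖)
        (b := ‖1 / (2 * c) * ρ j‖)
      linarith
    have hrs : Summable fun j => ‖r j‖ ^ 2 :=
      Summable.of_nonneg_of_le (fun j => by positivity) hle hb.summable
    have h1 := sq_sub_one_mul_tsum_le hξ (summable_norm_nodeVal_sq A (u n) (v n)) hrs fun j => by
      have h2 : ρ j = _ := nodeResidual_eq hc α β E x j
      simp only [hr]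
      rw [h2]
      field_simp
      ring
    refine h1.trans ((hasSum_le hle hrs.hasSum hb).trans ?_)
    gcongr
  have hlim : Tendsto (fun n => 2 * ∑ j ∈ F, ‖((β j - α) * S / (2 * c) : ℂ) *
      nodeVal A (u n) (v n) j‖ ^ 2 +
      2 * (‖(1 / (2 * c) : ℂ)‖ ^ 2 * (K' * ‖v n - (E : ℂ) • u n‖ ^ 2))) atTop (𝓝 0) := by
    have h1 : Tendsto (fun n => ∑ j ∈ F, ‖((β j - α) * S / (2 * c) : ℂ) *
        nodeVal A (u n) (v n) j‖ ^ 2) atTop (𝓝 (∑ j ∈ F, 0)) :=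
      tendsto_finsetSum _ fun j _ => by
        simpa using ((hx0 j).const_mul ((β j - α) * S / (2 * c) : ℂ)).norm.pow 2
    have h2 : Tendsto (fun n => ‖v n - (E : ℂ) • u n‖ ^ 2) atTop (𝓝 0) := by
      simpa using hyE.norm.pow 2
    simpa using (h1.const_mul 2).add (((h2.const_mul K').const_mul _).const_mul 2)
  have hX : Tendsto (fun n => ∑' j, ‖nodeVal A (u n) (v n) j‖ ^ 2) atTop (𝓝 0) := by
    have h1 := hlim.const_mul (4 * (|ξ| - 1) ^ 2)⁻¹
    rw [mul_zero] at h1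
    refine squeeze_zero (fun n => tsum_nonneg fun j => by positivity) (fun n => ?_) h1
    rw [le_inv_mul_iff₀ hδ]
    exact hmain n
  have hg : Tendsto (fun n => ‖v n - (E : ℂ) • u n‖ ^ 2) atTop (𝓝 0) := by
    simpa using hyE.norm.pow 2
  have hfin := (hX.add hg).const_mul K
  rw [add_zero, mul_zero] at hfin
  have h1 : ∀ n, (1 : ℝ) ≤ K * (∑' j, ‖nodeVal A (u n) (v n) j‖ ^ 2 +
      ‖v n - (E : ℂ) • u n‖ ^ 2) := fun n => by
    have := hKu β (u n) (v n) (hp n)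
    rwa [show ‖u n‖ = 1 from hy1 n, one_pow] at this
  exact absurd (ge_of_tendsto' hfin h1) (by norm_num)

theorem eq_smul_of_edgeMass {u v : ChainSpace} {E : ℂ} (h : ∀ j, edgeMass (v - E • u) j = 0) :
    v = E • u := by
  have h1 := hasSum_edgeMass (v - E • u)
  rw [show edgeMass (v - E • u) = fun _ => 0 from funext h] at h1
  have h2 := h1.unique hasSum_zero
  rw [sq_eq_zero_iff, norm_eq_zero, sub_eq_zero] at h2
  exact h2

/-- At such energies the sine solution vanishes at both ends of an edge, so the couplings are not
felt. Multiples of it on the four edges of two adjacent rings can be balanced at the three vertices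
involved, which gives compactly supported eigenfunctions as far out as desired. -/
theorem mem_essSpectrum_of_bandSin_eq_zero (A : ℝ) (β : ℤ → ℝ) {E : ℝ} (hS : bandSin E = 0) :
    E ∈ essSpectrum (chainLaplacian A β) := by
  refine mem_essSpectrum_of_approx fun n => ?_
  have hcs := continuous_edgeSin E
  set C : ℂ := ((bandCos E : ℝ) : ℂ) with hC
  have hCC : C * C = 1 := by
    have := bandCos_sq_add E
    rw [hS] at this
    rw [hC, ← Complex.ofReal_mul, ← sq]
    norm_num at this ⊢
    exact_mod_cast this
  set sg : Fin 2 → ℂ := ![1, -1] with hsg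
  set e : Fin 2 → ℂ := fun s => Complex.exp (Complex.I * fieldSign A s * Real.pi) with he
  -- The opposite signs on the two lines balance the derivatives at the outer vertices `n` and `n +
  -- 2`. At the middle vertex they balance because the phases of the two lines are inverse to each
  -- other.
  set κ : Fin 2 → ℤ → ℂ := fun s j =>
    if j = n then sg s else if j = n + 1 then -C * (sg s * e s) else 0 with hκ
  obtain ⟨B, hB0, hB⟩ := exists_norm_le_on_edge hcs
  set D : ℤ → ℝ := fun j => (1 + |E|) * B * (‖κ 0 j‖ + ‖κ 1 j‖) with hD
  have hDs : Summable fun j => D j ^ 2 := by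
    refine summable_of_ne_finset_zero (s := {(n : ℤ), (n : ℤ) + 1}) fun j hj => ?_
    simp only [Finset.mem_insert, Finset.mem_singleton, not_or] at hj
    simp [hD, hκ, hj.1, hj.2]
  have hκD : ∀ s j, ‖κ s j‖ ≤ ‖κ 0 j‖ + ‖κ 1 j‖ := by
    intro s j
    fin_cases s
    · exact le_add_of_nonneg_right (norm_nonneg _)
    · exact le_add_of_nonneg_left (norm_nonneg _)
  obtain ⟨u, v, hp, -, hu, hv⟩ := exists_chainPair_of_edges (A := A) (α := β)
    (F := fun s j t => κ s j * edgeSin E t) (F₁ := fun s j t => κ s j * edgeCos E t)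
    (F₂ := fun s j t => κ s j * (-(E : ℂ) * edgeSin E t)) (x := 0) (B := D)
    (fun s j t => (hasDerivAt_edgeSin E t).const_mul _)
    (fun s j t => (hasDerivAt_edgeCos E t).const_mul _) (fun s j => by fun_prop)
    (fun s j => by simp) (fun s j => by simp [edgeSin_pi, hS])
    (fun j => by
      rw [Fin.sum_univ_two]
      simp only [edgeCos_zero, edgeCos_pi, mul_one, Pi.zero_apply, mul_zero, ← hC]
      have h0 := sum_fieldSign_exp A
      have h1 := sum_fieldSign_exp_neg A
      have hee : ∀ s, Complex.exp (-(Complex.I * fieldSign A s * Real.pi)) * e s = 1 := fun s => by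
        rw [he, ← Complex.exp_add]; simp
      have hee0 := hee 0
      have hee1 := hee 1
      have hl0 : e 0 = Complex.exp (-(Complex.I * fieldSign A 1 * Real.pi)) := by
        simp [he, fieldSign]
      have hl1 : e 1 = Complex.exp (-(Complex.I * fieldSign A 0 * Real.pi)) := by
        simp [he, fieldSign]
      rw [← hl0, ← hl1] at *
      have hs0 : sg 0 = 1 := rfl
      have hs1 : sg 1 = -1 := rfl
      simp only [hκ, hs0, hs1]
      rcases eq_or_ne j n with h | h
      · subst h
        rw [if_pos rfl, if_pos rfl, if_neg (by omega), if_neg (by omega), if_neg (by omega),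
          if_neg (by omega)]
        ring
      rcases eq_or_ne j (n + 1) with h' | h'
      · subst h'
        rw [if_neg (by omega), if_pos rfl, if_pos (by omega), if_neg (by omega), if_pos rfl,
          if_pos (by omega)]
        ring
      rcases eq_or_ne j (n + 2) with h'' | h''
      · subst h''
        rw [if_neg (by omega), if_neg (by omega), if_neg (by omega), if_pos (by omega),
          if_neg (by omega), if_neg (by omega), if_neg (by omega), if_pos (by omega)]
        ring
      · rw [if_neg (by omega), if_neg (by omega), if_neg (by omega), if_neg (by omega),
          if_neg (by omega), if_neg (by omega), if_neg (by omega), if_neg (by omega)]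
        ring)
    hDs (fun s j t ht => by
      rw [norm_mul, hD, mul_comm]
      have := hκD s j
      have := hB t ht
      have : B ≤ (1 + |E|) * B := by nlinarith [abs_nonneg E]
      simp only
      gcongr
      linarith)
    (fun s j t ht => by
      rw [norm_mul, norm_mul, norm_neg, Complex.norm_real, Real.norm_eq_abs, hD, mul_comm]
      have := hκD s j
      have := mul_le_mul_of_nonneg_left (hB t ht) (abs_nonneg E)
      exact mul_le_mul (by linarith) (hκD s j) (norm_nonneg _) (by positivity))
  have hvu : v = (E : ℂ) • u := by
    refine eq_smul_of_edgeMass fun j => le_antisymm ?_ (edgeMass_nonneg _ _)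
    have := edgeMass_le_of_ae (w := v - (E : ℂ) • u) (j := j) (C := 0) fun s => by
      filter_upwards [hu s j, hv s j, ae_restrict_of_ae (Lp_sub_smul_ae u v E s)] with t ut vt wt
      rw [wt, ut, vt]
      refine (norm_eq_zero.2 ?_).le
      ring
    simpa using this
  refine ⟨u, v, hp, ?_, ?_, fun j hj => ?_⟩
  · rintro rfl
    have hdat : IsH2On (vertexPt n) (vertexPt ((n : ℤ) + 1)) (fun t => edgeSin E (t - vertexPt n))
        (fun t => edgeCos E (t - vertexPt n))
        (fun t => -(E : ℂ) * edgeSin E (t - vertexPt n)) :=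
      isH2On_of_hasDerivAt
        (fun t => by simpa using (hasDerivAt_edgeSin E (t - vertexPt n)).comp_sub_const t _)
        (fun t => by simpa using (hasDerivAt_edgeCos E (t - vertexPt n)).comp_sub_const t _)
        (by fun_prop)
    have hz := hdat.all_zero (vertexPt_lt_succ n) (by
      change _ =ᵐ[volume.restrict (edgeSet n)] _
      filter_upwards [hu 0 n, ae_restrict_of_ae (Lp.coeFn_zero ℂ 2 volume)] with t h1 h2
      have h3 : ((0 : ChainSpace) 0 : ℝ → ℂ) t = 0 := h2
      rw [h3] at h1
      have h4 : κ 0 n = 1 := by simp [hκ, hsg]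
      rw [h4, one_mul] at h1
      exact (mul_eq_zero.1 h1.symm).resolve_left (gaugeFactor_ne_zero _ _ _))
    have := hz.2.1 (vertexPt n) (left_mem_Icc.2 (vertexPt_lt_succ n).le)
    simp at this
  · rw [hvu, sub_self, norm_zero]; positivity
  · refine le_antisymm ?_ (edgeMass_nonneg _ _)
    have := edgeMass_le_of_ae (w := u) (j := j) (C := 0) fun s => by
      filter_upwards [hu s j] with t ut
      rw [ut]
      have : κ s j = 0 := by
        simp only [hκ]; rw [if_neg (by omega), if_neg (by omega)]
      simp [this]
    simpa using this

/-- The plane wave `ω ^ j` with `ω + ω⁻¹ = 2 ξ` solves the constant recursion. Cut off to a long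
stretch beyond `F`, it has a residual at four nodes only, bounded independently of the length,
whereas the sum of its squares grows with the length. The lifted elements thus have bounded `(T - E)
u` and arbitrarily large norm. -/
theorem mem_essSpectrum_of_abs_le_one {A α E : ℝ} {β : ℤ → ℝ} (F : Finset ℤ)
    (hβ : ∀ j ∉ F, β j = α) (hc : Real.cos (A * Real.pi) ≠ 0) (hS : bandSin E ≠ 0)
    (hξ : |bandXi A α E| ≤ 1) : E ∈ essSpectrum (chainLaplacian A β) := by
  refine mem_essSpectrum_of_approx fun n => ?_
  obtain ⟨K, hK, hbuild⟩ := exists_chainPair_of_nodes A hS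
  obtain ⟨K', hK', hlow⟩ := exists_tsum_nodeVal_le A
  set c := Real.cos (A * Real.pi) with hcdef
  set ξ := bandXi A α E with hξdef
  obtain ⟨m₀, hm₀⟩ := F.bddAbove
  -- The margin 2 places `M - 1`, the first node with a residual, beyond both `F` and `n`.
  set M : ℤ := max (n : ℤ) m₀ + 2 with hM
  have hMF : ∀ j, M - 1 ≤ j → β j = α := fun j hj => hβ j fun h => by
    have := hm₀ h
    have := le_max_right (n : ℤ) m₀
    omega
  have hMn : (n : ℤ) + 2 ≤ M := by have := le_max_left (n : ℤ) m₀; omega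
  set ω : ℂ := Complex.exp (Real.arccos ξ * Complex.I) with hω
  have hωn : ‖ω‖ = 1 := Complex.norm_exp_ofReal_mul_I _
  have hω0 : ω ≠ 0 := Complex.exp_ne_zero _
  have hωξ : ω + ω⁻¹ = 2 * (ξ : ℂ) := by
    rw [hω, ← Complex.exp_neg, ← neg_mul, ← Complex.two_cos, ← Complex.ofReal_cos,
      Real.cos_arccos (abs_le.1 hξ).1 (abs_le.1 hξ).2]
  have hωj : ∀ j : ℤ, ω ^ (j + 1) + ω ^ (j - 1) = 2 * (ξ : ℂ) * ω ^ j := fun j => by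
    rw [zpow_add_one₀ hω0, zpow_sub_one₀ hω0, ← hωξ]; ring
  set R : ℝ := 2 * |c| * (2 + 2 * |ξ|) with hR
  have hR0 : 0 ≤ R := by positivity
  set Q : ℝ := 4 * R ^ 2 * K with hQ
  have hQ0 : 0 ≤ Q := by positivity
  -- the length of the plateau
  obtain ⟨L, hL⟩ := exists_nat_gt (K' * (((n : ℝ) + 1) ^ 2 * Q * (1 + 2 * E ^ 2) + 2 * Q) + 1)
  have hL1 : (1 : ℝ) < L := by
    refine lt_of_le_of_lt ?_ hL
    have : 0 ≤ K' * (((n : ℝ) + 1) ^ 2 * Q * (1 + 2 * E ^ 2) + 2 * Q) := by positivity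
    linarith
  have hL1' : 1 < L := by exact_mod_cast hL1
  set x : ℤ → ℂ := fun j => if M ≤ j ∧ j ≤ M + L then ω ^ j else 0 with hx
  have hxn : ∀ j, ‖x j‖ ≤ 1 := fun j => by
    simp only [hx]; split_ifs
    · rw [norm_zpow, hωn, one_zpow]
    · simp
  have hxsum : HasSum (fun j => ‖x j‖ ^ 2) ((L : ℝ) + 1) := by
    have h1 : HasSum (fun j => ‖x j‖ ^ 2) (∑ j ∈ Finset.Icc M (M + L), ‖x j‖ ^ 2) :=
      hasSum_sum_of_ne_finset_zero fun j hj => by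
        rw [Finset.mem_Icc] at hj
        simp only [hx, if_neg hj]; simp
    have h2 : ∑ j ∈ Finset.Icc M (M + L), ‖x j‖ ^ 2 = (L : ℝ) + 1 := by
      rw [Finset.sum_congr rfl (g := fun _ => (1 : ℝ)) fun j hj => by
        rw [Finset.mem_Icc] at hj
        simp only [hx, if_pos hj]
        rw [norm_zpow, hωn, one_zpow, one_pow]]
      rw [Finset.sum_const, Int.card_Icc, nsmul_eq_mul, mul_one]
      rw [show (M + L + 1 - M).toNat = L + 1 by omega]; push_cast; rfl
    rwa [h2] at h1
  set ρ := nodeResidual A β E x with hρ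
  set P : Finset ℤ := {M - 1, M, M + L, M + L + 1} with hP
  have hρ0 : ∀ j ∉ P, ρ j = 0 := fun j hj => by
    simp only [hP, Finset.mem_insert, Finset.mem_singleton, not_or] at hj
    obtain ⟨a1, a2, a3, a4⟩ := hj
    rw [hρ, nodeResidual_eq hc α]
    simp only [hx]
    by_cases hin : M ≤ j ∧ j ≤ M + L
    · rw [if_pos hin, if_pos (by omega), if_pos (by omega), hωj, hMF j (by omega)]; ring
    · rw [if_neg hin, if_neg (by omega), if_neg (by omega)]; ring
  have hρR : ∀ j ∈ P, ‖ρ j‖ ^ 2 ≤ R ^ 2 := fun j hj => by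
    simp only [hP, Finset.mem_insert, Finset.mem_singleton] at hj
    have hj' : β j = α := hMF j (by omega)
    rw [hρ, nodeResidual_eq hc α, hj', sub_self, zero_mul, zero_mul, sub_zero, norm_mul, norm_mul,
      Complex.norm_real, Complex.norm_two, Real.norm_eq_abs, hR]
    gcongr
    refine (norm_sub_le _ _).trans ?_
    rw [norm_mul, norm_mul, Complex.norm_real, Complex.norm_two, Real.norm_eq_abs]
    have h1 := (norm_add_le (x (j + 1)) (x (j - 1))).trans (add_le_add (hxn _) (hxn _))
    have h2 := mul_le_mul_of_nonneg_left (hxn j) (show 0 ≤ 2 * |ξ| by positivity)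
    linarith
  have hρsum : HasSum (fun j => ‖ρ j‖ ^ 2) (∑ j ∈ P, ‖ρ j‖ ^ 2) :=
    hasSum_sum_of_ne_finset_zero fun j hj => by rw [hρ0 j hj]; simp
  have hρle : ∑ j ∈ P, ‖ρ j‖ ^ 2 ≤ 4 * R ^ 2 := by
    refine (Finset.sum_le_sum hρR).trans ?_
    rw [Finset.sum_const, nsmul_eq_mul]
    have : (P.card : ℝ) ≤ 4 := by exact_mod_cast Finset.card_le_four
    gcongr
  obtain ⟨u, v, hp, hnode, hg, hu0⟩ := hbuild β x hxsum.summable hρsum.summable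
  have hgle : ‖v - (E : ℂ) • u‖ ^ 2 ≤ Q := by
    have := hasSum_le hg (hasSum_edgeMass (v - (E : ℂ) • u)) (hρsum.mul_left K)
    refine this.trans ?_
    rw [hQ, mul_comm]
    gcongr
  have hl := hlow u v
  rw [hnode, hxsum.tsum_eq] at hl
  have hv : ‖v‖ ^ 2 ≤ 2 * Q + 2 * E ^ 2 * ‖u‖ ^ 2 := by
    have h1 : ‖v‖ ≤ ‖v - (E : ℂ) • u‖ + ‖(E : ℂ) • u‖ := by
      simpa using norm_add_le (v - (E : ℂ) • u) ((E : ℂ) • u)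
    rw [norm_smul, Complex.norm_real, Real.norm_eq_abs] at h1
    have h2 : ‖v‖ ^ 2 ≤ (‖v - (E : ℂ) • u‖ + |E| * ‖u‖) ^ 2 := by gcongr
    have h3 := add_sq_le (a := ‖v - (E : ℂ) • u‖) (b := |E| * ‖u‖)
    rw [mul_pow, sq_abs] at h3
    linarith
  have hE2 : 0 < 1 + 2 * E ^ 2 := by positivity
  -- If `u` were smaller, then `v` would be bounded as well, and `L + 1` nodal values of modulus one
  -- would contradict the choice of `L`.
  have hukey : ((n : ℝ) + 1) ^ 2 * Q ≤ ‖u‖ ^ 2 := by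
    by_contra hcon
    push Not at hcon
    have h1 : K' * (‖u‖ ^ 2 + ‖v‖ ^ 2) ≤
        K' * (((n : ℝ) + 1) ^ 2 * Q * (1 + 2 * E ^ 2) + 2 * Q) := by
      refine mul_le_mul_of_nonneg_left ?_ hK'.le
      nlinarith
    linarith
  refine ⟨u, v, hp, ?_, ?_, fun j hj => hu0 j ?_ ?_ (hρ0 j ?_)⟩
  · rintro rfl
    rw [norm_zero, zero_pow two_ne_zero] at hukey hv
    have hQz : Q ≤ 0 := by
      have : 0 < ((n : ℝ) + 1) ^ 2 := by positivity
      nlinarith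
    have : K' * (‖(0 : ChainSpace)‖ ^ 2 + ‖v‖ ^ 2) ≤ 0 := by
      rw [norm_zero, zero_pow two_ne_zero, zero_add]
      nlinarith
    linarith
  · have h1 : ‖v - (E : ℂ) • u‖ ^ 2 ≤ (1 / ((n : ℝ) + 1) * ‖u‖) ^ 2 := by
      rw [mul_pow, div_pow, one_pow, one_div, le_inv_mul_iff₀ (by positivity)]
      exact (mul_le_mul_of_nonneg_left hgle (by positivity)).trans hukey
    exact le_of_sq_le_sq h1 (by positivity)
  · simp only [hx]; rw [if_neg (by omega)]
  · simp only [hx]; rw [if_neg (by omega)]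
  · simp only [hP, Finset.mem_insert, Finset.mem_singleton]; omega

/-! ### Eigenvalues and the discrete problem -/

theorem mem_opEigenspace_iff {A : ℝ} {β : ℤ → ℝ} {z : ℂ} {w : ChainSpace} :
    w ∈ opEigenspace (chainLaplacian A β) z ↔ IsChainPair A β w (z • w) := by
  rw [isChainPair_iff, opEigenspace, Submodule.mem_map]
  constructor
  · rintro ⟨y, hy, rfl⟩
    refine ⟨y, rfl, ?_⟩
    rw [LinearMap.mem_ker, LinearMap.sub_apply, sub_eq_zero] at hy
    exact hy
  · rintro ⟨y, rfl, hy⟩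
    refine ⟨y, ?_, rfl⟩
    rw [LinearMap.mem_ker, LinearMap.sub_apply, sub_eq_zero]
    exact hy

theorem isOpEigenvalue_iff {A : ℝ} {β : ℤ → ℝ} {E : ℝ} :
    IsOpEigenvalue (chainLaplacian A β) E ↔
      ∃ u : ChainSpace, u ≠ 0 ∧ IsChainPair A β u ((E : ℂ) • u) := by
  rw [IsOpEigenvalue, Submodule.ne_bot_iff]
  simp only [mem_opEigenspace_iff]
  exact ⟨fun ⟨u, h1, h2⟩ => ⟨u, h2, h1⟩, fun ⟨u, h1, h2⟩ => ⟨u, h2, h1⟩⟩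

/-- A solution of a hyperbolic three-term recursion which tends to zero is geometric. -/
theorem eq_mul_of_tendsto_zero {lam : ℝ} (h0 : lam ≠ 0) (h1 : |lam| < 1) {z : ℕ → ℂ}
    (hz : Tendsto z atTop (𝓝 0))
    (hrec : ∀ k, z (k + 2) + z k = ((lam : ℂ) + (lam : ℂ)⁻¹) * z (k + 1)) (k : ℕ) :
    z (k + 1) = lam * z k := by
  have h0' : (lam : ℂ) ≠ 0 := by exact_mod_cast h0
  -- The component along the growing solution: it is multiplied by `1 / lam` in each step, so it can
  -- tend to zero only if it vanishes.
  set y : ℕ → ℂ := fun k => z (k + 1) - lam * z k with hy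
  have hys : ∀ k, y k = lam * y (k + 1) := fun k => by
    simp only [hy]
    have := hrec k
    field_simp at this
    linear_combination -this
  have hyn : ∀ n k, ‖y k‖ = |lam| ^ n * ‖y (k + n)‖ := fun n => by
    induction n with
    | zero => intro k; simp
    | succ n ih =>
      intro k
      rw [ih k, hys (k + n), norm_mul, Complex.norm_real, Real.norm_eq_abs]
      rw [pow_succ, add_assoc]; ring
  have hy0 : Tendsto y atTop (𝓝 0) := by
    simpa using ((tendsto_add_atTop_iff_nat 1).2 hz).sub (hz.const_mul (lam : ℂ))
  have hlim : Tendsto (fun n => |lam| ^ n * ‖y (k + n)‖) atTop (𝓝 (0 * 0)) := by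
    refine (tendsto_pow_atTop_nhds_zero_of_lt_one (abs_nonneg _) h1).mul ?_
    have := ((tendsto_add_atTop_iff_nat k).2 hy0).norm
    simp only [norm_zero] at this
    exact this.congr fun n => by rw [add_comm]
  have hc : Tendsto (fun _ : ℕ => ‖y k‖) atTop (𝓝 (0 * 0)) := hlim.congr fun n => (hyn n k).symm
  have := tendsto_nhds_unique hc tendsto_const_nhds
  rw [zero_mul, eq_comm, norm_eq_zero] at this
  exact sub_eq_zero.1 this

/-- The transfer recursion of the discrete problem: the first component is the renormalized
solution that decays at `-∞`, the second one measures the failure of its decay at `+∞`. -/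
noncomputable def transfer (g : ℕ → ℝ) (a t : ℝ) : ℕ → ℝ × ℝ
  | 0 => (1, 1 - a)
  | n + 1 =>
    (a * (transfer g a t n).1 + ((transfer g a t n).2 + t * g (n + 1) * (transfer g a t n).1),
      (transfer g a t n).2 + t * g (n + 1) * (transfer g a t n).1)

theorem transfer_congr {g g' : ℕ → ℝ} {a t : ℝ} {m : ℕ} (h : ∀ n, n ≤ m → g n = g' n) :
    ∀ n, n ≤ m → transfer g a t n = transfer g' a t n := by
  intro n
  induction n with
  | zero => intro _; rfl
  | succ n ih => intro hn; rw [transfer, transfer, ih (by omega), h (n + 1) hn]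

theorem transfer_neg (g : ℕ → ℝ) (a t : ℝ) (n : ℕ) :
    transfer (fun n => -g n) a t n = transfer g a (-t) n := by
  induction n with
  | zero => rfl
  | succ n ih => rw [transfer, transfer, ih]; simp only [mul_neg, neg_mul]

/-- Multiplication by `lam ^ n` removes all inverse powers, so the renormalized solution depends
polynomially on `lam ^ 2` and `b * lam`. This keeps the secular function smooth up to the band edge
`|lam| = 1` and makes the sign of `lam` harmless. -/
theorem solution_eq_transfer {lam b : ℝ} (h0 : lam ≠ 0) {g : ℕ → ℝ} {x : ℤ → ℂ} {m : ℕ}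
    (hl : x 0 = lam * x 1)
    (hrec : ∀ n : ℕ, n + 1 ≤ m → x (n + 2) + x n =
      ((lam : ℂ) + (lam : ℂ)⁻¹ + b * g (n + 1)) * x (n + 1)) :
    ∀ n : ℕ, n ≤ m → (lam : ℂ) ^ n * x (n + 1) = (transfer g (lam ^ 2) (b * lam) n).1 * x 1 ∧
      (lam : ℂ) ^ n * (x (n + 1) - lam * x n) = (transfer g (lam ^ 2) (b * lam) n).2 * x 1 := by
  have h0' : (lam : ℂ) ≠ 0 := by exact_mod_cast h0
  intro n
  induction n with
  | zero =>
    intro _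
    simp only [transfer, Nat.cast_zero, zero_add, pow_zero, one_mul, hl]
    push_cast
    exact ⟨by ring, by ring⟩
  | succ n ih =>
    intro hn
    obtain ⟨ih1, ih2⟩ := ih (by omega)
    have hr := hrec n hn
    have hc : ((n + 1 : ℕ) : ℤ) + 1 = (n : ℤ) + 2 := by push_cast; ring
    have hc' : ((n + 1 : ℕ) : ℤ) = (n : ℤ) + 1 := by push_cast; ring
    rw [hc, hc']
    have hx : x (n + 2) - lam * x (n + 1) = (lam : ℂ)⁻¹ * (x (n + 1) - lam * x n) +
        b * g (n + 1) * x (n + 1) := by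
      field_simp
      field_simp at hr
      linear_combination hr
    have h2 : (lam : ℂ) ^ (n + 1) * (x (n + 2) - lam * x (n + 1)) =
        (transfer g (lam ^ 2) (b * lam) (n + 1)).2 * x 1 := by
      rw [hx, transfer]
      push_cast
      have : (lam : ℂ) ^ (n + 1) * ((lam : ℂ)⁻¹ * (x (n + 1) - lam * x n) +
          b * g (n + 1) * x (n + 1)) = (lam : ℂ) ^ n * (x (n + 1) - lam * x n) +
          b * lam * g (n + 1) * ((lam : ℂ) ^ n * x (n + 1)) := by
        rw [pow_succ]; field_simp
      rw [this, ih1, ih2]; ring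
    refine ⟨?_, h2⟩
    have h3 : (transfer g (lam ^ 2) (b * lam) (n + 1)).1 =
        lam ^ 2 * (transfer g (lam ^ 2) (b * lam) n).1 +
          (transfer g (lam ^ 2) (b * lam) (n + 1)).2 := by rw [transfer]
    rw [h3]
    push_cast
    rw [add_mul, ← h2, mul_assoc, ← ih1]
    ring

/-- The solution of the discrete problem that decays at `-∞`. -/
noncomputable def jostSolution (g : ℕ → ℝ) (lam b : ℝ) (j : ℤ) : ℂ :=
  if 1 ≤ j then ((transfer g (lam ^ 2) (b * lam) (j - 1).toNat).1 / lam ^ (j - 1).toNat : ℝ)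
  else (lam ^ (1 - j).toNat : ℝ)

theorem jostSolution_rec {lam b : ℝ} (h0 : lam ≠ 0) (g : ℕ → ℝ) (j : ℤ) :
    jostSolution g lam b (j + 1) + jostSolution g lam b (j - 1) =
      ((lam : ℂ) + (lam : ℂ)⁻¹ + b * (if 1 ≤ j then g j.toNat else 0)) *
        jostSolution g lam b j := by
  have h0' : (lam : ℂ) ≠ 0 := by exact_mod_cast h0
  unfold jostSolution
  rcases lt_trichotomy j 1 with hj | rfl | hj
  · obtain ⟨k, rfl⟩ : ∃ k : ℕ, j = -(k : ℤ) := ⟨(-j).toNat, by omega⟩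
    rw [if_neg (by omega : ¬ (1 ≤ -(k : ℤ) - 1)), if_neg (by omega : ¬ (1 ≤ -(k : ℤ))),
      if_neg (by omega : ¬ (1 ≤ -(k : ℤ))),
      show (1 - (-(k : ℤ) - 1)).toNat = k + 2 by omega, show (1 - -(k : ℤ)).toNat = k + 1 by omega]
    -- For `k = 0` the right neighbour is the node 1, where the other formula takes over.
    rcases Nat.eq_zero_or_pos k with rfl | hk
    · simp [transfer]; field_simp; ring
    · rw [if_neg (by omega), show (1 - (-(k : ℤ) + 1)).toNat = k by omega]
      push_cast
      field_simp
      ring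
  · simp [transfer]; field_simp; ring
  · obtain ⟨k, rfl⟩ : ∃ k : ℕ, j = (k : ℤ) + 2 := ⟨(j - 2).toNat, by omega⟩
    rw [if_pos (by omega), if_pos (by omega), if_pos (by omega), if_pos (by omega),
      show ((k : ℤ) + 2 + 1 - 1).toNat = k + 2 by omega,
      show ((k : ℤ) + 2 - 1 - 1).toNat = k by omega,
      show ((k : ℤ) + 2 - 1).toNat = k + 1 by omega, show ((k : ℤ) + 2).toNat = k + 2 by omega]
    have e1 : transfer g (lam ^ 2) (b * lam) (k + 1) =
      (lam ^ 2 * (transfer g (lam ^ 2) (b * lam) k).1 + ((transfer g (lam ^ 2) (b * lam) k).2 +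
        b * lam * g (k + 1) * (transfer g (lam ^ 2) (b * lam) k).1),
      (transfer g (lam ^ 2) (b * lam) k).2 +
        b * lam * g (k + 1) * (transfer g (lam ^ 2) (b * lam) k).1) := by rw [transfer]
    have e2 : (transfer g (lam ^ 2) (b * lam) (k + 2)).1 =
      lam ^ 2 * (transfer g (lam ^ 2) (b * lam) (k + 1)).1 +
        ((transfer g (lam ^ 2) (b * lam) (k + 1)).2 +
        b * lam * g (k + 2) * (transfer g (lam ^ 2) (b * lam) (k + 1)).1) := by rw [transfer]
    rw [e2, e1]
    generalize (transfer g (lam ^ 2) (b * lam) k).1 = p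
    generalize (transfer g (lam ^ 2) (b * lam) k).2 = q
    push_cast
    field_simp
    ring

/-- Beyond the last coupling the second component stays zero, so the first one gains a factor `lam ^
2` per step; after division by `lam ^ n` the solution itself decays geometrically with ratio `lam`.
-/
theorem summable_jostSolution {lam b : ℝ} (h0 : lam ≠ 0) (h1 : |lam| < 1) {g : ℕ → ℝ} {m : ℕ}
    (hg : ∀ n, m < n → g n = 0) (hD : (transfer g (lam ^ 2) (b * lam) m).2 = 0) :
    Summable fun j => ‖jostSolution g lam b j‖ ^ 2 := by
  have hl2 : lam ^ 2 < 1 := by rw [← sq_abs]; nlinarith [abs_nonneg lam]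
  have hgeo := summable_geometric_of_lt_one (sq_nonneg lam) hl2
  have htail : ∀ k, (transfer g (lam ^ 2) (b * lam) (m + k)).2 = 0 ∧
      (transfer g (lam ^ 2) (b * lam) (m + k)).1 =
        (lam ^ 2) ^ k * (transfer g (lam ^ 2) (b * lam) m).1 := fun k => by
    induction k with
    | zero => simp [hD]
    | succ k ih =>
      rw [← add_assoc, transfer, hg (m + k + 1) (by omega), ih.1, ih.2]
      constructor
      · ring
      · simp only; ring
  refine Summable.of_nat_of_neg ?_ ?_
  · rw [← summable_nat_add_iff (m + 1)]
    refine (hgeo.mul_left (((transfer g (lam ^ 2) (b * lam) m).1 / lam ^ m) ^ 2)).congr fun k => ?_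
    rw [jostSolution, if_pos (by omega),
      show (((k + (m + 1) : ℕ) : ℤ) - 1).toNat = m + k by omega, (htail k).2, Complex.norm_real,
      Real.norm_eq_abs, sq_abs]
    field_simp
    ring
  · refine (hgeo.mul_left (lam ^ 2)).congr fun k => ?_
    rw [jostSolution, if_neg (by omega), show (1 - -(k : ℤ)).toNat = k + 1 by omega,
      Complex.norm_real, Real.norm_eq_abs, sq_abs]
    ring

/-! ### Eigenvalues as zeros of a discrete secular function -/

section Eigenvalues

variable {A α E : ℝ} {m : ℕ} {γ : ℤ → ℝ} {ε lam : ℝ}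

/-- The nodal values of an eigenfunction solve the discrete problem. -/
theorem eigen_recursion (hc : Real.cos (A * Real.pi) ≠ 0)
    (hlam : lam + lam⁻¹ = 2 * bandXi A α E) {u : ChainSpace}
    (hu : IsChainPair A (perturbedCoupling α m γ ε) u ((E : ℂ) • u)) (j : ℤ) :
    nodeVal A u ((E : ℂ) • u) (j + 1) + nodeVal A u ((E : ℂ) • u) (j - 1) =
      ((lam : ℂ) + (lam : ℂ)⁻¹ + (ε * bandSin E / (2 * Real.cos (A * Real.pi)) : ℝ) *
        (if j ∈ Finset.Icc (1 : ℤ) m then γ j else 0 : ℝ)) * nodeVal A u ((E : ℂ) • u) j := by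
  obtain ⟨K, hK, h⟩ := exists_tsum_nodeResidual_le A E
  obtain ⟨hs, hle⟩ := h _ _ _ hu
  rw [sub_self, norm_zero, zero_pow two_ne_zero, mul_zero] at hle
  have h0 : ‖nodeResidual A (perturbedCoupling α m γ ε) E (nodeVal A u ((E : ℂ) • u)) j‖ ^ 2 ≤ 0 :=
    (hs.le_tsum j fun i _ => by positivity).trans hle
  have h1 : nodeResidual A (perturbedCoupling α m γ ε) E (nodeVal A u ((E : ℂ) • u)) j = 0 := by
    have := le_antisymm h0 (by positivity)
    rwa [sq_eq_zero_iff, norm_eq_zero] at this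
  rw [nodeResidual_eq hc α] at h1
  have hc' : (Real.cos (A * Real.pi) : ℂ) ≠ 0 := by exact_mod_cast hc
  have h2 : (lam : ℂ) + (lam : ℂ)⁻¹ = 2 * (bandXi A α E : ℂ) := by exact_mod_cast hlam
  rw [h2]
  have h3 : ((perturbedCoupling α m γ ε j : ℝ) : ℂ) - α =
      ε * (if j ∈ Finset.Icc (1 : ℤ) m then γ j else 0 : ℝ) := by
    rw [perturbedCoupling]; split_ifs <;> push_cast <;> ring
  rw [h3] at h1
  push_cast at hc' h1 ⊢
  field_simp
  linear_combination h1

/-- The recursion is free at the nodes `j ≤ 0` and `j ≥ m + 1`, and nodal values of an element of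
`L²` tend to zero, so they are geometric on both sides, starting from the nodes 1 and `m`. -/
theorem eigen_left (hc : Real.cos (A * Real.pi) ≠ 0) (h0 : lam ≠ 0) (h1 : |lam| < 1)
    (hlam : lam + lam⁻¹ = 2 * bandXi A α E) {u : ChainSpace}
    (hu : IsChainPair A (perturbedCoupling α m γ ε) u ((E : ℂ) • u)) :
    nodeVal A u ((E : ℂ) • u) 0 = lam * nodeVal A u ((E : ℂ) • u) 1 ∧
    nodeVal A u ((E : ℂ) • u) (m + 1) = lam * nodeVal A u ((E : ℂ) • u) m := by
  set x := nodeVal A u ((E : ℂ) • u) with hx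
  have hsum := summable_norm_nodeVal_sq A u ((E : ℂ) • u)
  have hrec := eigen_recursion hc hlam hu
  have hlim : ∀ f : ℕ → ℤ, Function.Injective f → Tendsto (fun n => x (f n)) atTop (𝓝 0) := by
    intro f hf
    have h2 := (hsum.comp_injective hf).tendsto_atTop_zero
    rw [tendsto_zero_iff_norm_tendsto_zero]
    have h3 := h2.sqrt
    simp only [Function.comp_def, Real.sqrt_zero] at h3
    exact h3.congr fun n => Real.sqrt_sq (norm_nonneg _)
  constructor
  · have := eq_mul_of_tendsto_zero h0 h1 (z := fun k => x (1 - k))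
      (hlim (fun k => 1 - (k : ℤ)) fun a b hab => by simpa using hab) (fun k => by
        have := hrec (1 - ((k + 1 : ℕ) : ℤ))
        rw [if_neg (by rw [Finset.mem_Icc]; omega)] at this
        rw [Complex.ofReal_zero, mul_zero, add_zero] at this
        rw [← this, add_comm]
        congr 2 <;> push_cast <;> ring) 0
    simpa using this
  · have := eq_mul_of_tendsto_zero h0 h1 (z := fun k => x (m + k))
      (hlim (fun k => m + (k : ℤ)) fun a b hab => by simpa using hab) (fun k => by
        have := hrec (m + ((k + 1 : ℕ) : ℤ))
        rw [if_neg (by rw [Finset.mem_Icc]; omega)] at this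
        rw [Complex.ofReal_zero, mul_zero, add_zero] at this
        rw [← this]
        congr 2 <;> push_cast <;> ring) 0
    simpa using this

/-- Decay on the left forces the value at 0 to vanish together with the value at 1, and the second
order recursion carries two adjacent zeros to all nodes. This makes the value at 1 a coordinate on
the eigenspace. -/
theorem eigen_eq_zero (hc : Real.cos (A * Real.pi) ≠ 0) (hS : bandSin E ≠ 0) (h0 : lam ≠ 0)
    (h1 : |lam| < 1) (hlam : lam + lam⁻¹ = 2 * bandXi A α E) {u : ChainSpace}
    (hu : IsChainPair A (perturbedCoupling α m γ ε) u ((E : ℂ) • u))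
    (hx1 : nodeVal A u ((E : ℂ) • u) 1 = 0) : u = 0 := by
  have hrec := eigen_recursion hc hlam hu
  obtain ⟨hl, -⟩ := eigen_left hc h0 h1 hlam hu
  obtain ⟨K, hK, hle⟩ := exists_norm_sq_le (A := A) hS
  have h2 := hle _ _ _ hu
  rw [sub_self, norm_zero] at h2
  set x := nodeVal A u ((E : ℂ) • u)
  rw [hx1, mul_zero] at hl
  have hpos : ∀ n : ℕ, x n = 0 ∧ x (n + 1) = 0 := fun n => by
    induction n with
    | zero => simpa using ⟨hl, hx1⟩
    | succ n ih =>
      have := hrec (n + 1)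
      rw [ih.2, add_sub_cancel_right, ih.1, add_zero, mul_zero] at this
      refine ⟨by push_cast; exact ih.2, by push_cast; exact this⟩
  have hneg : ∀ n : ℕ, x (-n) = 0 ∧ x (-n + 1) = 0 := fun n => by
    induction n with
    | zero => simpa using ⟨hl, hx1⟩
    | succ n ih =>
      have := hrec (-n)
      rw [ih.1, ih.2, zero_add, mul_zero] at this
      refine ⟨?_, ?_⟩
      · rw [← this]; congr 1; push_cast; ring
      · rw [← ih.1]; congr 1; push_cast; ring
  have hall : ∀ j, x j = 0 := fun j => by
    obtain ⟨n, rfl | rfl⟩ := Int.eq_nat_or_neg j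
    exacts [(hpos n).1, (hneg n).1]
  have h3 : ∑' j, ‖x j‖ ^ 2 = 0 := by simp [hall]
  rw [h3] at h2
  have h4 : ‖u‖ ^ 2 ≤ 0 := by simpa using h2
  have := le_antisymm h4 (by positivity)
  rwa [sq_eq_zero_iff, norm_eq_zero] at this

/-- Eigenvalues off the Dirichlet spectrum and outside the bands are simple. -/
theorem IsOpEigenvalue.simple (hc : Real.cos (A * Real.pi) ≠ 0) (hS : bandSin E ≠ 0)
    (h0 : lam ≠ 0) (h1 : |lam| < 1) (hlam : lam + lam⁻¹ = 2 * bandXi A α E)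
    (h : IsOpEigenvalue (chainLaplacian A (perturbedCoupling α m γ ε)) E) :
    IsSimpleOpEigenvalue (chainLaplacian A (perturbedCoupling α m γ ε)) E := by
  obtain ⟨u, hu0, hu⟩ := isOpEigenvalue_iff.1 h
  rw [IsSimpleOpEigenvalue, finrank_eq_one_iff']
  refine ⟨⟨u, mem_opEigenspace_iff.2 hu⟩, fun h => hu0 (congrArg Subtype.val h), ?_⟩
  rintro ⟨w, hw⟩
  have hw' := mem_opEigenspace_iff.1 hw
  have hx1 : nodeVal A u ((E : ℂ) • u) 1 ≠ 0 := fun h =>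
    hu0 (eigen_eq_zero hc hS h0 h1 hlam hu h)
  set c := nodeVal A w ((E : ℂ) • w) 1 / nodeVal A u ((E : ℂ) • u) 1 with hcdef
  refine ⟨c, Subtype.ext ?_⟩
  have hp := isChainPair_sub_smul c hw' hu
  rw [smul_comm c (E : ℂ) u, ← smul_sub] at hp
  have hz := eigen_eq_zero hc hS h0 h1 hlam hp (by
    rw [smul_sub, smul_comm (E : ℂ) c u, nodeVal_sub_smul, hcdef, div_mul_cancel₀ _ hx1, sub_self])
  exact (sub_eq_zero.1 hz).symm

/-- The nodal values of an eigenfunction are a multiple of the solution decaying at `-∞`, and decay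
at `+∞` is the vanishing of the second component. Conversely that solution has zero residual and is
lifted to an eigenfunction. -/
theorem isOpEigenvalue_iff_transfer (hc : Real.cos (A * Real.pi) ≠ 0) (hS : bandSin E ≠ 0)
    (h0 : lam ≠ 0) (h1 : |lam| < 1) (hlam : lam + lam⁻¹ = 2 * bandXi A α E) :
    IsOpEigenvalue (chainLaplacian A (perturbedCoupling α m γ ε)) E ↔
      (transfer (fun n => γ n) (lam ^ 2)
        (ε * bandSin E / (2 * Real.cos (A * Real.pi)) * lam) m).2 = 0 := by
  rw [isOpEigenvalue_iff]
  set b := ε * bandSin E / (2 * Real.cos (A * Real.pi)) with hb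
  have h0' : (lam : ℂ) ≠ 0 := by exact_mod_cast h0
  constructor
  · rintro ⟨u, hu0, hu⟩
    obtain ⟨hl, hr⟩ := eigen_left hc h0 h1 hlam hu
    have hrec := eigen_recursion hc hlam hu
    have hx1 : nodeVal A u ((E : ℂ) • u) 1 ≠ 0 := fun h =>
      hu0 (eigen_eq_zero hc hS h0 h1 hlam hu h)
    set x := nodeVal A u ((E : ℂ) • u)
    have := (solution_eq_transfer (b := b) (g := fun n => γ n) (m := m) h0 hl (fun n hn => by
      have := hrec (n + 1)
      rw [if_pos (by rw [Finset.mem_Icc]; omega), add_sub_cancel_right, ← hb] at this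
      have hidx : (n : ℤ) + 2 = n + 1 + 1 := by ring
      rw [hidx, this]
      push_cast
      rfl) m le_rfl).2
    rw [hr, sub_self, mul_zero] at this
    exact_mod_cast (mul_eq_zero.1 this.symm).resolve_right hx1
  · intro hD
    -- Summability on the right needs couplings that vanish beyond `m`; the transfer recursion up to
    -- `m` does not notice the cut-off.
    set g : ℕ → ℝ := fun n => if n ≤ m then γ n else 0 with hg
    rw [transfer_congr (g' := g) (m := m) (fun n hn => by simp only [hg, if_pos hn]) m le_rfl] at hD
    have hsum := summable_jostSolution h0 h1 (m := m)
      (fun n hn => by simp only [hg]; rw [if_neg (by omega)]) hD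
    obtain ⟨K, hK, hbuild⟩ := exists_chainPair_of_nodes A hS
    set x := jostSolution g lam b with hx
    have hres : ∀ j, nodeResidual A (perturbedCoupling α m γ ε) E x j = 0 := fun j => by
      rw [nodeResidual_eq hc α]
      have hr := jostSolution_rec (b := b) h0 g j
      rw [← hx] at hr
      have hc' : (Real.cos (A * Real.pi) : ℂ) ≠ 0 := by exact_mod_cast hc
      have h2 : (lam : ℂ) + (lam : ℂ)⁻¹ = 2 * (bandXi A α E : ℂ) := by exact_mod_cast hlam
      have h3 : ((perturbedCoupling α m γ ε j : ℝ) : ℂ) - α =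
          ε * (if 1 ≤ j then g j.toNat else 0 : ℝ) := by
        rw [perturbedCoupling]
        by_cases hj : j ∈ Finset.Icc (1 : ℤ) m
        · rw [if_pos hj]
          rw [Finset.mem_Icc] at hj
          have : ((j.toNat : ℕ) : ℤ) = j := by omega
          simp only [hg]
          rw [if_pos hj.1, if_pos (by omega), this]; push_cast; ring
        · rw [if_neg hj]
          rw [Finset.mem_Icc] at hj
          simp only [hg]
          split_ifs
          · omega
          · simp
          · simp
      rw [h3, hr, h2, hb]
      push_cast at hc' ⊢
      field_simp
      split_ifs <;> push_cast <;> ring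
    obtain ⟨u, v, hp, hnode, hm, -⟩ := hbuild (perturbedCoupling α m γ ε) x hsum (by simp [hres])
    have hv : v = (E : ℂ) • u := eq_smul_of_edgeMass fun j =>
      le_antisymm ((hm j).trans_eq (by rw [hres]; simp)) (edgeMass_nonneg _ _)
    subst hv
    refine ⟨u, ?_, hp⟩
    rintro rfl
    have h4 := nodeVal_sub_smul A 0 0 0 0 1 1
    simp only [smul_zero, one_mul, sub_self] at h4
    rw [smul_zero] at hnode
    rw [hnode, hx, jostSolution] at h4
    simp [transfer] at h4

/-- A priori bound for eigenvalues in the gaps. -/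
theorem IsOpEigenvalue.abs_bandXi_le (hc : Real.cos (A * Real.pi) ≠ 0) (hS : bandSin E ≠ 0)
    (hξ : 1 < |bandXi A α E|) {Γ : ℝ} (hΓ : ∀ j ∈ Finset.Icc (1 : ℤ) m, |γ j| ≤ Γ) (hΓ0 : 0 ≤ Γ)
    (h : IsOpEigenvalue (chainLaplacian A (perturbedCoupling α m γ ε)) E) :
    2 * (|bandXi A α E| - 1) ≤ |ε * bandSin E / (2 * Real.cos (A * Real.pi))| * Γ := by
  obtain ⟨u, hu0, hu⟩ := isOpEigenvalue_iff.1 h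
  -- Either root would do: `lam` only serves to invoke `eigen_recursion`, and no decay is used.
  obtain ⟨lam, h0, hlam⟩ : ∃ lam : ℝ, lam ≠ 0 ∧ lam + lam⁻¹ = 2 * bandXi A α E := by
    set ξ := bandXi A α E
    have hsq : 0 ≤ ξ ^ 2 - 1 := by
      have : 1 < ξ ^ 2 := by rw [← sq_abs]; nlinarith
      linarith
    have hprod : (ξ - √(ξ ^ 2 - 1)) * (ξ + √(ξ ^ 2 - 1)) = 1 := by
      have := Real.sq_sqrt hsq; nlinarith
    refine ⟨ξ - √(ξ ^ 2 - 1), left_ne_zero_of_mul_eq_one hprod, ?_⟩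
    rw [inv_eq_of_mul_eq_one_right hprod]; ring
  have hrec := eigen_recursion hc hlam hu
  have hx := summable_norm_nodeVal_sq A u ((E : ℂ) • u)
  obtain ⟨K, hK, hle⟩ := exists_norm_sq_le (A := A) hS
  have h2 := hle _ _ _ hu
  rw [sub_self, norm_zero] at h2
  set x := nodeVal A u ((E : ℂ) • u)
  set b := ε * bandSin E / (2 * Real.cos (A * Real.pi))
  set g : ℤ → ℝ := fun j => if j ∈ Finset.Icc (1 : ℤ) m then γ j else 0 with hg
  have hgΓ : ∀ j, |g j| ≤ Γ := fun j => by
    simp only [hg]; split_ifs with hj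
    exacts [hΓ j hj, by simpa using hΓ0]
  set r : ℤ → ℂ := fun j => -(b * g j * x j) with hr
  have hrle : ∀ j, ‖r j‖ ^ 2 ≤ (|b| * Γ) ^ 2 * ‖x j‖ ^ 2 := fun j => by
    simp only [hr]
    rw [norm_neg, norm_mul, norm_mul, Complex.norm_real, Complex.norm_real, Real.norm_eq_abs,
      Real.norm_eq_abs, mul_pow]
    gcongr
    exact hgΓ j
  have hrs : Summable fun j => ‖r j‖ ^ 2 :=
    Summable.of_nonneg_of_le (fun j => by positivity) hrle (hx.mul_left _)
  have h3 := sq_sub_one_mul_tsum_le hξ hx hrs fun j => by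
    have h4 : (lam : ℂ) + (lam : ℂ)⁻¹ = 2 * (bandXi A α E : ℂ) := by exact_mod_cast hlam
    have h5 := hrec j
    rw [h4] at h5
    simp only [hr]
    linear_combination -h5
  have h4 := hasSum_le hrle hrs.hasSum (hx.hasSum.mul_left _)
  have hXpos : 0 < ∑' j, ‖x j‖ ^ 2 := by
    have : 0 < ‖u‖ ^ 2 := by have := norm_pos_iff.2 hu0; positivity
    by_contra hcon
    push Not at hcon
    have h6 : K * (∑' j, ‖x j‖ ^ 2) ≤ 0 := mul_nonpos_of_nonneg_of_nonpos hK.le hcon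
    rw [zero_pow two_ne_zero, add_zero] at h2
    linarith
  have h5 : (2 * (|bandXi A α E| - 1)) ^ 2 ≤ (|b| * Γ) ^ 2 := by
    have : (2 * (|bandXi A α E| - 1)) ^ 2 * ∑' j, ‖x j‖ ^ 2 ≤ (|b| * Γ) ^ 2 * ∑' j, ‖x j‖ ^ 2 := by
      linarith
    exact le_of_mul_le_mul_right this hXpos
  exact le_of_sq_le_sq h5 (by positivity)

end Eigenvalues

/-! ### The band functions -/

theorem bandCos_of_nonneg {E : ℝ} (h : 0 ≤ E) : bandCos E = Real.cos (√E * Real.pi) := by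
  rw [bandCos, if_pos h]

theorem bandCos_of_neg {E : ℝ} (h : E < 0) : bandCos E = Real.cosh (√(-E) * Real.pi) := by
  rw [bandCos, if_neg h.not_ge]

theorem bandSin_zero : bandSin 0 = Real.pi := by simp [bandSin]

theorem bandSin_of_pos {E : ℝ} (h : 0 < E) : bandSin E = Real.sin (√E * Real.pi) / √E := by
  rw [bandSin, if_neg h.ne', if_pos h.le]

theorem bandSin_of_neg {E : ℝ} (h : E < 0) : bandSin E = Real.sinh (√(-E) * Real.pi) / √(-E) := by
  rw [bandSin, if_neg h.ne, if_neg h.not_ge]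

theorem continuous_bandCos : Continuous bandCos := by
  unfold bandCos
  refine Continuous.if_le (by fun_prop) (by fun_prop) continuous_const continuous_id ?_
  rintro x rfl
  simp

theorem continuous_bandSin : Continuous bandSin := by
  -- Both branches are rewritten through functions that are continuous at the origin, where they
  -- agree.
  have h1 : bandSin = fun E => if 0 ≤ E then Real.pi * Real.sinc (√E * Real.pi)
      else Real.pi * dslope Real.sinh 0 (√(-E) * Real.pi) := by
    funext E
    have hpi := Real.pi_ne_zero
    rcases lt_trichotomy E 0 with h | rfl | h
    · have h2 : √(-E) ≠ 0 := (Real.sqrt_pos.2 (by linarith)).ne'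
      rw [bandSin_of_neg h, if_neg h.not_ge, dslope_of_ne _ (by positivity), slope_def_field]
      simp only [Real.sinh_zero, sub_zero]
      field_simp
    · simp [bandSin_zero]
    · have h2 : √E ≠ 0 := (Real.sqrt_pos.2 h).ne'
      rw [bandSin_of_pos h, if_pos h.le, Real.sinc_of_ne_zero (by positivity)]
      field_simp
  have h2 : Continuous (dslope Real.sinh 0) := by
    rw [← continuousOn_univ, continuousOn_dslope univ_mem]
    exact ⟨Real.continuous_sinh.continuousOn, Real.differentiable_sinh _⟩
  rw [h1]
  refine Continuous.if_le (continuous_const.mul (Real.continuous_sinc.comp (by fun_prop)))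
    (continuous_const.mul (h2.comp (by fun_prop))) continuous_const continuous_id ?_
  rintro x rfl
  simp

theorem hasDerivAt_bandCos {E : ℝ} (hE : E ≠ 0) :
    HasDerivAt bandCos (-(Real.pi / 2) * bandSin E) E := by
  rcases hE.lt_or_gt with h | h
  · have h2 : √(-E) ≠ 0 := (Real.sqrt_pos.2 (by linarith)).ne'
    have h3 := (((hasDerivAt_neg E).sqrt (by simpa using hE)).mul_const Real.pi).cosh
    refine (h3.congr_of_eventuallyEq ?_).congr_deriv ?_
    · filter_upwards [gt_mem_nhds h] with x hx using bandCos_of_neg hx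
    · rw [bandSin_of_neg h]; field_simp
  · have h2 : √E ≠ 0 := (Real.sqrt_pos.2 h).ne'
    have h3 := (((hasDerivAt_id E).sqrt hE).mul_const Real.pi).cos
    refine (h3.congr_of_eventuallyEq ?_).congr_deriv ?_
    · filter_upwards [lt_mem_nhds h] with x hx using bandCos_of_nonneg hx.le
    · rw [bandSin_of_pos h]; simp only [id]; field_simp

theorem hasDerivAt_bandSin {E : ℝ} (hE : E ≠ 0) :
    HasDerivAt bandSin ((Real.pi * bandCos E - bandSin E) / (2 * E)) E := by
  rcases hE.lt_or_gt with h | h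
  · have h2 : √(-E) ≠ 0 := (Real.sqrt_pos.2 (by linarith)).ne'
    have h4 := (hasDerivAt_neg E).sqrt (by simpa using hE)
    have h3 := (h4.mul_const Real.pi).sinh.div h4 h2
    refine (h3.congr_of_eventuallyEq ?_).congr_deriv ?_
    · filter_upwards [gt_mem_nhds h] with x hx using bandSin_of_neg hx
    · rw [bandSin_of_neg h, bandCos_of_neg h, Real.sq_sqrt (by linarith)]
      have h5 : √(-E) * √(-E) = -E := Real.mul_self_sqrt (by linarith)
      field_simp
      ring
  · have h2 : √E ≠ 0 := (Real.sqrt_pos.2 h).ne'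
    have h4 := (hasDerivAt_id E).sqrt hE
    have h3 := (h4.mul_const Real.pi).sin.div h4 h2
    refine (h3.congr_of_eventuallyEq ?_).congr_deriv ?_
    · filter_upwards [lt_mem_nhds h] with x hx using bandSin_of_pos hx
    · rw [bandSin_of_pos h, bandCos_of_nonneg h.le]
      simp only [id]
      rw [Real.sq_sqrt h.le]
      field_simp

theorem pi_lt_bandSin {E : ℝ} (h : E < 0) : Real.pi < bandSin E := by
  have h2 : 0 < √(-E) := Real.sqrt_pos.2 (by linarith)
  rw [bandSin_of_neg h, lt_div_iff₀ h2, mul_comm]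
  exact Real.self_lt_sinh_iff.2 (by positivity)

theorem one_lt_bandCos {E : ℝ} (h : E < 0) : 1 < bandCos E := by
  have h2 : 0 < √(-E) := Real.sqrt_pos.2 (by linarith)
  rw [bandCos_of_neg h, Real.one_lt_cosh]
  positivity

theorem abs_bandSin_lt_pi {E : ℝ} (h : 0 < E) : |bandSin E| < Real.pi := by
  have h2 : 0 < √E := Real.sqrt_pos.2 h
  have h3 : 0 < √E * Real.pi := by positivity
  rw [bandSin_of_pos h, abs_div, abs_of_pos h2, div_lt_iff₀ h2, mul_comm Real.pi]
  exact Real.abs_sin_lt_abs h3.ne' |>.trans_eq (abs_of_pos h3)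

theorem bandSin_mul_sqrt_le_bandCos {E : ℝ} (h : E < 0) : √(-E) * bandSin E ≤ bandCos E := by
  have h2 : 0 < √(-E) := Real.sqrt_pos.2 (by linarith)
  rw [bandSin_of_neg h, bandCos_of_neg h, mul_div_cancel₀ _ h2.ne']
  exact (Real.sinh_lt_cosh _).le

theorem bandCos_nat_sq (j : ℕ) : bandCos ((j : ℝ) ^ 2) = (-1) ^ j := by
  rw [bandCos_of_nonneg (by positivity), Real.sqrt_sq (by positivity), Real.cos_nat_mul_pi]

theorem bandSin_nat_sq (j : ℕ) : bandSin (((j : ℝ) + 1) ^ 2) = 0 := by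
  rw [bandSin_of_pos (by positivity), Real.sqrt_sq (by positivity)]
  have := Real.sin_nat_mul_pi (j + 1)
  push_cast at this
  rw [this, zero_div]

/-- The interval between consecutive zeros of `bandSin`; the first one is unbounded below. -/
def dirichletInterval (i : ℕ) : Set ℝ := {E | (i = 0 ∨ (i : ℝ) ^ 2 < E) ∧ E < ((i : ℝ) + 1) ^ 2}

theorem ordConnected_dirichletInterval (i : ℕ) : (dirichletInterval i).OrdConnected :=
  ⟨fun _ hx _ hy _ hz => ⟨hx.1.imp_right hz.1.trans_lt', hz.2.trans_lt hy.2⟩⟩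

theorem isOpen_dirichletInterval (i : ℕ) : IsOpen (dirichletInterval i) := by
  rcases eq_or_ne i 0 with h | h
  · have : dirichletInterval i = Iio (((i : ℝ) + 1) ^ 2) := by
      ext E; simp [dirichletInterval, h]
    rw [this]; exact isOpen_Iio
  · have : dirichletInterval i = Ioo ((i : ℝ) ^ 2) (((i : ℝ) + 1) ^ 2) := by
      ext E; simp [dirichletInterval, h]
    rw [this]; exact isOpen_Ioo

theorem bandSin_sign {i : ℕ} {E : ℝ} (h : E ∈ dirichletInterval i) :
    0 < (-1) ^ i * bandSin E := by
  obtain ⟨h1, h2⟩ := h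
  rcases le_or_gt E 0 with hE | hE
  · have hi : i = 0 := by
      rcases h1 with h1 | h1
      · exact h1
      · have : (0 : ℝ) ≤ (i : ℝ) ^ 2 := by positivity
        linarith
    rw [hi, pow_zero, one_mul]
    rcases hE.lt_or_eq with hE | rfl
    · exact Real.pi_pos.trans (pi_lt_bandSin hE)
    · rw [bandSin_zero]; exact Real.pi_pos
  · have h3 : 0 < √E := Real.sqrt_pos.2 hE
    have h4 : (i : ℝ) < √E := by
      rcases h1 with rfl | h1
      · simpa using h3
      · exact Real.lt_sqrt_of_sq_lt h1
    have h5 : √E < i + 1 := by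
      rw [Real.sqrt_lt' (by positivity)]; exact h2
    have h6 : 0 < Real.sin (√E * Real.pi - i * Real.pi) :=
      Real.sin_pos_of_pos_of_lt_pi (by nlinarith [Real.pi_pos]) (by nlinarith [Real.pi_pos])
    rw [Real.sin_sub_nat_mul_pi] at h6
    rw [bandSin_of_pos hE, mul_div_assoc']
    positivity

theorem mem_dirichletInterval_or (E : ℝ) :
    (∃ i, E ∈ dirichletInterval i) ∨ ∃ j : ℕ, E = ((j : ℝ) + 1) ^ 2 := by
  rcases lt_or_ge E 1 with h | h
  · exact Or.inl ⟨0, Or.inl rfl, by simpa using h⟩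
  · have h0 : (0 : ℝ) ≤ E := by linarith
    have h1 := Nat.floor_le (Real.sqrt_nonneg E)
    have h2 := Nat.lt_floor_add_one (√E)
    have h3 : 1 ≤ ⌊√E⌋₊ := by
      rw [Nat.one_le_floor_iff]; exact Real.one_le_sqrt.2 h
    rcases h1.lt_or_eq with h1 | h1
    · refine Or.inl ⟨⌊√E⌋₊, Or.inr ((Real.lt_sqrt (by positivity)).1 h1), ?_⟩
      exact (Real.sqrt_lt' (by positivity)).1 h2
    · refine Or.inr ⟨⌊√E⌋₊ - 1, ?_⟩
      rw [Nat.cast_sub h3, Nat.cast_one, sub_add_cancel, h1, Real.sq_sqrt h0]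

theorem bandSin_ne_zero {i : ℕ} {E : ℝ} (h : E ∈ dirichletInterval i) : bandSin E ≠ 0 :=
  right_ne_zero_of_mul (bandSin_sign h).ne'

theorem bandSin_eq_zero_iff {E : ℝ} : bandSin E = 0 ↔ ∃ j : ℕ, E = ((j : ℝ) + 1) ^ 2 := by
  constructor
  · intro h
    rcases mem_dirichletInterval_or E with ⟨i, hi⟩ | h'
    exacts [absurd h (bandSin_ne_zero hi), h']
  · rintro ⟨j, rfl⟩
    exact bandSin_nat_sq j

theorem abs_bandCos_lt_one {i : ℕ} {E : ℝ} (h : E ∈ dirichletInterval i) (hE : 0 < E) :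
    |bandCos E| < 1 := by
  have h1 := bandCos_sq_add E
  have h2 : 0 < bandSin E ^ 2 := by have := bandSin_ne_zero h; positivity
  rw [← sq_lt_one_iff_abs_lt_one]
  nlinarith

/-- The function `(bandCos - c) / bandSin`. -/
noncomputable def bandSlope (c E : ℝ) : ℝ := (bandCos E - c) / bandSin E

theorem hasDerivAt_bandSlope (c : ℝ) {i : ℕ} {E : ℝ} (h : E ∈ dirichletInterval i) (hE : E ≠ 0) :
    HasDerivAt (bandSlope c) (((bandCos E - c) * bandSin E - Real.pi * (1 - c * bandCos E)) /
      (2 * E * bandSin E ^ 2)) E := by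
  have hS := bandSin_ne_zero h
  refine (((hasDerivAt_bandCos hE).sub_const c).div (hasDerivAt_bandSin hE) hS).congr_deriv ?_
  have := bandCos_sq_add E
  field_simp
  linear_combination (-Real.pi) * this

/-- The numerator is affine in `c`, hence a convex combination of its values at `c = 1` and `c =
-1`, which factor. For `E > 0` the signs follow from `|cos kπ| < 1` and `|sin kπ / k| < π`. For `E <
0` both functions exceed these bounds, so the numerator changes sign along with the factor `E` in
the denominator. -/
theorem bandSlope_deriv_neg {c : ℝ} (hc : |c| ≤ 1) {i : ℕ} {E : ℝ} (h : E ∈ dirichletInterval i)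
    (hE : E ≠ 0) :
    ((bandCos E - c) * bandSin E - Real.pi * (1 - c * bandCos E)) / (2 * E * bandSin E ^ 2) < 0 := by
  have hS : 0 < bandSin E ^ 2 := by have := bandSin_ne_zero h; positivity
  obtain ⟨hc1, hc2⟩ := abs_le.1 hc
  have key : (bandCos E - c) * bandSin E - Real.pi * (1 - c * bandCos E) =
      (1 + c) / 2 * ((bandCos E - 1) * (bandSin E + Real.pi)) +
      (1 - c) / 2 * ((bandCos E + 1) * (bandSin E - Real.pi)) := by ring
  rw [key]
  rcases hE.lt_or_gt with h0 | h0
  · have h1 := one_lt_bandCos h0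
    have h2 := pi_lt_bandSin h0
    have h3 : 0 < (bandCos E - 1) * (bandSin E + Real.pi) := by
      have := Real.pi_pos
      apply mul_pos <;> linarith
    have h4 : 0 < (bandCos E + 1) * (bandSin E - Real.pi) := by apply mul_pos <;> linarith
    refine div_neg_of_pos_of_neg ?_ (by nlinarith)
    rcases hc1.lt_or_eq with h5 | h5
    · exact add_pos_of_pos_of_nonneg (mul_pos (by linarith) h3) (mul_nonneg (by linarith) h4.le)
    · rw [← h5]; linarith
  · obtain ⟨h1, h1'⟩ := abs_lt.1 (abs_bandCos_lt_one h h0)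
    obtain ⟨h2, h2'⟩ := abs_lt.1 (abs_bandSin_lt_pi h0)
    have h3 : (bandCos E - 1) * (bandSin E + Real.pi) < 0 :=
      mul_neg_of_neg_of_pos (by linarith) (by linarith)
    have h4 : (bandCos E + 1) * (bandSin E - Real.pi) < 0 :=
      mul_neg_of_pos_of_neg (by linarith) (by linarith)
    refine div_neg_of_neg_of_pos ?_ (by positivity)
    rcases hc1.lt_or_eq with h5 | h5
    · exact add_neg_of_neg_of_nonpos (mul_neg_of_pos_of_neg (by linarith) h3)
        (mul_nonpos_of_nonneg_of_nonpos (by linarith) h4.le)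
    · rw [← h5]; linarith

theorem continuousOn_bandSlope (c : ℝ) (i : ℕ) :
    ContinuousOn (bandSlope c) (dirichletInterval i) :=
  ((continuous_bandCos.sub continuous_const).continuousOn).div continuous_bandSin.continuousOn
    fun _ h => bandSin_ne_zero h

theorem strictAntiOn_bandSlope {c : ℝ} (hc : |c| ≤ 1) (i : ℕ) :
    StrictAntiOn (bandSlope c) (dirichletInterval i) := by
  have hI : Convex ℝ (dirichletInterval i) := (ordConnected_dirichletInterval i).convex
  have hanti : ∀ s : Set ℝ, Convex ℝ s → s ⊆ dirichletInterval i → (0 : ℝ) ∉ interior s →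
      StrictAntiOn (bandSlope c) s := by
    intro s hs hsub h0
    refine strictAntiOn_of_deriv_neg hs ((continuousOn_bandSlope c i).mono hsub) fun x hx => ?_
    have hxI := hsub (interior_subset hx)
    have hx0 : x ≠ 0 := fun h => h0 (h ▸ hx)
    rw [(hasDerivAt_bandSlope c hxI hx0).deriv]
    exact bandSlope_deriv_neg hc hxI hx0
  rcases eq_or_ne i 0 with hi | hi
  -- The derivative formula is not available at `E = 0`, which lies in the first interval;
  -- monotonicity on the two halves is glued there.
  · have h0 : (0 : ℝ) ∈ dirichletInterval i := ⟨Or.inl hi, by positivity⟩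
    have h1 := hanti (dirichletInterval i ∩ Iic 0) (hI.inter (convex_Iic 0)) inter_subset_left
      fun h => by simpa using (interior_mono inter_subset_right h : (0 : ℝ) ∈ interior (Iic 0))
    have h2 := hanti (dirichletInterval i ∩ Ici 0) (hI.inter (convex_Ici 0)) inter_subset_left
      fun h => by simpa using (interior_mono inter_subset_right h : (0 : ℝ) ∈ interior (Ici 0))
    have h3 := h1.union h2 (c := 0) ⟨⟨h0, self_mem_Iic⟩, fun x hx => hx.2⟩
      ⟨⟨h0, self_mem_Ici⟩, fun x hx => hx.2⟩
    rwa [← inter_union_distrib_left, Iic_union_Ici, inter_univ] at h3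
  · refine hanti _ hI le_rfl fun h => ?_
    have h1 := (interior_subset h).1.resolve_left hi
    have : (0 : ℝ) ≤ (i : ℝ) ^ 2 := by positivity
    linarith

/-- `1 / bandSin` is controlled by `bandSlope c` for `|c| < 1`. -/
theorem abs_inv_bandSin_sub_le {c : ℝ} (hc : |c| < 1) {i : ℕ} {E E' : ℝ}
    (h : E ∈ dirichletInterval i) (h' : E' ∈ dirichletInterval i) :
    (1 - |c|) * |(bandSin E)⁻¹ - (bandSin E')⁻¹| ≤ |bandSlope c E - bandSlope c E'| := by
  wlog hle : E ≤ E' generalizing E E'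
  · rw [abs_sub_comm, abs_sub_comm (bandSlope c E)]
    exact this h' h (le_of_not_ge hle)
  have h1 := (strictAntiOn_bandSlope (c := 1) (by simp) i).antitoneOn h h' hle
  have h2 := (strictAntiOn_bandSlope (c := -1) (by simp) i).antitoneOn h h' hle
  -- The slopes for `±1` are monotone too. The slope for `c` is a convex combination of them and `1
  -- / bandSin` is half their difference, so the comparison reduces to nonnegative `x` and `y`.
  set x := bandSlope 1 E - bandSlope 1 E' with hx
  set y := bandSlope (-1) E - bandSlope (-1) E' with hy
  have e1 : (bandSin E)⁻¹ - (bandSin E')⁻¹ = (y - x) / 2 := by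
    simp only [hx, hy, bandSlope]; ring
  have e2 : bandSlope c E - bandSlope c E' = (1 + c) / 2 * x + (1 - c) / 2 * y := by
    simp only [hx, hy, bandSlope]; ring
  have hx0 : 0 ≤ x := by linarith
  have hy0 : 0 ≤ y := by linarith
  obtain ⟨hc1, hc2⟩ := abs_lt.1 hc
  have habs := neg_abs_le c
  have habs' := le_abs_self c
  rw [e1, e2, abs_of_nonneg (add_nonneg (mul_nonneg (by linarith) hx0)
    (mul_nonneg (by linarith) hy0)), abs_div, abs_two]
  have h3 : |y - x| ≤ x + y := abs_le.2 ⟨by linarith, by linarith⟩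
  have h4 : (1 - |c|) * (|y - x| / 2) ≤ (1 - |c|) * ((x + y) / 2) := by
    apply mul_le_mul_of_nonneg_left _ (by linarith); linarith
  nlinarith

/-! ### Band edges -/

theorem abs_neg_one_pow_mul (i : ℕ) (x : ℝ) : |(-1) ^ i * x| = |x| := by
  rw [abs_mul, abs_pow, abs_neg, abs_one, one_pow, one_mul]

theorem neg_one_pow_mul_self (i : ℕ) : ((-1 : ℝ) ^ i) * (-1) ^ i = 1 := by
  rw [← mul_pow]; norm_num

/-- The Kronig–Penney discriminant `cos kπ + α/(4k) sin kπ` as a function of the energy. -/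
noncomputable def bandDisc (α E : ℝ) : ℝ := bandCos E + α / 4 * bandSin E

theorem continuous_bandDisc (α : ℝ) : Continuous (bandDisc α) :=
  continuous_bandCos.add (continuous_const.mul continuous_bandSin)

theorem bandDisc_eq (α c : ℝ) {i : ℕ} {E : ℝ} (h : E ∈ dirichletInterval i) :
    bandDisc α E - c = bandSin E * (bandSlope c E + α / 4) := by
  have := bandSin_ne_zero h
  rw [bandDisc, bandSlope]; field_simp; ring

theorem bandDisc_nat_sq (α : ℝ) (j : ℕ) : bandDisc α (((j : ℝ) + 1) ^ 2) = (-1) ^ (j + 1) := by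
  have := bandCos_nat_sq (j + 1)
  push_cast at this
  rw [bandDisc, bandSin_nat_sq, this, mul_zero, add_zero]

theorem bandSin_mul_le_bandDisc (α : ℝ) {E : ℝ} (h : E < 0) :
    bandSin E * (√(-E) - |α| / 4) ≤ bandDisc α E := by
  have h1 := bandSin_mul_sqrt_le_bandCos h
  have h2 := Real.pi_pos.trans (pi_lt_bandSin h)
  have h3 := neg_abs_le α
  rw [bandDisc]
  nlinarith

theorem exists_left_end (α : ℝ) (i : ℕ) : ∃ a, a < ((i : ℝ) + 1) ^ 2 ∧
    Ioo a (((i : ℝ) + 1) ^ 2) ⊆ dirichletInterval i ∧ 1 ≤ (-1) ^ i * bandDisc α a := by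
  rcases Nat.eq_zero_or_pos i with rfl | hi
  · have h0 : -(|α| / 4 + 1) ^ 2 < 0 := by have := abs_nonneg α; nlinarith
    -- Here `√(-E) - |α| / 4 = 1`, so the discriminant is at least `bandSin E > π`.
    refine ⟨-(|α| / 4 + 1) ^ 2, h0.trans (by positivity), fun E hE => ⟨Or.inl rfl, hE.2⟩, ?_⟩
    have h1 := bandSin_mul_le_bandDisc α h0
    have h2 := pi_lt_bandSin h0
    rw [neg_neg, Real.sqrt_sq (by positivity)] at h1
    have := Real.pi_gt_three
    rw [pow_zero, one_mul]
    linarith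
  · refine ⟨(i : ℝ) ^ 2, by gcongr; linarith, fun E hE => ⟨Or.inr hE.1, hE.2⟩, ?_⟩
    obtain ⟨k, rfl⟩ : ∃ k, i = k + 1 := ⟨i - 1, by omega⟩
    have := bandDisc_nat_sq α k
    push_cast at this ⊢
    rw [this, neg_one_pow_mul_self]

/-- A crossing exists because the signed discriminant falls from at least 1 to -1. It is the only
one because the signed discriminant minus `d` is a positive factor times `bandSlope c + α / 4`,
which is strictly decreasing; monotonicity of the discriminant itself is not used. -/
theorem exists_bandEdge (α : ℝ) (i : ℕ) {d : ℝ} (hd : |d| < 1) :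
    ∃ r ∈ dirichletInterval i, ∀ E ∈ dirichletInterval i,
      (d < (-1) ^ i * bandDisc α E ↔ E < r) ∧ ((-1) ^ i * bandDisc α E < d ↔ r < E) := by
  obtain ⟨hd1, hd2⟩ := abs_lt.1 hd
  obtain ⟨a, ha, hsub, ha1⟩ := exists_left_end α i
  have hcont : ContinuousOn (fun E => (-1) ^ i * bandDisc α E) (Icc a (((i : ℝ) + 1) ^ 2)) :=
    (continuous_const.mul (continuous_bandDisc α)).continuousOn
  have hb : (-1) ^ i * bandDisc α (((i : ℝ) + 1) ^ 2) = -1 := by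
    rw [bandDisc_nat_sq, pow_succ, ← mul_assoc, neg_one_pow_mul_self]; ring
  obtain ⟨r, hr, hrd⟩ := intermediate_value_Ioo' ha.le hcont
    (show d ∈ Ioo _ _ from ⟨by rw [hb]; exact hd1, by linarith⟩)
  have hrI := hsub hr
  refine ⟨r, hrI, fun E hE => ?_⟩
  set c : ℝ := (-1) ^ i * d with hc
  have hcabs : |c| ≤ 1 := by rw [hc, abs_neg_one_pow_mul]; exact hd.le
  have key : ∀ x ∈ dirichletInterval i,
      (-1) ^ i * bandDisc α x - d = ((-1) ^ i * bandSin x) * (bandSlope c x + α / 4) := by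
    intro x hx
    rw [mul_assoc, ← bandDisc_eq α c hx, hc, mul_sub, ← mul_assoc, neg_one_pow_mul_self, one_mul]
  have hr0 : bandSlope c r + α / 4 = 0 := by
    have h1 := key r hrI
    simp only at hrd
    rw [hrd, sub_self] at h1
    exact (mul_eq_zero.1 h1.symm).resolve_left (bandSin_sign hrI).ne'
  have hq := bandSin_sign hE
  have hanti := strictAntiOn_bandSlope hcabs i
  have h1 := key E hE
  constructor
  · rw [← hanti.lt_iff_gt hrI hE, ← sub_pos, h1, mul_pos_iff_of_pos_left hq]
    constructor <;> intro h <;> linarith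
  · rw [← hanti.lt_iff_gt hE hrI, ← sub_neg, h1, ← neg_pos, ← mul_neg, mul_pos_iff_of_pos_left hq]
    constructor <;> intro h <;> linarith

/-! ### The discrete problem at weak coupling -/

theorem exists_abs_sub_le_of_contDiffOn {F : ℝ × ℝ → ℝ} {s : Set (ℝ × ℝ)} (hs : IsCompact s)
    (hc : Convex ℝ s) (hF : ContDiffOn ℝ 1 F s) :
    ∃ L ≥ 0, ∀ p ∈ s, ∀ p' ∈ s, |F p - F p'| ≤ L * (|p.1 - p'.1| + |p.2 - p'.2|) := by
  obtain ⟨K, hK⟩ := (hF.locallyLipschitzOn hc).exists_lipschitzOnWith_of_compact hs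
  refine ⟨K, K.2, fun p hp p' hp' => ?_⟩
  have h := hK.dist_le_mul p hp p' hp'
  rw [Real.dist_eq, Prod.dist_eq, Real.dist_eq, Real.dist_eq] at h
  exact h.trans (mul_le_mul_of_nonneg_left
    (max_le_add_of_nonneg (abs_nonneg _) (abs_nonneg _)) K.2)

theorem exists_abs_le_of_contDiffOn {F : ℝ × ℝ → ℝ} {s : Set (ℝ × ℝ)} (hs : IsCompact s)
    (hF : ContDiffOn ℝ 1 F s) : ∃ B ≥ 0, ∀ p ∈ s, |F p| ≤ B := by
  obtain ⟨B, hB⟩ := hs.exists_bound_of_continuousOn hF.continuousOn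
  exact ⟨max B 0, le_max_right _ _, fun p hp => (hB p hp).trans (le_max_left _ _)⟩

theorem contDiff_transfer (g : ℕ → ℝ) (n : ℕ) :
    ContDiff ℝ 1 (fun p : ℝ × ℝ => (transfer g p.1 p.2 n).1) ∧
      ContDiff ℝ 1 (fun p : ℝ × ℝ => (transfer g p.1 p.2 n).2) := by
  induction n with
  | zero => simp only [transfer]; constructor <;> fun_prop
  | succ n ih =>
    obtain ⟨h1, h2⟩ := ih
    simp only [transfer]
    constructor <;> fun_prop

/-- The weighted sum of the couplings with the decaying solution. -/
noncomputable def transferSum (g : ℕ → ℝ) (a t : ℝ) (n : ℕ) : ℝ :=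
  ∑ k ∈ Finset.range n, g (k + 1) * (transfer g a t k).1

theorem transfer_snd (g : ℕ → ℝ) (a t : ℝ) (n : ℕ) :
    (transfer g a t n).2 = 1 - a + t * transferSum g a t n := by
  induction n with
  | zero => simp [transfer, transferSum]
  | succ n ih =>
    rw [transfer, ih, transferSum, transferSum, Finset.sum_range_succ]; ring

theorem transfer_one_zero (g : ℕ → ℝ) (n : ℕ) : transfer g 1 0 n = (1, 0) := by
  induction n with
  | zero => simp [transfer]
  | succ n ih => rw [transfer, ih]; simp

theorem transferSum_one_zero (g : ℕ → ℝ) (n : ℕ) :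
    transferSum g 1 0 n = ∑ k ∈ Finset.range n, g (k + 1) := by
  simp [transferSum, transfer_one_zero]

/-- The secular function of the discrete problem. -/
noncomputable def secular (g : ℕ → ℝ) (m : ℕ) (l b : ℝ) : ℝ := (transfer g (l ^ 2) (b * l) m).2

theorem secular_eq (g : ℕ → ℝ) (m : ℕ) (l b : ℝ) :
    secular g m l b = 1 - l ^ 2 + b * l * transferSum g (l ^ 2) (b * l) m := by
  rw [secular, transfer_snd]

theorem continuous_secular (g : ℕ → ℝ) (m : ℕ) :
    Continuous fun p : ℝ × ℝ => secular g m p.1 p.2 := by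
  have h := (contDiff_transfer g m).2.continuous
  have h2 : Continuous fun p : ℝ × ℝ => ((p.1 ^ 2, p.2 * p.1) : ℝ × ℝ) := by fun_prop
  exact h.comp h2

theorem secular_zero_right (g : ℕ → ℝ) (m : ℕ) (l : ℝ) : secular g m l 0 = 1 - l ^ 2 := by
  simp [secular_eq]

theorem contDiff_transferSum_comp (g : ℕ → ℝ) (m : ℕ) :
    ContDiff ℝ 1 fun p : ℝ × ℝ => transferSum g (p.1 ^ 2) (p.2 * p.1) m := by
  unfold transferSum
  refine ContDiff.sum fun k _ => contDiff_const.mul ?_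
  have h2 : ContDiff ℝ 1 fun p : ℝ × ℝ => ((p.1 ^ 2, p.2 * p.1) : ℝ × ℝ) := by fun_prop
  exact (contDiff_transfer g k).1.comp h2

/-- The zeros of the secular function for weak coupling, in terms of `X = (l + 1 / l) / 2`. -/
theorem exists_secular_bounds (g : ℕ → ℝ) (m : ℕ) (hg : ∑ k ∈ Finset.range m, g (k + 1) < 0) :
    ∃ b₀ > 0, ∃ C ≥ 0, (∀ b ∈ Ioc 0 b₀, secular g m 1 b < 0) ∧
      (∀ l ∈ Ioo (0 : ℝ) 1, ∀ b ∈ Ioc 0 b₀, secular g m l b = 0 →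
        |(l + l⁻¹) / 2 - 1 - b ^ 2 * (∑ k ∈ Finset.range m, g (k + 1)) ^ 2 / 8| ≤ C * b ^ 3) ∧
      ∀ l ∈ Ioo (0 : ℝ) 1, ∀ b ∈ Ioc 0 b₀, secular g m l b = 0 →
        ∀ l' ∈ Ioo (0 : ℝ) 1, ∀ b' ∈ Ioc 0 b₀, secular g m l' b' = 0 →
        |((l + l⁻¹) / 2 - 1) / b - ((l' + l'⁻¹) / 2 - 1) / b'| ≤ C * |b - b'| := by
  set Q : Set (ℝ × ℝ) := Icc 0 1 ×ˢ Icc 0 1 with hQ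
  have hQc : IsCompact Q := isCompact_Icc.prod isCompact_Icc
  have hQv : Convex ℝ Q := (convex_Icc 0 1).prod (convex_Icc 0 1)
  set w : ℝ × ℝ → ℝ := fun p => transferSum g (p.1 ^ 2) (p.2 * p.1) m with hw
  have hwc : ContDiff ℝ 1 w := contDiff_transferSum_comp g m
  set S := ∑ k ∈ Finset.range m, g (k + 1) with hS
  have hw10 : w (1, 0) = S := by simp only [hw]; rw [zero_mul, one_pow, transferSum_one_zero]
  have hne : ∀ p ∈ Q, 1 + p.1 ≠ 0 := fun p hp => by have := hp.1.1; positivity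
  -- Dividing the secular equation by `1 + l` gives `1 - l = b ψ(l, b)`. Then `(l + l⁻¹) / 2 - 1 =
  -- (1 - l)² / (2 l) = b² H(l, b)`: the factor `l` in `ψ` cancels the pole at `l = 0`, so `H` is
  -- smooth on the closed square.
  set ψ : ℝ × ℝ → ℝ := fun p => -(p.1 * w p) / (1 + p.1) with hψ
  have hψc : ContDiffOn ℝ 1 ψ Q :=
    ContDiffOn.div (by fun_prop) (by fun_prop) hne
  set H : ℝ × ℝ → ℝ := fun p => p.1 * w p ^ 2 / (2 * (1 + p.1) ^ 2) with hH
  have hHc : ContDiffOn ℝ 1 H Q :=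
    ContDiffOn.div (by fun_prop) (by fun_prop) fun p hp => by have := hne p hp; positivity
  obtain ⟨L₁, hL₁, hψL⟩ := exists_abs_sub_le_of_contDiffOn hQc hQv hψc
  obtain ⟨B₁, hB₁, hψB⟩ := exists_abs_le_of_contDiffOn hQc hψc
  obtain ⟨L₂, hL₂, hHL⟩ := exists_abs_sub_le_of_contDiffOn hQc hQv hHc
  obtain ⟨B₂, hB₂, hHB⟩ := exists_abs_le_of_contDiffOn hQc hHc
  obtain ⟨δ, hδ, hδneg⟩ : ∃ δ > 0, ∀ b ∈ Ioc 0 δ, w (1, b) < 0 := by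
    have hc : ContinuousAt (fun b : ℝ => w (1, b)) 0 :=
      (hwc.continuous.comp (by fun_prop)).continuousAt
    have h2 := hc.eventually (gt_mem_nhds (show w (1, 0) < 0 by rw [hw10]; exact hg))
    obtain ⟨δ, hδ, h3⟩ := Metric.eventually_nhds_iff.1 h2
    refine ⟨δ / 2, by positivity, fun b hb => h3 ?_⟩
    rw [Real.dist_eq, sub_zero, abs_of_pos hb.1]
    have := hb.2; linarith
  -- The bounds keep `w (1, b)` negative, keep `(l, b)` in the square `Q`, and give `b * L₁ ≤ 1 /
  -- 2`, so that the dependence of `ψ` on `l` can be absorbed.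
  set b₀ : ℝ := min δ (min 1 (1 / (2 * (L₁ + 1)))) with hb₀
  have hb₀pos : 0 < b₀ := by simp only [hb₀, lt_min_iff]; refine ⟨hδ, one_pos, by positivity⟩
  have hb1 : ∀ b ∈ Ioc 0 b₀, b ≤ 1 := fun b hb =>
    hb.2.trans ((min_le_right _ _).trans (min_le_left _ _))
  have hbL : ∀ b ∈ Ioc 0 b₀, b * L₁ ≤ 1 / 2 := fun b hb => by
    have h1 : b ≤ 1 / (2 * (L₁ + 1)) := hb.2.trans ((min_le_right _ _).trans (min_le_right _ _))
    rw [le_div_iff₀ (by positivity)] at h1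
    nlinarith [hb.1]
  have hmem : ∀ l ∈ Ioo (0 : ℝ) 1, ∀ b ∈ Ioc 0 b₀, (l, b) ∈ Q := fun l hl b hb =>
    ⟨⟨hl.1.le, hl.2.le⟩, ⟨hb.1.le, hb1 b hb⟩⟩
  have hzero : ∀ l ∈ Ioo (0 : ℝ) 1, ∀ b, secular g m l b = 0 → 1 - l = b * ψ (l, b) := by
    intro l hl b h
    rw [secular_eq] at h
    have h1 : 1 + l ≠ 0 := by have := hl.1; positivity
    simp only [hψ, hw]
    generalize transferSum g (l ^ 2) (b * l) m = T at h ⊢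
    field_simp
    linarith
  have hX : ∀ l ∈ Ioo (0 : ℝ) 1, ∀ b, secular g m l b = 0 →
      (l + l⁻¹) / 2 - 1 = b ^ 2 * H (l, b) := by
    intro l hl b h
    have h1 : l ≠ 0 := hl.1.ne'
    have h3 : 1 + l ≠ 0 := by have := hl.1; positivity
    have e1 : (l + l⁻¹) / 2 - 1 = (1 - l) ^ 2 / (2 * l) := by field_simp; ring
    rw [e1, hzero l hl b h]
    simp only [hψ, hH]
    field_simp
  refine ⟨b₀, hb₀pos, max (L₂ * (B₁ + 1)) (B₂ + L₂ * (2 * (B₁ + L₁) + 1)),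
    le_max_of_le_left (by positivity), ?_, ?_, ?_⟩
  · intro b hb
    have := hδneg b ⟨hb.1, hb.2.trans (min_le_left _ _)⟩
    simp only [hw] at this
    rw [secular_eq]
    have hb0 := hb.1
    nlinarith
  · intro l hl b hb h
    have h10 : ((1 : ℝ), (0 : ℝ)) ∈ Q := ⟨⟨zero_le_one, le_rfl⟩, ⟨le_rfl, zero_le_one⟩⟩
    have hH10 : H (1, 0) = S ^ 2 / 8 := by simp only [hH, hw10]; ring
    have h1 := hHL _ (hmem l hl b hb) _ h10
    have h2 := hψB _ (hmem l hl b hb)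
    have h3 := hzero l hl b h
    rw [hX l hl b h, mul_div_assoc, ← hH10, ← mul_sub, abs_mul, abs_of_nonneg (sq_nonneg b)]
    have h4 : |l - 1| ≤ b * B₁ := by
      rw [abs_sub_comm, h3, abs_mul, abs_of_pos hb.1]
      exact mul_le_mul_of_nonneg_left h2 hb.1.le
    simp only [sub_zero, abs_of_pos hb.1] at h1
    have h5 : |H (l, b) - H (1, 0)| ≤ L₂ * (B₁ + 1) * b :=
      h1.trans (by nlinarith)
    calc b ^ 2 * |H (l, b) - H (1, 0)| ≤ b ^ 2 * (L₂ * (B₁ + 1) * b) := by gcongr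
      _ = L₂ * (B₁ + 1) * b ^ 3 := by ring
      _ ≤ _ := by
        have := hb.1
        gcongr
        exact le_max_left _ _
  · intro l hl b hb h l' hl' b' hb' h'
    have h1 := hzero l hl b h
    have h2 := hzero l' hl' b' h'
    have h3 := hψB _ (hmem l hl b hb)
    have h4 := hψL _ (hmem l hl b hb) _ (hmem l' hl' b' hb')
    simp only at h4
    have hd0 := abs_nonneg (b - b')
    have hl0 := abs_nonneg (l - l')
    have h5 : |l - l'| ≤ |b - b'| * B₁ + b' * (L₁ * (|l - l'| + |b - b'|)) := by
      have e : l - l' = -((b - b') * ψ (l, b) + b' * (ψ (l, b) - ψ (l', b'))) := by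
        linear_combination h2 - h1
      calc |l - l'| = |(b - b') * ψ (l, b) + b' * (ψ (l, b) - ψ (l', b'))| := by
            rw [e, abs_neg]
        _ ≤ |b - b'| * |ψ (l, b)| + |b'| * |ψ (l, b) - ψ (l', b')| := by
            rw [← abs_mul, ← abs_mul]; exact abs_add_le _ _
        _ ≤ _ := by
            rw [abs_of_pos hb'.1]
            have := hb'.1.le
            gcongr
    -- Absorbing half of `|l - l'|` on the left shows that zeros of the secular function depend on
    -- `b` in a Lipschitz way.
    have h6 : |l - l'| ≤ 2 * (B₁ + L₁) * |b - b'| := by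
      have hh := hbL b' hb'
      have hh1 := hb1 b' hb'
      have e1 : b' * L₁ * |l - l'| ≤ 1 / 2 * |l - l'| := by gcongr
      have e2 : b' * (L₁ * |b - b'|) ≤ 1 * (L₁ * |b - b'|) := by gcongr
      linarith
    have h7 := hHL _ (hmem l hl b hb) _ (hmem l' hl' b' hb')
    have h8 := hHB _ (hmem l hl b hb)
    simp only at h7
    have e3 : ∀ b : ℝ, b ≠ 0 → ∀ x : ℝ, b ^ 2 * x / b = b * x := fun b hb x => by field_simp
    rw [hX l hl b h, hX l' hl' b' h', e3 b hb.1.ne', e3 b' hb'.1.ne']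
    have e : b * H (l, b) - b' * H (l', b') =
        (b - b') * H (l, b) + b' * (H (l, b) - H (l', b')) := by ring
    calc |b * H (l, b) - b' * H (l', b')| ≤
          |b - b'| * |H (l, b)| + |b'| * |H (l, b) - H (l', b')| := by
            rw [e, ← abs_mul, ← abs_mul]; exact abs_add_le _ _
      _ ≤ |b - b'| * B₂ + 1 * (L₂ * (2 * (B₁ + L₁) * |b - b'| + |b - b'|)) := by
            rw [abs_of_pos hb'.1]
            have hb1' := hb1 b' hb'
            have hx := h7.trans (mul_le_mul_of_nonneg_left (by linarith : |l - l'| + |b - b'| ≤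
              2 * (B₁ + L₁) * |b - b'| + |b - b'|) hL₂)
            exact add_le_add (mul_le_mul_of_nonneg_left h8 hd0)
              (mul_le_mul hb1' hx (abs_nonneg _) zero_le_one)
      _ = (B₂ + L₂ * (2 * (B₁ + L₁) + 1)) * |b - b'| := by ring
      _ ≤ _ := by gcongr; exact le_max_right _ _

/-! ### Eigenvalues in the gaps -/

/-- The solution `0 < l ≤ 1` of `l + 1 / l = 2 X`. -/
noncomputable def decayRate (X : ℝ) : ℝ := X - √(X ^ 2 - 1)

theorem continuous_decayRate : Continuous decayRate := by unfold decayRate; fun_prop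

theorem decayRate_one : decayRate 1 = 1 := by simp [decayRate]

theorem decayRate_spec {X : ℝ} (h : 1 < X) :
    decayRate X ∈ Ioo (0 : ℝ) 1 ∧ decayRate X + (decayRate X)⁻¹ = 2 * X := by
  have h0 : 0 < X ^ 2 - 1 := by nlinarith
  have h1 := Real.sq_sqrt h0.le
  have h2 := Real.sqrt_pos.2 h0
  have hprod : decayRate X * (X + √(X ^ 2 - 1)) = 1 := by rw [decayRate]; nlinarith
  have hpos : 0 < decayRate X := by
    by_contra hcon
    push Not at hcon
    nlinarith
  refine ⟨⟨hpos, ?_⟩, ?_⟩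
  · have : X - 1 < √(X ^ 2 - 1) := by
      apply Real.lt_sqrt_of_sq_lt; nlinarith
    rw [decayRate]; linarith
  · rw [inv_eq_of_mul_eq_one_right hprod, decayRate]; ring

/-- The gap in the interval number `i` on the side given by the sign `ν`; the number `c` is
`|cos Aπ|`. -/
def gapRegion (α c ν : ℝ) (i : ℕ) : Set ℝ :=
  {E | E ∈ dirichletInterval i ∧ c < ν * ((-1) ^ i * bandDisc α E)}

theorem bandXi_eq (A α E : ℝ) : bandXi A α E = bandDisc α E / Real.cos (A * Real.pi) := rfl

theorem secular_of_sign {ν : ℝ} (hν : ν = 1 ∨ ν = -1) (g : ℕ → ℝ) (m : ℕ) (l b : ℝ) :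
    secular (fun n => ν * g n) m l b = (transfer g (l ^ 2) (ν * (b * l)) m).2 := by
  rcases hν with rfl | rfl
  · simp [secular]
  · simp only [secular, neg_one_mul]; rw [transfer_neg]

/-! ### Existence and uniqueness of the eigenvalues, uniformly over all gaps -/

section Gaps

variable {A α E ν ε : ℝ} {m i : ℕ} {γ : ℤ → ℝ}

/-- All gaps are brought to one normal form. The sign of `ξ` is the product `τ` of `ν`, `(-1) ^ i`
and the sign of `cos(Aπ)`, so `lam = τ l` with `l` in `(0, 1)`. The secular function only sees `lam
^ 2 = l ^ 2` and `b * lam`, where all signs cancel except for `ν`, which is moved to the couplings.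
-/
theorem isOpEigenvalue_iff_secular (hc : Real.cos (A * Real.pi) ≠ 0) (hν : ν = 1 ∨ ν = -1)
    (hE : E ∈ gapRegion α |Real.cos (A * Real.pi)| ν i) :
    (IsOpEigenvalue (chainLaplacian A (perturbedCoupling α m γ ε)) E ↔
      secular (fun n => ν * γ n) m
        (decayRate (ν * ((-1) ^ i * bandDisc α E) / |Real.cos (A * Real.pi)|))
        (ε * ((-1) ^ i * bandSin E) / (2 * |Real.cos (A * Real.pi)|)) = 0) ∧
    (IsOpEigenvalue (chainLaplacian A (perturbedCoupling α m γ ε)) E →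
      IsSimpleOpEigenvalue (chainLaplacian A (perturbedCoupling α m γ ε)) E) := by
  obtain ⟨hEI, hEc⟩ := hE
  have hS := bandSin_ne_zero hEI
  have hc0 : 0 < |Real.cos (A * Real.pi)| := abs_pos.2 hc
  set c₀ := |Real.cos (A * Real.pi)| with hc₀
  obtain ⟨κ, hκ2, hκ⟩ : ∃ κ : ℝ, κ * κ = 1 ∧ Real.cos (A * Real.pi) = κ * c₀ := by
    rcases abs_choice (Real.cos (A * Real.pi)) with h | h
    · exact ⟨1, by norm_num, by rw [hc₀, h, one_mul]⟩
    · exact ⟨-1, by norm_num, by rw [hc₀, h]; ring⟩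
  have hν2 : ν * ν = 1 := by rcases hν with rfl | rfl <;> norm_num
  have hσ2 := neg_one_pow_mul_self i
  set σ : ℝ := (-1) ^ i
  set X := ν * (σ * bandDisc α E) / c₀ with hX
  have hX1 : 1 < X := (one_lt_div hc0).2 hEc
  obtain ⟨⟨hl0, hl1⟩, hl⟩ := decayRate_spec hX1
  set l := decayRate X
  set τ := ν * σ * κ with hτ
  have hτ2 : τ * τ = 1 := by
    linear_combination (ν * ν * σ * σ) * hκ2 + (ν * ν) * hσ2 + hν2
  have hκ0 : κ ≠ 0 := left_ne_zero_of_mul_eq_one hκ2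
  have hτ0 : τ ≠ 0 := left_ne_zero_of_mul_eq_one hτ2
  have hτabs : |τ| = 1 := by
    have h1 : |τ| * |τ| = 1 := by rw [← abs_mul, hτ2, abs_one]
    nlinarith [abs_nonneg τ]
  have hlam0 : τ * l ≠ 0 := mul_ne_zero hτ0 hl0.ne'
  have hlam1 : |τ * l| < 1 := by rw [abs_mul, hτabs, one_mul, abs_of_pos hl0]; exact hl1
  have hlam : τ * l + (τ * l)⁻¹ = 2 * bandXi A α E := by
    rw [mul_inv, inv_eq_of_mul_eq_one_right hτ2, ← mul_add, hl, hX, bandXi_eq, hκ]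
    field_simp
    rw [hτ]
    linear_combination (bandDisc α E * (ν * ν * σ * σ)) * hκ2 +
      (bandDisc α E * (ν * ν)) * hσ2 + bandDisc α E * hν2
  have e1 : (τ * l) ^ 2 = l ^ 2 := by linear_combination l ^ 2 * hτ2
  have e2 : ε * bandSin E / (2 * Real.cos (A * Real.pi)) * (τ * l) =
      ν * (ε * (σ * bandSin E) / (2 * c₀) * l) := by
    rw [hκ, hτ]; field_simp
  refine ⟨?_, IsOpEigenvalue.simple hc hS hlam0 hlam1 hlam⟩
  rw [isOpEigenvalue_iff_transfer hc hS hlam0 hlam1 hlam, secular_of_sign hν, e1, e2]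

/-- At negative energies the discriminant is at least `bandSin E * (√(-E) - |α| / 4)` and `bandSin E
> 1`, so the assumed bound limits `√(-E)`. -/
theorem neg_sq_le_of_bandDisc_le {G : ℝ}
    (h : E < 0 → bandDisc α E ≤ 1 + bandSin E * G) : -(G + |α| / 4 + 1) ^ 2 ≤ E := by
  by_contra hcon
  push Not at hcon
  have hα := abs_nonneg α
  have hE : E < 0 := hcon.trans_le (by nlinarith)
  have h1 := h hE
  have h2 := bandSin_mul_le_bandDisc α hE
  have h3 := pi_lt_bandSin hE
  have h4 : G + |α| / 4 + 1 < √(-E) := Real.lt_sqrt_of_sq_lt (by linarith)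
  have := Real.pi_gt_three
  nlinarith

theorem exists_abs_bandSin_le (R : ℝ) : ∃ M > 0, ∀ E, -R ≤ E → |bandSin E| ≤ M := by
  obtain ⟨B, hB⟩ := (isCompact_Icc (a := -R) (b := 0)).exists_bound_of_continuousOn
    continuous_bandSin.continuousOn
  refine ⟨max B Real.pi, lt_max_of_lt_right Real.pi_pos, fun E hE => ?_⟩
  rcases le_or_gt E 0 with h | h
  · exact (hB E ⟨hE, h⟩).trans (le_max_left _ _)
  · exact (abs_bandSin_lt_pi h).le.trans (le_max_right _ _)

/-- The lowest gap is unbounded and `bandSin` grows at `-∞`. The a priori bound on `ξ` confines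
eigenvalues to a half-line independent of `ε`, where `bandSin` is bounded. -/
theorem eigenvalue_lower_bound (hc : Real.cos (A * Real.pi) ≠ 0)
    (hν : ν = 1 ∨ ν = -1) (hE : E ∈ gapRegion α |Real.cos (A * Real.pi)| ν i) {Γ : ℝ}
    (hΓ : ∀ j ∈ Finset.Icc (1 : ℤ) m, |γ j| ≤ Γ) (hΓ0 : 0 ≤ Γ) (hε : ε ∈ Ioo (0 : ℝ) 1)
    (h : IsOpEigenvalue (chainLaplacian A (perturbedCoupling α m γ ε)) E) :
    -(Γ / 4 + |α| / 4 + 1) ^ 2 ≤ E := by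
  refine neg_sq_le_of_bandDisc_le (G := Γ / 4) fun hE0 => ?_
  have hc0 : 0 < |Real.cos (A * Real.pi)| := abs_pos.2 hc
  have hS := pi_lt_bandSin hE0
  have hpi := Real.pi_pos
  have hdisc : |Real.cos (A * Real.pi)| < |bandDisc α E| := by
    refine hE.2.trans_le ((le_abs_self _).trans_eq ?_)
    rw [abs_mul, abs_neg_one_pow_mul]
    rcases hν with rfl | rfl <;> simp
  have h1 := h.abs_bandXi_le hc (by linarith) (by
    rw [bandXi_eq, abs_div, one_lt_div hc0]; exact hdisc) hΓ hΓ0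
  have hcos := Real.abs_cos_le_one (A * Real.pi)
  rw [bandXi_eq, abs_div, abs_div, abs_mul, abs_mul, abs_of_pos hε.1, abs_two,
    abs_of_pos (show 0 < bandSin E by linarith)] at h1
  have h2 : |bandDisc α E| ≤ |Real.cos (A * Real.pi)| + ε * bandSin E * Γ / 4 := by
    field_simp at h1
    linarith
  have h3 : ε * bandSin E * Γ / 4 ≤ bandSin E * (Γ / 4) := by
    have : ε * (bandSin E * Γ) ≤ 1 * (bandSin E * Γ) := by
      have := hε.2.le
      have : 0 ≤ bandSin E * Γ := mul_nonneg (by linarith) hΓ0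
      gcongr
    linarith
  linarith [le_abs_self (bandDisc α E)]

theorem bandDisc_bandEdge (α : ℝ) (i : ℕ) {d r : ℝ} (hr : r ∈ dirichletInterval i)
    (h : ∀ E ∈ dirichletInterval i,
      (d < (-1) ^ i * bandDisc α E ↔ E < r) ∧ ((-1) ^ i * bandDisc α E < d ↔ r < E)) :
    (-1) ^ i * bandDisc α r = d :=
  le_antisymm (not_lt.1 fun h1 => lt_irrefl _ ((h r hr).1.1 h1))
    (not_lt.1 fun h1 => lt_irrefl _ ((h r hr).2.1 h1))

theorem exists_mem_Ioo_eq_zero {D : ℝ → ℝ} (hD : Continuous D) {x y : ℝ} {s : Set ℝ}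
    (hsub : (x < y ∧ Ioo x y ⊆ s) ∨ (y < x ∧ Ioo y x ⊆ s)) (hx : 0 < D x) (hy : D y < 0) :
    ∃ z ∈ s, D z = 0 := by
  rcases hsub with ⟨hxy, hsub⟩ | ⟨hxy, hsub⟩
  · obtain ⟨z, hz, h⟩ := intermediate_value_Ioo' hxy.le hD.continuousOn ⟨hy, hx⟩
    exact ⟨z, hsub hz, h⟩
  · obtain ⟨z, hz, h⟩ := intermediate_value_Ioo hxy.le hD.continuousOn ⟨hy, hx⟩
    exact ⟨z, hsub hz, h⟩

set_option maxHeartbeats 1000000 in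
/-- The eigenvalues in all the gaps of one parity, for weak coupling. -/
theorem exists_gap_eigenvalues (hc : Real.cos (A * Real.pi) ≠ 0)
    (hc1 : |Real.cos (A * Real.pi)| < 1) (hν : ν = 1 ∨ ν = -1)
    (hs : ∑ k ∈ Finset.range m, ν * γ ((k + 1 : ℕ) : ℤ) < 0) :
    ∃ ε₀ > 0, ∃ C ≥ 0, ∀ ε ∈ Ioo 0 ε₀, ∀ i : ℕ,
      (∃ E ∈ gapRegion α |Real.cos (A * Real.pi)| ν i,
        IsSimpleOpEigenvalue (chainLaplacian A (perturbedCoupling α m γ ε)) E ∧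
        ∀ E' ∈ gapRegion α |Real.cos (A * Real.pi)| ν i,
          IsOpEigenvalue (chainLaplacian A (perturbedCoupling α m γ ε)) E' → E' = E) ∧
      ∀ E ∈ gapRegion α |Real.cos (A * Real.pi)| ν i,
        IsOpEigenvalue (chainLaplacian A (perturbedCoupling α m γ ε)) E →
        |ν * ((-1) ^ i * bandDisc α E) - |Real.cos (A * Real.pi)| -
          ε ^ 2 * bandSin E ^ 2 * (∑ k ∈ Finset.range m, γ ((k + 1 : ℕ) : ℤ)) ^ 2 /
            (32 * |Real.cos (A * Real.pi)|)| ≤ C * ε ^ 3 ∧ |bandSin E| ≤ C := by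
  have hc0 : 0 < |Real.cos (A * Real.pi)| := abs_pos.2 hc
  set c₀ := |Real.cos (A * Real.pi)| with hc₀
  have hν2 : ν * ν = 1 := by rcases hν with rfl | rfl <;> norm_num
  have hνabs : |ν| = 1 := by rcases hν with rfl | rfl <;> simp
  set g : ℕ → ℝ := fun n => ν * γ n with hg
  obtain ⟨b₀, hb₀, C, hC, hneg, hasym, hlip⟩ := exists_secular_bounds g m hs
  set Γ : ℝ := ∑ j ∈ Finset.Icc (1 : ℤ) m, |γ j| with hΓdef
  have hΓ0 : 0 ≤ Γ := Finset.sum_nonneg fun j _ => abs_nonneg _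
  have hΓ : ∀ j ∈ Finset.Icc (1 : ℤ) m, |γ j| ≤ Γ := fun j hj =>
    Finset.single_le_sum (f := fun j => |γ j|) (fun j _ => abs_nonneg _) hj
  obtain ⟨M, hM, hMle⟩ := exists_abs_bandSin_le ((Γ / 4 + |α| / 4 + 1) ^ 2)
  -- The unbounded gap has no zero of `bandSin` at its left end. The fixed energy `r₀ - 1` inside it
  -- plays this role, and positivity of the secular function there is ensured by small `ε`.
  obtain ⟨r₀, hr₀, hr₀E⟩ := exists_bandEdge α 0 (d := c₀) (by rwa [abs_of_pos hc0])
  -- the far end of the unbounded gap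
  obtain ⟨δ, hδ, hfar⟩ : ∃ δ > 0, ∀ ε ∈ Ioo 0 δ,
      0 < secular g m (decayRate (bandDisc α (r₀ - 1) / c₀))
        (ε * bandSin (r₀ - 1) / (2 * c₀)) := by
    have hmem : r₀ - 1 ∈ dirichletInterval 0 := ⟨Or.inl rfl, by linarith [hr₀.2]⟩
    have h1 := ((hr₀E _ hmem).1.2 (by linarith))
    rw [pow_zero, one_mul] at h1
    obtain ⟨⟨hl0, hl1⟩, -⟩ := decayRate_spec ((one_lt_div hc0).2 h1)
    set l := decayRate (bandDisc α (r₀ - 1) / c₀)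
    have hcont : Continuous fun ε : ℝ => secular g m l (ε * bandSin (r₀ - 1) / (2 * c₀)) := by
      have h2 : Continuous fun ε : ℝ => ((l, ε * bandSin (r₀ - 1) / (2 * c₀)) : ℝ × ℝ) := by fun_prop
      exact (continuous_secular g m).comp h2
    have h3 := hcont.continuousAt.eventually (lt_mem_nhds (a := 0) (show 0 <
      secular g m l (0 * bandSin (r₀ - 1) / (2 * c₀)) by
        rw [zero_mul, zero_div, secular_zero_right]; nlinarith))
    obtain ⟨δ, hδ, h4⟩ := Metric.eventually_nhds_iff.1 h3
    exact ⟨δ, hδ, fun ε hε => h4 (by rw [Real.dist_eq, sub_zero, abs_of_pos hε.1]; exact hε.2)⟩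
  have hK0 : 0 ≤ C * M ^ 2 / (4 * c₀ * (1 - c₀)) := by
    have : 0 < 1 - c₀ := by linarith
    positivity
  set K := C * M ^ 2 / (4 * c₀ * (1 - c₀)) with hK
  -- In this order: the a priori bound requires `ε < 1`, `δ` serves the unbounded gap, the third
  -- bound keeps `b` below `b₀`, and the last one makes the contraction factor `ε ^ 2 * K` smaller
  -- than 1.
  refine ⟨min (min 1 δ) (min (2 * c₀ * b₀ / M) (1 / (K + 1))), by
    simp only [lt_min_iff]; exact ⟨⟨one_pos, hδ⟩, by positivity, by positivity⟩,
    max (C * M ^ 3 / (8 * c₀ ^ 2)) M, by positivity, fun ε hε i => ?_⟩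
  obtain ⟨hε0, hεlt⟩ := hε
  simp only [lt_min_iff] at hεlt
  obtain ⟨⟨hε1, hεδ⟩, hεb, hεK⟩ := hεlt
  have hσ2 := neg_one_pow_mul_self i
  set T := chainLaplacian A (perturbedCoupling α m γ ε) with hT
  set b : ℝ → ℝ := fun E => ε * ((-1) ^ i * bandSin E) / (2 * c₀) with hb
  set X : ℝ → ℝ := fun E => ν * ((-1) ^ i * bandDisc α E) / c₀ with hX
  have hbcont : Continuous b := by
    have := continuous_bandSin
    simp only [hb]; fun_prop
  have hXcont : Continuous X := by
    have := continuous_bandDisc α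
    simp only [hX]; fun_prop
  have hbIoc : ∀ E ∈ dirichletInterval i, -(Γ / 4 + |α| / 4 + 1) ^ 2 ≤ E →
      b E ∈ Ioc 0 b₀ ∧ b E ≤ ε * M / (2 * c₀) := by
    intro E hE hlow
    have h1 := bandSin_sign hE
    have h2 : (-1) ^ i * bandSin E ≤ M := by
      have := hMle E hlow
      rw [← abs_neg_one_pow_mul i] at this
      exact (le_abs_self _).trans this
    have h3 : b E ≤ ε * M / (2 * c₀) := by simp only [hb]; gcongr
    refine ⟨⟨by simp only [hb]; positivity, h3.trans ?_⟩, h3⟩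
    rw [div_le_iff₀ (by positivity)]
    rw [lt_div_iff₀ hM] at hεb
    linarith
  have hiff : ∀ E ∈ gapRegion α c₀ ν i, (IsOpEigenvalue T E ↔
      secular g m (decayRate (X E)) (b E) = 0) ∧ (IsOpEigenvalue T E → IsSimpleOpEigenvalue T E) :=
    fun E hE => isOpEigenvalue_iff_secular hc hν hE
  have hspec : ∀ E ∈ gapRegion α c₀ ν i, decayRate (X E) ∈ Ioo (0 : ℝ) 1 ∧
      decayRate (X E) + (decayRate (X E))⁻¹ = 2 * X E := fun E hE =>
    decayRate_spec ((one_lt_div hc0).2 hE.2)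
  have hlow : ∀ E ∈ gapRegion α c₀ ν i, IsOpEigenvalue T E →
      -(Γ / 4 + |α| / 4 + 1) ^ 2 ≤ E := fun E hE h =>
    eigenvalue_lower_bound hc hν hE hΓ hΓ0 ⟨hε0, hε1⟩ h
  refine ⟨?_, ?_⟩
  · -- existence
    have hex : ∃ E ∈ gapRegion α c₀ ν i, IsOpEigenvalue T E := by
      have hcabs : |ν * c₀| < 1 := by rw [abs_mul, hνabs, one_mul, abs_of_pos hc0]; exact hc1
      obtain ⟨r, hr, hrE⟩ := exists_bandEdge α i hcabs
      have hrd := bandDisc_bandEdge α i hr hrE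
      have hXr : X r = 1 := by
        simp only [hX]; rw [hrd, ← mul_assoc, hν2, one_mul, div_self hc0.ne']
      have hrlow : -(Γ / 4 + |α| / 4 + 1) ^ 2 ≤ r := by
        refine neg_sq_le_of_bandDisc_le (G := Γ / 4) fun h0 => ?_
        have h1 : |bandDisc α r| < 1 := by rw [← abs_neg_one_pow_mul i, hrd]; exact hcabs
        have h2 : 0 ≤ bandSin r * (Γ / 4) :=
          mul_nonneg (Real.pi_pos.trans (pi_lt_bandSin h0)).le (by positivity)
        linarith [le_abs_self (bandDisc α r)]
      -- At the band edge `l = 1`, and this is where the sign of the sum of the couplings enters.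
      have hDr : secular g m (decayRate (X r)) (b r) < 0 := by
        rw [hXr, decayRate_one]; exact hneg _ (hbIoc r hr hrlow).1
      have hDcont : Continuous fun E => secular g m (decayRate (X E)) (b E) :=
        (continuous_secular g m).comp ((continuous_decayRate.comp hXcont).prodMk hbcont)
      -- At a zero of `bandSin` the effective coupling `b` vanishes, so the secular function is `1 -
      -- l ^ 2 > 0`.
      have hDfar : ∀ x, bandSin x = 0 → ν * ((-1) ^ i * bandDisc α x) = 1 →
          0 < secular g m (decayRate (X x)) (b x) := by
        intro x h1 h2
        have h3 : b x = 0 := by simp only [hb]; rw [h1]; ring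
        have h4 : 1 < X x := by simp only [hX]; rw [h2, one_lt_div hc0]; exact hc1
        obtain ⟨⟨h5, h6⟩, -⟩ := decayRate_spec h4
        rw [h3, secular_zero_right]
        nlinarith
      suffices h : ∃ x, ((x < r ∧ Ioo x r ⊆ gapRegion α c₀ ν i) ∨
          (r < x ∧ Ioo r x ⊆ gapRegion α c₀ ν i)) ∧ 0 < secular g m (decayRate (X x)) (b x) by
        obtain ⟨x, hsub, hx⟩ := h
        obtain ⟨E, hE, h0⟩ := exists_mem_Ioo_eq_zero hDcont hsub hx hDr
        exact ⟨E, hE, (hiff E hE).1.2 h0⟩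
      rcases hν with rfl | rfl
      · rcases Nat.eq_zero_or_pos i with rfl | hi
        · have hrr : r = r₀ := by
            refine le_antisymm (not_lt.1 fun h => ?_) (not_lt.1 fun h => ?_)
            · have := (hrE r₀ hr₀).1.2 h
              rw [bandDisc_bandEdge α 0 hr₀ hr₀E, one_mul] at this
              exact lt_irrefl _ this
            · have := (hr₀E r hr).1.2 h
              rw [hrd, one_mul] at this
              exact lt_irrefl _ this
          refine ⟨r₀ - 1, Or.inl ⟨by linarith, fun E hE => ?_⟩, ?_⟩
          · have hEI : E ∈ dirichletInterval 0 := ⟨Or.inl rfl, hE.2.trans hr.2⟩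
            refine ⟨hEI, ?_⟩
            have := (hrE E hEI).1.2 hE.2
            linarith
          · have := hfar ε ⟨hε0, hεδ⟩
            simp only [hX, hb, pow_zero, one_mul]
            exact this
        · have hri := hr.1.resolve_left (by omega)
          obtain ⟨k, rfl⟩ : ∃ k, i = k + 1 := ⟨i - 1, by omega⟩
          have hcast : ((k + 1 : ℕ) : ℝ) = (k : ℝ) + 1 := by push_cast; ring
          rw [hcast] at hri
          refine ⟨((k : ℝ) + 1) ^ 2, Or.inl ⟨hri, fun E hE => ?_⟩, hDfar _ (bandSin_nat_sq k) ?_⟩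
          · have hEI : E ∈ dirichletInterval (k + 1) :=
              ⟨Or.inr (by rw [hcast]; exact hE.1), hE.2.trans hr.2⟩
            refine ⟨hEI, ?_⟩
            have := (hrE E hEI).1.2 hE.2
            linarith
          · rw [bandDisc_nat_sq, hσ2, one_mul]
      · refine ⟨((i : ℝ) + 1) ^ 2, Or.inr ⟨hr.2, fun E hE => ?_⟩, hDfar _ (bandSin_nat_sq i) ?_⟩
        · have hEI : E ∈ dirichletInterval i := ⟨hr.1.imp_right fun h => h.trans hE.1, hE.2⟩
          refine ⟨hEI, ?_⟩
          have := (hrE E hEI).2.2 hE.1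
          linarith
        · rw [bandDisc_nat_sq, pow_succ]; linear_combination hσ2
    -- uniqueness
    obtain ⟨E, hE, hEv⟩ := hex
    refine ⟨E, hE, (hiff E hE).2 hEv, fun E' hE' hEv' => ?_⟩
    have hz := (hiff E hE).1.1 hEv
    have hz' := (hiff E' hE').1.1 hEv'
    obtain ⟨hl, hlX⟩ := hspec E hE
    obtain ⟨hl', hlX'⟩ := hspec E' hE'
    have hbE := (hbIoc E hE.1 (hlow E hE hEv)).1
    have hbE' := (hbIoc E' hE'.1 (hlow E' hE' hEv')).1
    have h1 := hlip _ hl _ hbE hz _ hl' _ hbE' hz'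
    rw [hlX, hlX'] at h1
    set c := ν * ((-1) ^ i * c₀) with hcdef
    have hcabs : |c| = c₀ := by
      rw [hcdef, abs_mul, hνabs, abs_neg_one_pow_mul, one_mul, abs_of_pos hc0]
    -- The quantity that is Lipschitz in `b` along the zeros is an affine function of the monotone
    -- slope at the edge level `c`, with the large factor `2 / ε`.
    have hslope : ∀ E ∈ gapRegion α c₀ ν i,
        (2 * X E / 2 - 1) / b E = 2 / ε * (ν * (bandSlope c E + α / 4)) := by
      intro E hE
      have h2 := bandDisc_eq α c hE.1
      have h3 := bandSin_sign hE.1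
      have h4 : ν * ((-1) ^ i * bandDisc α E) - c₀ =
          ((-1) ^ i * bandSin E) * (ν * (bandSlope c E + α / 4)) := by
        have h5 : ν * ((-1) ^ i * (bandDisc α E - c)) = ν * ((-1) ^ i * bandDisc α E) - c₀ := by
          rw [hcdef]
          linear_combination (-(ν * ν) * c₀) * hσ2 - c₀ * hν2
        rw [← h5, h2]; ring
      have h6 : X E - 1 = ((-1) ^ i * bandSin E) * (ν * (bandSlope c E + α / 4)) / c₀ := by
        rw [← h4]; simp only [hX]; field_simp
      rw [mul_div_cancel_left₀ _ two_ne_zero, h6]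
      simp only [hb]
      generalize (-1) ^ i * bandSin E = q at *
      field_simp
    rw [hslope E hE, hslope E' hE'] at h1
    have h2 := abs_inv_bandSin_sub_le (c := c) (by rw [hcabs]; exact hc1) hE.1 hE'.1
    rw [hcabs] at h2
    have hqE := bandSin_sign hE.1
    have hqE' := bandSin_sign hE'.1
    have hSE := hMle E (hlow E hE hEv)
    have hSE' := hMle E' (hlow E' hE' hEv')
    have hSne := bandSin_ne_zero hE.1
    have hSne' := bandSin_ne_zero hE'.1
    set x := |bandSlope c E - bandSlope c E'| with hx
    have h3 : |2 / ε * (ν * (bandSlope c E + α / 4)) - 2 / ε * (ν * (bandSlope c E' + α / 4))| =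
        2 / ε * x := by
      rw [show 2 / ε * (ν * (bandSlope c E + α / 4)) - 2 / ε * (ν * (bandSlope c E' + α / 4)) =
        2 / ε * (ν * (bandSlope c E - bandSlope c E')) by ring, abs_mul, abs_mul, hνabs, one_mul,
        abs_of_pos (by positivity)]
    have h4 : |b E - b E'| = ε / (2 * c₀) * |bandSin E - bandSin E'| := by
      simp only [hb]
      rw [show ε * ((-1) ^ i * bandSin E) / (2 * c₀) - ε * ((-1) ^ i * bandSin E') / (2 * c₀) =
        ε / (2 * c₀) * ((-1) ^ i * (bandSin E - bandSin E')) by ring, abs_mul, abs_neg_one_pow_mul,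
        abs_of_pos (by positivity)]
    have h5 : |bandSin E - bandSin E'| ≤ M ^ 2 * |(bandSin E)⁻¹ - (bandSin E')⁻¹| := by
      have e : bandSin E - bandSin E' =
          -(bandSin E * bandSin E' * ((bandSin E)⁻¹ - (bandSin E')⁻¹)) := by
        field_simp; ring
      rw [e, abs_neg, abs_mul, abs_mul, pow_two]
      gcongr
    rw [h3, h4] at h1
    have h1c : 0 < 1 - c₀ := by linarith
    have h6 : |(bandSin E)⁻¹ - (bandSin E')⁻¹| ≤ x / (1 - c₀) := by
      rw [le_div_iff₀ h1c]; linarith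
    have h7 : 2 / ε * x ≤ C * (ε / (2 * c₀) * (M ^ 2 * (x / (1 - c₀)))) :=
      h1.trans (by gcongr; exact h5.trans (by gcongr))
    -- The difference `x` of slopes controls that of `1 / bandSin`, hence that of `bandSin` and of
    -- `b` with a factor `ε`; the Lipschitz bound and the factor `2 / ε` close the loop with a
    -- contraction.
    have h8 : x ≤ ε ^ 2 * K * x := by
      have : ε / 2 * (2 / ε * x) ≤ ε / 2 * (C * (ε / (2 * c₀) * (M ^ 2 * (x / (1 - c₀))))) := by
        gcongr
      rw [hK]
      calc x = ε / 2 * (2 / ε * x) := by field_simp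
        _ ≤ _ := this
        _ = _ := by field_simp; ring
    have h9 : ε ^ 2 * K < 1 := by
      rw [lt_div_iff₀ (by positivity)] at hεK
      calc ε ^ 2 * K = ε * (ε * K) := by ring
        _ ≤ 1 * (ε * K) := by gcongr
        _ < 1 := by linarith
    have hx0 : x = 0 := by
      have h10 : 0 ≤ x := abs_nonneg _
      by_contra hne
      have h11 := mul_lt_mul_of_pos_right h9 (h10.lt_of_ne' hne)
      linarith
    have h10 := sub_eq_zero.1 (abs_eq_zero.1 hx0)
    exact ((strictAntiOn_bandSlope (by rw [hcabs]; exact hc1.le) i).injOn hE.1 hE'.1 h10).symm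
  · intro E hE hEv
    have hz := (hiff E hE).1.1 hEv
    obtain ⟨hl, hlX⟩ := hspec E hE
    obtain ⟨hbE, hbM⟩ := hbIoc E hE.1 (hlow E hE hEv)
    refine ⟨?_, (hMle E (hlow E hE hEv)).trans (le_max_right _ _)⟩
    have h1 := hasym _ hl _ hbE hz
    rw [hlX] at h1
    have hsum : (∑ k ∈ Finset.range m, g (k + 1)) ^ 2 =
        (∑ k ∈ Finset.range m, γ ((k + 1 : ℕ) : ℤ)) ^ 2 := by
      simp only [hg]
      rw [← Finset.mul_sum, mul_pow, pow_two ν, hν2, one_mul]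
    rw [hsum] at h1
    have e1 : ν * ((-1) ^ i * bandDisc α E) - c₀ -
          ε ^ 2 * bandSin E ^ 2 * (∑ k ∈ Finset.range m, γ ((k + 1 : ℕ) : ℤ)) ^ 2 / (32 * c₀) =
        c₀ * (2 * X E / 2 - 1 - b E ^ 2 *
          (∑ k ∈ Finset.range m, γ ((k + 1 : ℕ) : ℤ)) ^ 2 / 8) := by
      have e2 : b E ^ 2 = ε ^ 2 * bandSin E ^ 2 / (4 * c₀ ^ 2) := by
        simp only [hb]
        rw [div_pow, mul_pow, mul_pow ((-1) ^ i), pow_two ((-1) ^ i), hσ2]; ring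
      rw [e2]
      simp only [hX]
      field_simp
      ring
    rw [e1, abs_mul, abs_of_pos hc0]
    calc c₀ * |2 * X E / 2 - 1 - b E ^ 2 *
          (∑ k ∈ Finset.range m, γ ((k + 1 : ℕ) : ℤ)) ^ 2 / 8| ≤ c₀ * (C * b E ^ 3) := by gcongr
      _ ≤ c₀ * (C * (ε * M / (2 * c₀)) ^ 3) := by
        have := hbE.1.le
        gcongr
      _ = C * M ^ 3 / (8 * c₀ ^ 2) * ε ^ 3 := by field_simp; ring
      _ ≤ _ := by gcongr; exact le_max_left _ _

end Gaps

/-! ### Asymptotics at the band edges -/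

/-- The first order Taylor expansion with quadratic remainder. -/
theorem isBigO_taylor_one {F : Type*} [NormedAddCommGroup F] [NormedSpace ℝ F] {f f' : ℝ → F}
    {x : ℝ} (h : ∀ᶠ y in 𝓝 x, HasDerivAt f (f' y) y) (h' : DifferentiableAt ℝ f' x) :
    (fun y => f y - f x - (y - x) • f' x) =O[𝓝 x] fun y => (y - x) ^ 2 := by
  obtain ⟨C, hC⟩ := h'.isBigO_sub.bound
  obtain ⟨δ, hδ, hball⟩ := Metric.eventually_nhds_iff_ball.1 (h.and hC)
  refine IsBigO.of_bound C ?_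
  filter_upwards [Metric.ball_mem_nhds x hδ] with y hy
  have hsub : ∀ z ∈ uIcc x y, z ∈ Metric.ball x δ := fun z hz => by
    rw [Metric.mem_ball, Real.dist_eq] at hy ⊢
    exact (abs_sub_left_of_mem_uIcc hz).trans_lt hy
  have hC0 : 0 ≤ C * ‖y - x‖ := (norm_nonneg _).trans (hball y hy).2
  have hd : ∀ z ∈ uIcc x y, HasDerivWithinAt (fun z => f z - f x - (z - x) • f' x)
      (f' z - f' x) (uIcc x y) z := fun z hz => by
    have h1 := ((hball z (hsub z hz)).1.sub_const (f x)).sub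
      (((hasDerivAt_id z).sub_const x).smul_const (f' x))
    rw [one_smul] at h1
    exact h1.hasDerivWithinAt
  have hb : ∀ z ∈ uIcc x y, ‖f' z - f' x‖ ≤ C * ‖y - x‖ := fun z hz => by
    rcases eq_or_ne y x with rfl | hyx
    · rw [uIcc_self, mem_singleton_iff] at hz
      simp [hz]
    · refine (hball z (hsub z hz)).2.trans ?_
      have hCn : 0 ≤ C := by
        have : 0 < ‖y - x‖ := norm_pos_iff.2 (sub_ne_zero.2 hyx)
        exact nonneg_of_mul_nonneg_left hC0 this
      exact mul_le_mul_of_nonneg_left (abs_sub_left_of_mem_uIcc hz) hCn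
  have := (convex_uIcc x y).norm_image_sub_le_of_norm_hasDerivWithin_le hd hb
    left_mem_uIcc right_mem_uIcc
  simp only [sub_self, zero_smul, sub_zero] at this
  refine this.trans_eq ?_
  rw [norm_pow]; ring

theorem hasDerivAt_momentum {E : ℝ} (hE : E ≠ 0) :
    HasDerivAt momentum (1 / (2 * momentum E)) E := by
  rcases hE.lt_or_gt with h | h
  · have h2 : (√(-E) : ℂ) ≠ 0 := by exact_mod_cast (Real.sqrt_pos.2 (by linarith : 0 < -E)).ne'
    have h3 := (((hasDerivAt_neg E).sqrt (by simpa using hE)).ofReal_comp).const_mul Complex.I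
    refine (h3.congr_of_eventuallyEq ?_).congr_deriv ?_
    · filter_upwards [gt_mem_nhds h] with x hx
      rw [momentum, if_neg hx.not_ge]
    · rw [momentum, if_neg h.not_ge]
      push_cast
      field_simp
      rw [Complex.I_sq, neg_neg]
  · have h2 : (√E : ℂ) ≠ 0 := by exact_mod_cast (Real.sqrt_pos.2 h).ne'
    have h3 := ((hasDerivAt_id E).sqrt hE).ofReal_comp
    refine (h3.congr_of_eventuallyEq ?_).congr_deriv ?_
    · filter_upwards [lt_mem_nhds h] with x hx
      rw [momentum, if_pos hx.le]; rfl
    · rw [momentum, if_pos h.le]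
      simp only [id]
      push_cast
      rfl

/-- The derivative of `bandDisc` off the origin. -/
noncomputable def bandDiscDeriv (α E : ℝ) : ℝ :=
  -(Real.pi / 2) * bandSin E + α / 4 * ((Real.pi * bandCos E - bandSin E) / (2 * E))

theorem hasDerivAt_bandDisc (α : ℝ) {E : ℝ} (hE : E ≠ 0) :
    HasDerivAt (bandDisc α) (bandDiscDeriv α E) E :=
  (hasDerivAt_bandCos hE).add ((hasDerivAt_bandSin hE).const_mul _)

theorem differentiableAt_bandDiscDeriv (α : ℝ) {E : ℝ} (hE : E ≠ 0) :
    DifferentiableAt ℝ (bandDiscDeriv α) E := by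
  have h1 := (hasDerivAt_bandCos hE).differentiableAt
  have h2 := (hasDerivAt_bandSin hE).differentiableAt
  unfold bandDiscDeriv
  refine (h2.const_mul _).add (DifferentiableAt.const_mul ?_ _)
  exact ((h1.const_mul _).sub h2).div (differentiableAt_id.const_mul 2) (by simpa using hE)

/-- With the level `c = bandDisc α e` the factor `bandSlope c + α / 4` vanishes at `e`, so the
derivative of the discriminant there is `bandSin e` times the strictly negative derivative of the
slope. -/
theorem bandDiscDeriv_ne_zero {α e : ℝ} {i : ℕ} (he : e ∈ dirichletInterval i) (he0 : e ≠ 0)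
    (hd : |bandDisc α e| ≤ 1) : bandDiscDeriv α e ≠ 0 := by
  have hS := bandSin_ne_zero he
  have h1 := bandSlope_deriv_neg hd he he0
  have h2 := bandCos_sq_add e
  have h3 : bandDiscDeriv α e = bandSin e *
      (((bandCos e - bandDisc α e) * bandSin e - Real.pi * (1 - bandDisc α e * bandCos e)) /
        (2 * e * bandSin e ^ 2)) := by
    rw [bandDiscDeriv, bandDisc]
    field_simp
    linear_combination (-4 * Real.pi) * h2
  rw [h3]
  exact mul_ne_zero hS h1.ne

theorem bandDisc_lt_iff {α a : ℝ} {i : ℕ} (ha : a ∈ dirichletInterval i)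
    (ha1 : |bandDisc α a| < 1) {E : ℝ} (hE : E ∈ dirichletInterval i) :
    ((-1) ^ i * bandDisc α a < (-1) ^ i * bandDisc α E ↔ E < a) ∧
      ((-1) ^ i * bandDisc α E < (-1) ^ i * bandDisc α a ↔ a < E) := by
  obtain ⟨r, hr, h⟩ := exists_bandEdge α i (d := (-1) ^ i * bandDisc α a)
    (by rwa [abs_neg_one_pow_mul])
  have : a = r := le_antisymm (not_lt.1 fun h1 => lt_irrefl _ ((h a ha).2.2 h1))
    (not_lt.1 fun h1 => lt_irrefl _ ((h a ha).1.2 h1))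
  subst this
  exact h E hE

/-- A priori the energies may move anywhere in the interval. Points `a'` close to `e` on either side
have levels that are crossed only once, so comparing discriminants with the one at `a'` traps the
energies near `e`. -/
theorem tendsto_of_tendsto_bandDisc {α e : ℝ} {i : ℕ} (he : e ∈ dirichletInterval i)
    (hd : |bandDisc α e| < 1) {ι : Type*} {l : Filter ι} {E : ι → ℝ}
    (hE : ∀ᶠ ε in l, E ε ∈ dirichletInterval i)
    (hlim : Tendsto (fun ε => bandDisc α (E ε)) l (𝓝 (bandDisc α e))) : Tendsto E l (𝓝 e) := by
  have hlim' := hlim.const_mul ((-1 : ℝ) ^ i)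
  have hnear : ∀ᶠ a in 𝓝 e, a ∈ dirichletInterval i ∧ |bandDisc α a| < 1 :=
    (show ∀ᶠ a in 𝓝 e, a ∈ dirichletInterval i from (isOpen_dirichletInterval i).mem_nhds he).and
      ((continuous_bandDisc α).abs.continuousAt.eventually (gt_mem_nhds hd))
  rw [tendsto_order]
  constructor
  · intro a ha
    obtain ⟨a', ⟨ha', hae⟩, hI, h1⟩ :=
      ((Filter.Eventually.and (Ioo_mem_nhdsLT ha) (nhdsWithin_le_nhds hnear)).exists :
        ∃ a', a' ∈ Ioo a e ∧ a' ∈ dirichletInterval i ∧ |bandDisc α a'| < 1)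
    have h2 := (bandDisc_lt_iff hI h1 he).2.2 hae
    filter_upwards [hE, hlim'.eventually (gt_mem_nhds h2)] with ε h3 h4
    exact ha'.trans ((bandDisc_lt_iff hI h1 h3).2.1 h4)
  · intro a ha
    obtain ⟨a', ⟨hae, ha'⟩, hI, h1⟩ :=
      ((Filter.Eventually.and (Ioo_mem_nhdsGT ha) (nhdsWithin_le_nhds hnear)).exists :
        ∃ a', a' ∈ Ioo e a ∧ a' ∈ dirichletInterval i ∧ |bandDisc α a'| < 1)
    have h2 := (bandDisc_lt_iff hI h1 he).1.2 hae
    filter_upwards [hE, hlim'.eventually (lt_mem_nhds h2)] with ε h3 h4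
    exact ((bandDisc_lt_iff hI h1 h3).1.1 h4).trans ha'

/-- The nonzero derivative of the discriminant gives `E ε - e = O(ε ^ 2)`. The quadratic Taylor
remainders and the replacement of `bandSin (E ε)` by `bandSin e` then cost only `O(ε ^ 4)`. -/
theorem momentum_expansion {α e κ : ℝ} {i : ℕ} (he : e ∈ dirichletInterval i) (he0 : e ≠ 0)
    (hd : |bandDisc α e| < 1) {E : ℝ → ℝ}
    (hE : ∀ᶠ ε in 𝓝[>] 0, E ε ∈ dirichletInterval i)
    (hS : (fun ε => bandSin (E ε)) =O[𝓝[>] 0] fun _ => (1 : ℝ))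
    (h : (fun ε : ℝ => bandDisc α (E ε) - bandDisc α e - κ * ε ^ 2 * bandSin (E ε) ^ 2)
      =O[𝓝[>] 0] fun ε => ε ^ 3) :
    (fun ε : ℝ => momentum (E ε) - (momentum e +
      (κ * bandSin e ^ 2 / bandDiscDeriv α e : ℝ) / (2 * momentum e) * (ε : ℂ) ^ 2))
      =O[𝓝[>] 0] fun ε : ℝ => ε ^ 3 := by
  set l : Filter ℝ := 𝓝[>] 0 with hl
  set s : ℝ := bandDiscDeriv α e with hs
  have hs0 : s ≠ 0 := bandDiscDeriv_ne_zero he he0 hd.le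
  have hid : Tendsto (fun ε : ℝ => ε) l (𝓝 0) := nhdsWithin_le_nhds
  have h32 : (fun ε : ℝ => ε ^ 3) =O[l] fun ε => ε ^ 2 :=
    (isLittleO_pow_pow (by norm_num)).isBigO.mono nhdsWithin_le_nhds
  have h43 : (fun ε : ℝ => ε ^ 4) =O[l] fun ε => ε ^ 3 :=
    (isLittleO_pow_pow (by norm_num)).isBigO.mono nhdsWithin_le_nhds
  have h1 : (fun ε : ℝ => bandDisc α (E ε) - bandDisc α e) =O[l] fun ε => ε ^ 2 := by
    have h2 : (fun ε : ℝ => κ * ε ^ 2 * bandSin (E ε) ^ 2) =O[l] fun ε => ε ^ 2 := by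
      simpa using (((isBigO_refl (fun ε : ℝ => ε ^ 2) l).const_mul_left κ).mul (hS.pow 2))
    simpa using (h.trans h32).add h2
  have hlimE : Tendsto E l (𝓝 e) := by
    refine tendsto_of_tendsto_bandDisc he hd hE ?_
    have h2 : Tendsto (fun ε : ℝ => ε ^ 2) l (𝓝 0) := by simpa using hid.pow 2
    have h3 := (h1.trans_tendsto h2).add_const (bandDisc α e)
    simpa using h3
  have hderiv := hasDerivAt_bandDisc α he0
  have hEe : (fun ε => E ε - e) =O[l] fun ε => ε ^ 2 :=
    ((HasDerivAtFilter.isTheta_sub hderiv hs0).isBigO_symm.comp_tendsto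
      (hlimE.prodMk (tendsto_const_pure (b := e)))).trans h1
  have hEe2 : (fun ε => (E ε - e) ^ 2) =O[l] fun ε => ε ^ 3 := by
    refine (hEe.pow 2).trans ?_
    simpa [← pow_mul] using h43
  have hne : ∀ᶠ y in 𝓝 e, y ≠ 0 := isOpen_ne.mem_nhds he0
  have hT1 : (fun ε => bandDisc α (E ε) - bandDisc α e - (E ε - e) * s) =O[l] fun ε => ε ^ 3 :=
    ((isBigO_taylor_one (hne.mono fun y hy => hasDerivAt_bandDisc α hy)
      (differentiableAt_bandDiscDeriv α he0)).comp_tendsto hlimE).trans hEe2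
  have hk0 : momentum e ≠ 0 := fun h => he0 (momentum_eq_zero.1 h)
  have hT2 : (fun ε => momentum (E ε) - momentum e - (E ε - e) • (1 / (2 * momentum e)))
      =O[l] fun ε => ε ^ 3 := by
    refine ((isBigO_taylor_one (f' := fun E => 1 / (2 * momentum E))
      (hne.mono fun y hy => hasDerivAt_momentum hy) ?_).comp_tendsto hlimE).trans hEe2
    exact (differentiableAt_const _).div ((hasDerivAt_momentum he0).differentiableAt.const_mul _)
      (mul_ne_zero two_ne_zero hk0)
  have hSd : (fun ε => bandSin (E ε) ^ 2 - bandSin e ^ 2) =O[l] fun ε => ε ^ 2 := by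
    have h2 := ((hasDerivAt_bandSin he0).pow 2).isBigO_sub
    exact (h2.comp_tendsto hlimE).trans hEe
  have hSd' : (fun ε : ℝ => κ * ε ^ 2 * (bandSin (E ε) ^ 2 - bandSin e ^ 2)) =O[l]
      fun ε => ε ^ 3 := by
    refine (((isBigO_refl (fun ε : ℝ => ε ^ 2) l).const_mul_left κ).mul hSd).trans ?_
    simpa [← pow_add] using h43
  have hreal : (fun ε => (E ε - e) - κ * bandSin e ^ 2 / s * ε ^ 2) =O[l] fun ε => ε ^ 3 := by
    have h2 := ((h.add hSd').sub hT1).const_mul_left (1 / s)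
    refine h2.congr_left fun ε => ?_
    field_simp
    ring
  have hcomplex : (fun ε => 1 / (2 * momentum e) *
      (((E ε - e) - κ * bandSin e ^ 2 / s * ε ^ 2 : ℝ) : ℂ)) =O[l] fun ε => ε ^ 3 := by
    have h2 : (fun ε => (((E ε - e) - κ * bandSin e ^ 2 / s * ε ^ 2 : ℝ) : ℂ)) =O[l]
        fun ε => ε ^ 3 := by
      refine IsBigO.trans (IsBigO.of_bound 1 (Eventually.of_forall fun ε => ?_)) hreal
      rw [Complex.norm_real, one_mul]
    exact h2.const_mul_left _
  refine (hT2.add hcomplex).congr_left fun ε => ?_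
  rw [Complex.real_smul]
  push_cast
  ring

/-! ### The gaps -/

/-- Open preconnected sets which cover the complement of `S` and increase are its gaps. -/
theorem enumeratesGaps_of_cover {S : Set ℝ} {G : ℕ+ → Set ℝ} (ho : ∀ n, IsOpen (G n))
    (hc : ∀ n, IsPreconnected (G n)) (hne : ∀ n, (G n).Nonempty) (hcover : ⋃ n, G n = Sᶜ)
    (hlt : ∀ m n, m < n → ∀ x ∈ G m, ∀ y ∈ G n, x < y) : EnumeratesGaps S G := by
  have hcomp : ∀ n, ∀ x ∈ G n, connectedComponentIn Sᶜ x = G n := by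
    intro n x hx
    have hxS : x ∈ Sᶜ := hcover ▸ mem_iUnion_of_mem n hx
    refine Subset.antisymm ?_ ((hc n).subset_connectedComponentIn hx
      (hcover ▸ subset_iUnion G n))
    have hd : Disjoint (G n) (⋃ k ∈ {k | k ≠ n}, G k) := by
      rw [disjoint_iUnion₂_right]
      intro k hk
      rw [Set.disjoint_left]
      intro y hy hy'
      rcases lt_or_gt_of_ne hk with h | h
      exacts [lt_irrefl _ (hlt k n h y hy' y hy), lt_irrefl _ (hlt n k h y hy y hy')]
    -- The component is covered by the disjoint open sets `G n` and the union of the others, and it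
    -- meets `G n`.
    refine isPreconnected_connectedComponentIn.subset_left_of_subset_union (ho n)
      (isOpen_biUnion fun k _ => ho k) hd ?_ ⟨x, mem_connectedComponentIn hxS, hx⟩
    refine (connectedComponentIn_subset _ _).trans ?_
    rw [← hcover]
    refine iUnion_subset fun k => ?_
    rcases eq_or_ne k n with rfl | hk
    · exact subset_union_left
    · exact (subset_biUnion_of_mem (u := G) hk).trans subset_union_right
  refine ⟨fun I => ⟨?_, ?_⟩, hlt⟩
  · rintro ⟨x, hx, rfl⟩
    rw [← hcover, mem_iUnion] at hx
    obtain ⟨n, hn⟩ := hx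
    exact ⟨n, (hcomp n x hn).symm⟩
  · rintro ⟨n, rfl⟩
    obtain ⟨x, hx⟩ := hne n
    exact ⟨x, hcover ▸ mem_iUnion_of_mem n hx, (hcomp n x hx).symm⟩

/-- The number of the Dirichlet interval that contains the gap number `n`. -/
def gapIndex (n : ℕ+) : ℕ := ((n : ℕ) - 1) / 2

/-- The side of the Dirichlet interval on which the gap number `n` lies. -/
noncomputable def gapSign (n : ℕ+) : ℝ := if Odd (n : ℕ) then 1 else -1

theorem gapSign_eq (n : ℕ+) : gapSign n = 1 ∨ gapSign n = -1 := by
  unfold gapSign; split_ifs <;> simp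

/-- The gaps number `2 i + 1` and `2 i + 2` share the interval number `i`, the odd one lying to the
left. -/
theorem gapIndex_lt_or {m n : ℕ+} (h : m < n) :
    gapIndex m < gapIndex n ∨ gapIndex m = gapIndex n ∧ gapSign m = 1 ∧ gapSign n = -1 := by
  have h' : (m : ℕ) < n := h
  have hm := m.pos
  unfold gapIndex gapSign
  by_cases hi : ((m : ℕ) - 1) / 2 < ((n : ℕ) - 1) / 2
  · exact Or.inl hi
  · refine Or.inr ⟨by omega, if_pos ?_, if_neg ?_⟩
    · rw [Nat.odd_iff]; omega
    · rw [Nat.odd_iff]; omega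

theorem exists_gapIndex_eq (i : ℕ) {ν : ℝ} (hν : ν = 1 ∨ ν = -1) :
    ∃ n, gapIndex n = i ∧ gapSign n = ν := by
  rcases hν with rfl | rfl
  · refine ⟨⟨2 * i + 1, by omega⟩, ?_, if_pos ?_⟩
    · simp [gapIndex]
    · rw [PNat.mk_coe, Nat.odd_iff]; omega
  · refine ⟨⟨2 * i + 2, by omega⟩, ?_, if_neg ?_⟩
    · simp only [gapIndex, PNat.mk_coe]; omega
    · rw [PNat.mk_coe, Nat.odd_iff]; omega

theorem lt_of_mem_dirichletInterval {i j : ℕ} (h : i < j) {x y : ℝ}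
    (hx : x ∈ dirichletInterval i) (hy : y ∈ dirichletInterval j) : x < y := by
  have h1 := hy.1.resolve_left (by omega)
  have h2 : (i : ℝ) + 1 ≤ j := by exact_mod_cast h
  have h3 : ((i : ℝ) + 1) ^ 2 ≤ (j : ℝ) ^ 2 := by gcongr
  exact hx.2.trans (h3.trans_lt h1)

/-- The band edge next to the gap number `n`. -/
theorem exists_gapEdge (α : ℝ) {c : ℝ} (hc : 0 < c) (hc1 : c < 1) (n : ℕ+) :
    ∃ r ∈ dirichletInterval (gapIndex n), ∀ E ∈ dirichletInterval (gapIndex n),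
      (gapSign n * c < (-1) ^ gapIndex n * bandDisc α E ↔ E < r) ∧
        ((-1) ^ gapIndex n * bandDisc α E < gapSign n * c ↔ r < E) := by
  refine exists_bandEdge α (gapIndex n) ?_
  rcases gapSign_eq n with h | h <;> rw [h, abs_mul, abs_of_pos hc] <;> simpa using hc1

/-! ### Numbering of the gaps and of the band edges -/

section Enumeration

variable {α c : ℝ} {e : ℕ+ → ℝ}

theorem isOpen_gapRegion (α c ν : ℝ) (i : ℕ) : IsOpen (gapRegion α c ν i) :=
  (isOpen_dirichletInterval i).inter (isOpen_lt continuous_const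
    (continuous_const.mul (continuous_const.mul (continuous_bandDisc α))))

theorem iUnion_gapRegion (α c : ℝ) :
    ⋃ n, gapRegion α c (gapSign n) (gapIndex n) =
      {E | |bandDisc α E| ≤ c ∨ bandSin E = 0}ᶜ := by
  ext E
  simp only [mem_iUnion, mem_compl_iff, mem_ofPred_eq, not_or, not_le]
  constructor
  · rintro ⟨n, hI, h⟩
    refine ⟨h.trans_le ((le_abs_self _).trans_eq ?_), bandSin_ne_zero hI⟩
    rw [abs_mul, abs_neg_one_pow_mul]
    rcases gapSign_eq n with h | h <;> rw [h] <;> simp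
  · rintro ⟨h1, h2⟩
    rcases mem_dirichletInterval_or E with ⟨i, hi⟩ | h
    · rw [← abs_neg_one_pow_mul i, lt_abs] at h1
      rcases h1 with h1 | h1
      · obtain ⟨n, hn, hs⟩ := exists_gapIndex_eq i (Or.inl rfl)
        exact ⟨n, by rw [hn, hs]; exact ⟨hi, by rwa [one_mul]⟩⟩
      · obtain ⟨n, hn, hs⟩ := exists_gapIndex_eq i (Or.inr rfl)
        exact ⟨n, by rw [hn, hs]; exact ⟨hi, by rwa [neg_one_mul]⟩⟩
    · exact absurd (bandSin_eq_zero_iff.2 h) h2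

theorem gapRegion_eq
    (hE : ∀ n, ∀ E ∈ dirichletInterval (gapIndex n),
      (gapSign n * c < (-1) ^ gapIndex n * bandDisc α E ↔ E < e n) ∧
        ((-1) ^ gapIndex n * bandDisc α E < gapSign n * c ↔ e n < E)) (n : ℕ+) :
    (gapSign n = 1 ∧ gapRegion α c (gapSign n) (gapIndex n) =
      dirichletInterval (gapIndex n) ∩ Iio (e n)) ∨
    (gapSign n = -1 ∧ gapRegion α c (gapSign n) (gapIndex n) =
      dirichletInterval (gapIndex n) ∩ Ioi (e n)) := by
  rcases gapSign_eq n with h | h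
  · refine Or.inl ⟨h, ?_⟩
    ext E
    refine and_congr_right fun hI => ?_
    have := (hE n E hI).1
    rw [h, one_mul] at this
    rw [h, one_mul, mem_Iio]
    exact this
  · refine Or.inr ⟨h, ?_⟩
    ext E
    refine and_congr_right fun hI => ?_
    have := (hE n E hI).2
    rw [h, neg_one_mul] at this
    rw [h, neg_one_mul, mem_Ioi, lt_neg]
    exact this

theorem enumeratesGaps_gapRegion (hc : 0 < c)
    (he : ∀ n, e n ∈ dirichletInterval (gapIndex n))
    (hE : ∀ n, ∀ E ∈ dirichletInterval (gapIndex n),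
      (gapSign n * c < (-1) ^ gapIndex n * bandDisc α E ↔ E < e n) ∧
        ((-1) ^ gapIndex n * bandDisc α E < gapSign n * c ↔ e n < E)) :
    EnumeratesGaps {E | |bandDisc α E| ≤ c ∨ bandSin E = 0}
      (fun n => gapRegion α c (gapSign n) (gapIndex n)) := by
  refine enumeratesGaps_of_cover (fun n => isOpen_gapRegion _ _ _ _) (fun n => ?_) (fun n => ?_)
    (iUnion_gapRegion _ _) fun m n hmn x hx y hy => ?_
  · have h1 := ordConnected_dirichletInterval (gapIndex n)
    rcases gapRegion_eq hE n with ⟨-, h⟩ | ⟨-, h⟩ <;> rw [h]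
    exacts [(h1.inter ordConnected_Iio).isPreconnected, (h1.inter ordConnected_Ioi).isPreconnected]
  · have h1 : ∀ᶠ E in 𝓝 (e n), E ∈ dirichletInterval (gapIndex n) :=
      (isOpen_dirichletInterval _).mem_nhds (he n)
    rcases gapRegion_eq hE n with ⟨-, h⟩ | ⟨-, h⟩
    · obtain ⟨E, hE1, hE2⟩ := (Filter.Eventually.and (nhdsWithin_le_nhds h1)
        (self_mem_nhdsWithin : ∀ᶠ E in 𝓝[<] (e n), E ∈ Iio (e n))).exists
      exact ⟨E, h.symm ▸ ⟨hE1, hE2⟩⟩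
    · obtain ⟨E, hE1, hE2⟩ := (Filter.Eventually.and (nhdsWithin_le_nhds h1)
        (self_mem_nhdsWithin : ∀ᶠ E in 𝓝[>] (e n), E ∈ Ioi (e n))).exists
      exact ⟨E, h.symm ▸ ⟨hE1, hE2⟩⟩
  · rcases gapIndex_lt_or hmn with h | ⟨hi, hm, hn⟩
    · exact lt_of_mem_dirichletInterval h hx.1 hy.1
    · rw [hn] at hy
      rw [hm] at hx
      have hyI : y ∈ dirichletInterval (gapIndex m) := hi ▸ hy.1
      -- Both gaps lie in the same interval, and the edge `e m` of the left one already separates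
      -- them.
      have h1 := (hE m x hx.1).1
      have h2 := (hE m y hyI).2
      have hx2 := hx.2
      have hy2 := hy.2
      rw [hm, one_mul] at h1 h2
      rw [← hi] at hy2
      exact (h1.1 (by linarith)).trans (h2.1 (by linarith))

theorem bandDisc_gapEdge (he : ∀ n, e n ∈ dirichletInterval (gapIndex n))
    (hE : ∀ n, ∀ E ∈ dirichletInterval (gapIndex n),
      (gapSign n * c < (-1) ^ gapIndex n * bandDisc α E ↔ E < e n) ∧
        ((-1) ^ gapIndex n * bandDisc α E < gapSign n * c ↔ e n < E)) (n : ℕ+) :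
    bandDisc α (e n) = gapSign n * (-1) ^ gapIndex n * c := by
  have h1 := bandDisc_bandEdge α _ (he n) (hE n)
  have h2 := neg_one_pow_mul_self (gapIndex n)
  linear_combination (-1) ^ gapIndex n * h1 - bandDisc α (e n) * h2

theorem strictMono_gapEdge (hc : 0 < c) (he : ∀ n, e n ∈ dirichletInterval (gapIndex n))
    (hE : ∀ n, ∀ E ∈ dirichletInterval (gapIndex n),
      (gapSign n * c < (-1) ^ gapIndex n * bandDisc α E ↔ E < e n) ∧
        ((-1) ^ gapIndex n * bandDisc α E < gapSign n * c ↔ e n < E)) : StrictMono e := by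
  intro m n hmn
  rcases gapIndex_lt_or hmn with h | ⟨hi, hm, hn⟩
  · exact lt_of_mem_dirichletInterval h (he m) (he n)
  · have h1 := bandDisc_bandEdge α _ (he n) (hE n)
    rw [hn, ← hi] at h1
    have h2 := (hE m (e n) (hi ▸ he n)).2
    rw [hm, h1] at h2
    exact h2.1 (by linarith)

theorem range_gapEdge (hc : 0 < c) (hc1 : c < 1) (he : ∀ n, e n ∈ dirichletInterval (gapIndex n))
    (hE : ∀ n, ∀ E ∈ dirichletInterval (gapIndex n),
      (gapSign n * c < (-1) ^ gapIndex n * bandDisc α E ↔ E < e n) ∧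
        ((-1) ^ gapIndex n * bandDisc α E < gapSign n * c ↔ e n < E)) :
    range e = {E | |bandDisc α E| = c} := by
  ext E
  constructor
  · rintro ⟨n, rfl⟩
    rw [mem_ofPred_eq, ← abs_neg_one_pow_mul (gapIndex n), bandDisc_bandEdge α _ (he n) (hE n),
      abs_mul, abs_of_pos hc]
    rcases gapSign_eq n with h | h <;> rw [h] <;> simp
  · intro h
    rw [mem_ofPred_eq] at h
    rcases mem_dirichletInterval_or E with ⟨i, hi⟩ | ⟨j, rfl⟩
    · have key : ∀ ν : ℝ, (ν = 1 ∨ ν = -1) → (-1) ^ i * bandDisc α E = ν * c → E ∈ range e := by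
        intro ν hν h1
        obtain ⟨n, rfl, rfl⟩ := exists_gapIndex_eq i hν
        refine ⟨n, le_antisymm (not_lt.1 fun h2 => ?_) (not_lt.1 fun h2 => ?_)⟩
        · exact absurd ((hE n E hi).1.2 h2) (by rw [h1]; exact lt_irrefl _)
        · exact absurd ((hE n E hi).2.2 h2) (by rw [h1]; exact lt_irrefl _)
      rw [← abs_neg_one_pow_mul i] at h
      rcases (abs_eq hc.le).1 h with h1 | h1
      · exact key 1 (Or.inl rfl) (by rw [h1, one_mul])
      · exact key (-1) (Or.inr rfl) (by rw [h1, neg_one_mul])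
    · rw [bandDisc_nat_sq, abs_pow, abs_neg, abs_one, one_pow] at h
      linarith

end Enumeration

/-- The essential spectrum does not depend on finitely many couplings. -/
theorem essSpectrum_chainLaplacian {A α : ℝ} {β : ℤ → ℝ} (F : Finset ℤ)
    (hβ : ∀ j ∉ F, β j = α) (hc : Real.cos (A * Real.pi) ≠ 0) :
    essSpectrum (chainLaplacian A β) =
      {E | |bandDisc α E| ≤ |Real.cos (A * Real.pi)| ∨ bandSin E = 0} := by
  have hc0 : 0 < |Real.cos (A * Real.pi)| := abs_pos.2 hc
  have hξ : ∀ E, |bandXi A α E| ≤ 1 ↔ |bandDisc α E| ≤ |Real.cos (A * Real.pi)| := fun E => by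
    rw [bandXi_eq, abs_div, div_le_one hc0]
  ext E
  rw [mem_ofPred_eq, ← hξ]
  constructor
  · intro h
    by_contra hcon
    push Not at hcon
    exact not_mem_essSpectrum F hβ hc hcon.2 hcon.1 h
  · intro h
    by_cases hS : bandSin E = 0
    · exact mem_essSpectrum_of_bandSin_eq_zero A β hS
    · exact mem_essSpectrum_of_abs_le_one F hβ hc hS (h.resolve_right hS)

/-! ### The expansion -/

/-- The bracket in the denominator of `chainK` is `-64 e / bandSin e` times the derivative of the
discriminant. Once this is inserted, both sides are rational in the same quantities and differ only
by `|cos(Aπ)| ^ 2 = cos(Aπ) ^ 2`. -/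
theorem edge_coefficient {A α e s ν : ℝ} {i : ℕ} (hc : Real.cos (A * Real.pi) ≠ 0)
    (he : e ∈ dirichletInterval i) (he0 : e ≠ 0)
    (hd : bandDisc α e = ν * (-1) ^ i * |Real.cos (A * Real.pi)|)
    (hs : bandDiscDeriv α e ≠ 0) :
    -(chainXi A α (momentum e) * chainK A α s (momentum e)) =
      (ν * (-1) ^ i * s ^ 2 / (32 * |Real.cos (A * Real.pi)|) * bandSin e ^ 2 /
        bandDiscDeriv α e : ℝ) / (2 * momentum e) := by
  set k := momentum e with hk
  have hk0 : k ≠ 0 := fun h => he0 (momentum_eq_zero.1 h)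
  have hk2 : k ^ 2 = e := momentum_sq e
  have hS := bandSin_ne_zero he
  have hcos : Complex.cos (k * Real.pi) = bandCos e := edgeCos_pi e
  have hsin : Complex.sin (k * Real.pi) = k * bandSin e := by
    have := edgeSin_pi e
    rw [edgeSin, ← hk, if_neg hk0] at this
    rw [← this]; field_simp
  have hS' : (bandSin e : ℂ) ≠ 0 := by exact_mod_cast hS
  have he0' : (e : ℂ) ≠ 0 := by exact_mod_cast he0
  have hc' : (Real.cos (A * Real.pi) : ℂ) ≠ 0 := by exact_mod_cast hc
  have hs' : (bandDiscDeriv α e : ℂ) ≠ 0 := by exact_mod_cast hs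
  have hden : (32 * k ^ 2 * Real.pi - 8 * α * k * Real.pi * Complex.cot (k * Real.pi) + 8 * α : ℂ) =
      -(64 * e / bandSin e) * bandDiscDeriv α e := by
    rw [Complex.cot, hcos, hsin, hk2, bandDiscDeriv]
    push_cast
    field_simp
    ring
  have hxi : chainXi A α k = (bandDisc α e : ℂ) / Real.cos (A * Real.pi) := by
    rw [hk, chainXi_momentum, bandXi_eq]; push_cast; rfl
  have hc0 : (|Real.cos (A * Real.pi)| : ℝ) ≠ 0 := abs_ne_zero.2 hc
  have hsq : ((|Real.cos (A * Real.pi)| : ℝ) : ℂ) ^ 2 = (Real.cos (A * Real.pi) : ℂ) ^ 2 := by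
    rw [← Complex.ofReal_pow, sq_abs, Complex.ofReal_pow]
  rw [hxi, chainK, hden, hsin, hd]
  generalize |Real.cos (A * Real.pi)| = c at *
  generalize Real.cos (A * Real.pi) = d at *
  have hc0' : (c : ℂ) ≠ 0 := by exact_mod_cast hc0
  generalize bandDiscDeriv α e = D at *
  rw [← hk2]
  push_cast
  field_simp
  linear_combination (64 * (ν : ℂ) * (s : ℂ) ^ 2) * hsq

theorem weakCouplingEigenvalues_of_sign {A α : ℝ} {m : ℕ} {γ : ℤ → ℝ}
    (hc : Real.cos (A * Real.pi) ≠ 0) (hc1 : |Real.cos (A * Real.pi)| < 1) {e : ℕ+ → ℝ}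
    (he : ∀ n, e n ∈ dirichletInterval (gapIndex n))
    (hd : ∀ n, bandDisc α (e n) = gapSign n * (-1) ^ gapIndex n * |Real.cos (A * Real.pi)|)
    {ν : ℝ} (hν : ν = 1 ∨ ν = -1) (hs : ν * ∑ j ∈ Finset.Icc (1 : ℤ) m, γ j < 0)
    {P : Set ℕ+} (hP : ∀ n ∈ P, gapSign n = ν) :
    WeakCouplingEigenvalues A α m γ
      (fun n => gapRegion α |Real.cos (A * Real.pi)| (gapSign n) (gapIndex n)) e P := by
  have hsum : ∑ j ∈ Finset.Icc (1 : ℤ) m, γ j = ∑ k ∈ Finset.range m, γ ((k + 1 : ℕ) : ℤ) := by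
    refine (Finset.sum_nbij' (fun k : ℕ => ((k + 1 : ℕ) : ℤ)) (fun j : ℤ => (j - 1).toNat)
      ?_ ?_ ?_ ?_ ?_).symm
    · intro k hk; rw [Finset.mem_range] at hk; rw [Finset.mem_Icc]; omega
    · intro j hj; rw [Finset.mem_Icc] at hj; rw [Finset.mem_range]; omega
    · intro k _; simp
    · intro j hj; rw [Finset.mem_Icc] at hj; omega
    · intro k _; rfl
  rw [hsum, Finset.mul_sum] at hs
  obtain ⟨ε₀, hε₀, C, hC, h⟩ := exists_gap_eigenvalues (A := A) (α := α) hc hc1 hν hs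
  have hex : ∀ (i : ℕ) (ε : ℝ), ∃ E, ε ∈ Ioo 0 ε₀ →
      E ∈ gapRegion α |Real.cos (A * Real.pi)| ν i ∧
        IsSimpleOpEigenvalue (chainLaplacian A (perturbedCoupling α m γ ε)) E ∧
        ∀ E' ∈ gapRegion α |Real.cos (A * Real.pi)| ν i,
          IsOpEigenvalue (chainLaplacian A (perturbedCoupling α m γ ε)) E' → E' = E := by
    intro i ε
    by_cases hε : ε ∈ Ioo 0 ε₀
    · obtain ⟨E, hE⟩ := (h ε hε i).1
      exact ⟨E, fun _ => hE⟩
    -- A dummy value: nothing is claimed for `ε` outside the interval.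
    · exact ⟨0, fun h => absurd h hε⟩
  choose ev hev using hex
  refine ⟨fun n ε => ev (gapIndex n) ε, ⟨ε₀, hε₀, fun ε hε n hn => ?_⟩, fun n hn he0 => ?_⟩
  · simp only [hP n hn]
    exact hev (gapIndex n) ε hε
  · rw [hsum]
    set i := gapIndex n with hi
    have hν2 : ν * ν = 1 := by rcases hν with rfl | rfl <;> norm_num
    have hσ2 := neg_one_pow_mul_self i
    have hdn := hd n
    rw [hP n hn, ← hi] at hdn
    have hc0 : 0 < |Real.cos (A * Real.pi)| := abs_pos.2 hc
    have hνabs : |ν| = 1 := by rcases hν with rfl | rfl <;> simp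
    have hdabs : |bandDisc α (e n)| < 1 := by
      rw [hdn, mul_assoc, abs_mul, abs_neg_one_pow_mul, hνabs, one_mul, abs_abs]; exact hc1
    have hsmall : ∀ᶠ ε in 𝓝[>] (0 : ℝ), ε ∈ Ioo 0 ε₀ := Ioo_mem_nhdsGT hε₀
    have hbound : ∀ ε ∈ Ioo 0 ε₀, _ := fun ε hε =>
      (h ε hε i).2 (ev i ε) (hev i ε hε).1 (by
        rw [IsOpEigenvalue]
        intro hbot
        have h1 := (hev i ε hε).2.1
        rw [IsSimpleOpEigenvalue, hbot, finrank_bot] at h1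
        exact zero_ne_one h1)
    have hexp := momentum_expansion (E := ev i)
      (κ := ν * (-1) ^ i * (∑ k ∈ Finset.range m, γ ((k + 1 : ℕ) : ℤ)) ^ 2 /
        (32 * |Real.cos (A * Real.pi)|)) (he n) he0 hdabs
      (hsmall.mono fun ε hε => (hev i ε hε).1.1)
      (IsBigO.of_bound C (hsmall.mono fun ε hε => by
        rw [norm_one, mul_one, Real.norm_eq_abs]; exact (hbound ε hε).2))
      (IsBigO.of_bound C (hsmall.mono fun ε hε => by
        have h1 := (hbound ε hε).1
        rw [Real.norm_eq_abs, Real.norm_eq_abs, abs_of_pos (pow_pos hε.1 3)]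
        have e1 : bandDisc α (ev i ε) - bandDisc α (e n) -
            ν * (-1) ^ i * (∑ k ∈ Finset.range m, γ ((k + 1 : ℕ) : ℤ)) ^ 2 /
              (32 * |Real.cos (A * Real.pi)|) * ε ^ 2 * bandSin (ev i ε) ^ 2 =
            ν * ((-1) ^ i * (ν * ((-1) ^ i * bandDisc α (ev i ε)) - |Real.cos (A * Real.pi)| -
              ε ^ 2 * bandSin (ev i ε) ^ 2 * (∑ k ∈ Finset.range m, γ ((k + 1 : ℕ) : ℤ)) ^ 2 /
                (32 * |Real.cos (A * Real.pi)|))) := by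
          rw [hdn]
          linear_combination (-(ν * ν) * bandDisc α (ev i ε)) * hσ2 - bandDisc α (ev i ε) * hν2
        rw [e1, abs_mul, hνabs, one_mul, abs_neg_one_pow_mul]
        exact h1))
    rw [← edge_coefficient hc (he n) he0 hdn
      (bandDiscDeriv_ne_zero (he n) he0 hdabs.le)] at hexp
    refine hexp.congr_left fun ε => ?_
    ring

theorem mainTheorem9 (A α : ℝ) (hA : ∀ z : ℤ, A ≠ z) (hA' : ∀ z : ℤ, A - 1 / 2 ≠ z)
    (m : ℕ) (γ : ℤ → ℝ) :
    -- the essential spectrum is preserved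
    (∀ ε ∈ Set.Ioo (0 : ℝ) 1,
      essSpectrum (chainLaplacian A (perturbedCoupling α m γ ε)) =
        essSpectrum (chainLaplacian A fun _ => α)) ∧
    -- its gaps are `G 1, G 2, …`, and `e 1 < e 2 < …` are the energies with `|ξ(k)| = 1`
    ∃ (G : ℕ+ → Set ℝ) (e : ℕ+ → ℝ),
      EnumeratesGaps (essSpectrum (chainLaplacian A fun _ => α)) G ∧
      StrictMono e ∧ Set.range e = {E : ℝ | ‖chainXi A α (momentum E)‖ = 1} ∧
      (∑ j ∈ Finset.Icc (1 : ℤ) m, γ j < 0 →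
        WeakCouplingEigenvalues A α m γ G e {n : ℕ+ | Odd (n : ℕ)}) ∧
      (0 < ∑ j ∈ Finset.Icc (1 : ℤ) m, γ j →
        WeakCouplingEigenvalues A α m γ G e {n : ℕ+ | Even (n : ℕ)}) := by
  have hpi := Real.pi_ne_zero
  have hc : Real.cos (A * Real.pi) ≠ 0 := by
    rw [Real.cos_ne_zero_iff]
    intro k hk
    refine hA' k ?_
    have : A * Real.pi = ((2 * k + 1) / 2) * Real.pi := by rw [hk]; ring
    rw [mul_right_cancel₀ hpi this]; ring
  -- At the positive zeros of `sin kπ` the discriminant has modulus 1, so strictness keeps these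
  -- energies away from the bands and all gaps open.
  have hc1 : |Real.cos (A * Real.pi)| < 1 := by
    have hs : Real.sin (A * Real.pi) ≠ 0 := by
      rw [Real.sin_ne_zero_iff]
      intro k hk
      exact hA k (mul_right_cancel₀ hpi hk).symm
    have h1 := Real.sin_sq_add_cos_sq (A * Real.pi)
    rw [← sq_lt_one_iff_abs_lt_one]
    have : 0 < Real.sin (A * Real.pi) ^ 2 := by positivity
    linarith
  have hc0 : 0 < |Real.cos (A * Real.pi)| := abs_pos.2 hc
  have hess : essSpectrum (chainLaplacian A fun _ => α) =
      {E | |bandDisc α E| ≤ |Real.cos (A * Real.pi)| ∨ bandSin E = 0} :=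
    essSpectrum_chainLaplacian ∅ (fun _ _ => rfl) hc
  refine ⟨fun ε _ => ?_, ?_⟩
  · rw [hess]
    exact essSpectrum_chainLaplacian (Finset.Icc 1 (m : ℤ))
      (fun j hj => by rw [perturbedCoupling, if_neg hj]) hc
  choose e he hE using exists_gapEdge α hc0 hc1
  have hd := bandDisc_gapEdge he hE
  refine ⟨fun n => gapRegion α |Real.cos (A * Real.pi)| (gapSign n) (gapIndex n), e, ?_,
    strictMono_gapEdge hc0 he hE, ?_, fun hs => ?_, fun hs => ?_⟩
  · rw [hess]
    exact enumeratesGaps_gapRegion hc0 he hE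
  · rw [range_gapEdge hc0 hc1 he hE]
    ext E
    rw [mem_ofPred_eq, mem_ofPred_eq, chainXi_momentum, Complex.norm_real, Real.norm_eq_abs, bandXi_eq,
      abs_div, div_eq_one_iff_eq hc0.ne']
  · exact weakCouplingEigenvalues_of_sign hc hc1 he hd (Or.inl rfl) (by rwa [one_mul])
      fun n hn => if_pos hn
  · exact weakCouplingEigenvalues_of_sign hc hc1 he hd (Or.inr rfl) (by linarith)
      fun n hn => if_neg (Nat.not_odd_iff_even.2 hn)
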